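/- **Notation.** Let $d\in\mathbb N_0$, $\mathbb R^d_+=(0,\infty)^d$, and $|n|=n_1+\dots+n_d$ for $n\in\mathbb N_0^d$. Let $$L_j(t)=\frac{e^t}{j!}\frac{d^j}{dt^j}\bigl(e^{-t}t^j\bigr),\qquad l_n(x)=\prod_{j=1}^d L_{n_j}(x_j)e^{-x_j/2},\qquad E=-\sum_{j=1}^d\Bigl(x_j\partial_j^2+\partial_j-\frac{x_j}{4}+\frac12\Bigr)$$ be the Laguerre polynomials, the Laguerre functions and the Laguerre operator. For $f\in L^2(\mathbb R^d_+)$ (complex valued) let $a_n(f)=\int_{\mathbb R^d_+}f(x)l_n(x)\,dx$ be its Laguerre coefficients. For $\beta,h>0$ and a complex sequence $a=(a_n)_{n\in\mathbb N_0^d}$ put $\|a\|_{h,\beta}=\sup_n|a_n|e^{h|n|^{1/(2\beta)}}$. Let $\ell_\beta$ (resp. $\ell_{0,\beta}$) be the space of all $a$ with $\|a\|_{h,\beta}<\infty$ for some (resp. every) $h>0$. It carries the locally convex inductive limit topology (resp. the projective limit topology) of the normed spaces $\{a:\|a\|_{h,\beta}<\infty\}$, $h>0$. For $\alpha,h>0$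 put $$\eta^\alpha_h(f)=\sup_{N\in\mathbb N_0}\frac{\|E^Nf\|_{L^2(\mathbb R^d_+)}}{h^N\,N!^{\alpha}} .$$ Let $\mathbf G^\alpha_\alpha(\mathbb R^d_+)$ (resp. $\mathbf g^\alpha_\alpha(\mathbb R^d_+)$) be the space of all $f\in C^\infty(\mathbb R^d_+)$ all of whose derivatives extend continuously to $[0,\infty)^d$ and which satisfy $\eta^\alpha_h(f)<\infty$ for some (resp. every) $h>0$. It carries the locally convex inductive limit topology (resp. the projective limit topology) of the normed spaces $\{f:\eta^\alpha_h(f)<\infty\}$, $h>0$, of such functions. **Theorem.** Let $\alpha>0$. 1. For every $f\in L^2(\mathbb R^d_+)\cap C^\infty(\mathbb R^d_+)$: (i) $f\in\mathbf G^\alpha_\alpha(\mathbb R^d_+)$ if and only if $(a_n(f))_n\in\ell_{\alpha/2}$; (ii) $f\in\mathbf g^\alpha_\alpha(\mathbb R^d_+)$ if and only if $(a_n(f))_n\in\ell_{0,\alpha/2}$. 2. The map $T\bigl((a_n)_n\bigr)=\sum_n a_nl_n$ is well defined (the series converges unconditionally at each point of $\mathbb R^d_+$ and in $L^2(\mathbb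 R^d_+)$), and it is a topological isomorphism of $\ell_{\alpha/2}$ onto $\mathbf G^\alpha_\alpha(\mathbb R^d_+)$ and of $\ell_{0,\alpha/2}$ onto $\mathbf g^\alpha_\alpha(\mathbb R^d_+)$. -/

import Mathlib

open MeasureTheory Set Filter Topology
open scoped ENNReal NNReal ContDiff Nat

noncomputable section

/-! ### Limit topologies of scales of (extended) seminorms -/

/-- The seminorm given by a finite-valued, subadditive, absolutely homogeneous
`[0, ∞]`-valued functional. -/
def seminormOfENNReal {W : Type*} [AddCommGroup W] [Module ℂ W] (q : W → ℝ≥0∞)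
    (hfin : ∀ w, q w < ⊤) (hadd : ∀ v w, q (v + w) ≤ q v + q w)
    (hsmul : ∀ (c : ℂ) w, q (c • w) = ‖c‖ₑ * q w) : Seminorm ℂ W :=
  Seminorm.of (fun w => (q w).toReal)
    (fun v w => by
      rw [← ENNReal.toReal_add (hfin v).ne (hfin w).ne]
      exact ENNReal.toReal_mono (ENNReal.add_lt_top.2 ⟨hfin v, hfin w⟩).ne (hadd v w))
    (fun c w => by simp [hsmul])

/-- The locally convex inductive limit topology on a space `W` which is the union of the steps
`W_i = {w | q i w < ∞}`, where `W_i` is normed by `q i`. It is the finest locally convex topology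
for which all the inclusions `W_i → W` are continuous, that is, the topology defined by the family
of all seminorms on `W` whose restriction to each step `W_i` is continuous (bounded by a multiple
of `q i`). -/
@[reducible] def inductiveTopology {W ι : Type*} [AddCommGroup W] [Module ℂ W] (q : ι → W → ℝ≥0∞) :
    TopologicalSpace W :=
  letI : Nonempty {p : Seminorm ℂ W //
      ∀ i, ∃ C : ℝ≥0, ∀ w, q i w < ⊤ → ENNReal.ofReal (p w) ≤ C * q i w} :=
    ⟨⟨0, fun _ => ⟨0, fun w _ => by simp⟩⟩⟩
  (SeminormFamily.moduleFilterBasis (𝕜 := ℂ) fun p : {p : Seminorm ℂ W //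
      ∀ i, ∃ C : ℝ≥0, ∀ w, q i w < ⊤ → ENNReal.ofReal (p w) ≤ C * q i w} =>
    (p : Seminorm ℂ W)).topology

/-- The projective limit topology on the intersection of a scale of (semi)normed spaces: the
coarsest topology for which all the inclusions into the steps are continuous, that is, the topology
defined by the family of the given seminorms. -/
@[reducible] def projectiveTopology {W ι : Type*} [AddCommGroup W] [Module ℂ W] [Nonempty ι]
    (p : ι → Seminorm ℂ W) : TopologicalSpace W :=
  (SeminormFamily.moduleFilterBasis (𝕜 := ℂ) p).topology

instance : Nonempty {h : ℝ // 0 < h} := ⟨⟨1, one_pos⟩⟩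

/-! ### Sequence spaces -/

/-- The weight `ϑ_{h,α}(n) = exp (h |n|^{1/(2α)})`, where `|n| = n_1 + ⋯ + n_d`. -/
def seqWeight {d : ℕ} (h α : ℝ) (n : Fin d → ℕ) : ℝ :=
  Real.exp (h * ((∑ j, n j : ℕ) : ℝ) ^ (1 / (2 * α)))

/-- The norm of the weighted space `ℓ^∞_{[ϑ_{h,α}]}`: the supremum of `|a_n| ϑ_{h,α}(n)`
(equal to `∞` if `a` is not in this space). -/
def seqNorm {d : ℕ} (h α : ℝ) (a : (Fin d → ℕ) → ℂ) : ℝ≥0∞ :=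
  ⨆ n, ‖a n‖ₑ * ENNReal.ofReal (seqWeight h α n)

theorem seqNorm_add_le {d : ℕ} (h α : ℝ) (a b : (Fin d → ℕ) → ℂ) :
    seqNorm h α (a + b) ≤ seqNorm h α a + seqNorm h α b := by
  refine iSup_le fun n => ?_
  calc ‖(a + b) n‖ₑ * ENNReal.ofReal (seqWeight h α n)
      ≤ (‖a n‖ₑ + ‖b n‖ₑ) * ENNReal.ofReal (seqWeight h α n) := by
        gcongr; exact enorm_add_le _ _
    _ ≤ _ := by
        rw [add_mul]
        exact add_le_add (le_iSup (fun n => ‖a n‖ₑ * ENNReal.ofReal (seqWeight h α n)) n)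
          (le_iSup (fun n => ‖b n‖ₑ * ENNReal.ofReal (seqWeight h α n)) n)

theorem seqNorm_smul {d : ℕ} (h α : ℝ) (c : ℂ) (a : (Fin d → ℕ) → ℂ) :
    seqNorm h α (c • a) = ‖c‖ₑ * seqNorm h α a := by
  simp [seqNorm, ENNReal.mul_iSup, mul_assoc]

theorem seqNorm_mono {d : ℕ} {h h' : ℝ} (hh : h ≤ h') (α : ℝ) (a : (Fin d → ℕ) → ℂ) :
    seqNorm h α a ≤ seqNorm h' α a := by
  refine iSup_mono fun n => ?_
  unfold seqWeight
  gcongr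

/-- `ℓ_α(ℕ₀^d)`, the union over `h > 0` of the spaces `ℓ^∞_{[ϑ_{h,α}]}`. -/
def ellUnion (d : ℕ) (α : ℝ) : Submodule ℂ ((Fin d → ℕ) → ℂ) where
  carrier := {a | ∃ h : ℝ, 0 < h ∧ seqNorm h α a < ⊤}
  zero_mem' := ⟨1, one_pos, by simp [seqNorm]⟩
  add_mem' := by
    rintro a b ⟨h, hh, ha⟩ ⟨k, hk, hb⟩
    refine ⟨min h k, lt_min hh hk, (seqNorm_add_le _ _ _ _).trans_lt (ENNReal.add_lt_top.2
      ⟨(seqNorm_mono (min_le_left _ _) _ _).trans_lt ha,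
        (seqNorm_mono (min_le_right _ _) _ _).trans_lt hb⟩)⟩
  smul_mem' := by
    rintro c a ⟨h, hh, ha⟩
    exact ⟨h, hh, by rw [seqNorm_smul]; exact ENNReal.mul_lt_top enorm_lt_top ha⟩

/-- `ℓ_{0,α}(ℕ₀^d)`, the intersection over `h > 0` of the spaces `ℓ^∞_{[ϑ_{h,α}]}`. -/
def ellInter (d : ℕ) (α : ℝ) : Submodule ℂ ((Fin d → ℕ) → ℂ) where
  carrier := {a | ∀ h : ℝ, 0 < h → seqNorm h α a < ⊤}
  zero_mem' := fun h _ => by simp [seqNorm]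
  add_mem' := fun {a b} ha hb h hh =>
    (seqNorm_add_le _ _ _ _).trans_lt (ENNReal.add_lt_top.2 ⟨ha h hh, hb h hh⟩)
  smul_mem' := fun c a ha h hh => by
    rw [seqNorm_smul]; exact ENNReal.mul_lt_top enorm_lt_top (ha h hh)

/-- `ℓ_α(ℕ₀^d)` as a topological vector space. (The wrapper keeps the topology of pointwise
convergence of the ambient product from being inherited.) -/
def EllUnion (d : ℕ) (α : ℝ) : Type := ↥(ellUnion d α)

instance (d : ℕ) (α : ℝ) : AddCommGroup (EllUnion d α) := inferInstanceAs (AddCommGroup (ellUnion d α))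
instance (d : ℕ) (α : ℝ) : Module ℂ (EllUnion d α) := inferInstanceAs (Module ℂ (ellUnion d α))

/-- The underlying sequence. -/
def EllUnion.seq {d : ℕ} {α : ℝ} (a : EllUnion d α) : (Fin d → ℕ) → ℂ := Subtype.val a

instance (d : ℕ) (α : ℝ) : TopologicalSpace (EllUnion d α) :=
  inductiveTopology (fun (h : {h : ℝ // 0 < h}) a => seqNorm (h : ℝ) α a.seq)

/-- `ℓ_{0,α}(ℕ₀^d)` as a topological vector space. -/
def EllInter (d : ℕ) (α : ℝ) : Type := ↥(ellInter d α)

instance (d : ℕ) (α : ℝ) : AddCommGroup (EllInter d α) := inferInstanceAs (AddCommGroup (ellInter d α))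
instance (d : ℕ) (α : ℝ) : Module ℂ (EllInter d α) := inferInstanceAs (Module ℂ (ellInter d α))

/-- The underlying sequence. -/
def EllInter.seq {d : ℕ} {α : ℝ} (a : EllInter d α) : (Fin d → ℕ) → ℂ := Subtype.val a

instance (d : ℕ) (α : ℝ) : TopologicalSpace (EllInter d α) :=
  projectiveTopology (fun h : {h : ℝ // 0 < h} =>
    seminormOfENNReal (fun a => seqNorm (h : ℝ) α a.seq) (fun a => a.2 h h.2)
      (fun a b => seqNorm_add_le _ _ a.seq b.seq) (fun c a => seqNorm_smul _ _ c a.seq))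

/-! ### Functions on the orthant, Laguerre functions and the Laguerre operator -/

/-- The open positive orthant `ℝ^d_+ = (0, ∞)^d`. -/
def orthant (d : ℕ) : Set (Fin d → ℝ) := {x | ∀ j, 0 < x j}

theorem isOpen_orthant (d : ℕ) : IsOpen (orthant d) := by
  have : orthant d = ⋂ j, {x | 0 < x j} := by ext; simp [orthant]
  rw [this]
  exact isOpen_iInter_of_finite fun j => isOpen_lt continuous_const (continuous_apply j)

theorem measurableSet_orthant (d : ℕ) : MeasurableSet (orthant d) :=
  (isOpen_orthant d).measurableSet

open Classical in
/-- The extension by zero to `ℝ^d` of a function on the orthant. All derivatives and integrals below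
only involve its values on the open orthant. -/
def zeroExt {d : ℕ} (f : orthant d → ℂ) (x : Fin d → ℝ) : ℂ :=
  if hx : x ∈ orthant d then f ⟨x, hx⟩ else 0

theorem zeroExt_add {d : ℕ} (f g : orthant d → ℂ) : zeroExt (f + g) = zeroExt f + zeroExt g := by
  ext x; by_cases hx : x ∈ orthant d <;> simp [zeroExt, hx]

theorem zeroExt_smul {d : ℕ} (c : ℂ) (f : orthant d → ℂ) : zeroExt (c • f) = c • zeroExt f := by
  ext x; by_cases hx : x ∈ orthant d <;> simp [zeroExt, hx]

theorem zeroExt_zero {d : ℕ} : zeroExt (0 : orthant d → ℂ) = 0 := by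
  ext x; simp [zeroExt]

/-- The Laguerre polynomial (of order zero)
`L_j(t) = (e^t / j!) (d/dt)^j (e^{-t} t^j)`. -/
def laguerrePoly (j : ℕ) (t : ℝ) : ℝ :=
  Real.exp t / (j ! : ℝ) * iteratedDeriv j (fun s : ℝ => Real.exp (-s) * s ^ j) t

/-- The `d`-dimensional Laguerre function `l_n(x) = ∏ L_{n_j}(x_j) e^{-x_j/2}`. -/
def laguerreFun {d : ℕ} (n : Fin d → ℕ) (x : Fin d → ℝ) : ℝ :=
  ∏ j, laguerrePoly (n j) (x j) * Real.exp (-(x j) / 2)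

/-- The Laguerre coefficients `a_n(f) = ∫_{ℝ^d_+} f(x) l_n(x) dx`. -/
def laguerreCoeff {d : ℕ} (f : orthant d → ℂ) (n : Fin d → ℕ) : ℂ :=
  ∫ x in orthant d, zeroExt f x * (laguerreFun n x : ℂ)

/-- The partial derivative `∂F/∂x_j`. -/
def partialD {d : ℕ} (j : Fin d) (F : (Fin d → ℝ) → ℂ) (x : Fin d → ℝ) : ℂ :=
  lineDeriv ℝ F x (Pi.single j 1)

/-- The Laguerre operator `E = -∑_j (x_j ∂_j² + ∂_j - x_j/4 + 1/2)`. -/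
def laguerreOp {d : ℕ} (F : (Fin d → ℝ) → ℂ) (x : Fin d → ℝ) : ℂ :=
  -∑ j, ((x j : ℂ) * partialD j (partialD j F) x + partialD j F x - (x j : ℂ) / 4 * F x
    + 1 / 2 * F x)

/-- Smoothness up to the boundary: `F` is smooth on the open orthant and all of its derivatives
extend to continuous functions on the closed orthant. -/
def SmoothUpToBoundary {d : ℕ} (F : (Fin d → ℝ) → ℂ) : Prop :=
  ContDiffOn ℝ ∞ F (orthant d) ∧
    ∀ k : ℕ, ∃ G : (Fin d → ℝ) → (Fin d → ℝ) [×k]→L[ℝ] ℂ,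
      ContinuousOn G (closure (orthant d)) ∧ EqOn (iteratedFDeriv ℝ k F) G (orthant d)

/-- `η_h^α(F) = sup_N ‖E^N F‖_{L²(ℝ^d_+)} / (h^N N!^α)`, the supremum being over
`N = 0, 1, 2, …`, with value `∞` allowed. -/
def eta {d : ℕ} (h α : ℝ) (F : (Fin d → ℝ) → ℂ) : ℝ≥0∞ :=
  ⨆ N : ℕ, eLpNorm (laguerreOp^[N] F) 2 (volume.restrict (orthant d)) /
    ENNReal.ofReal (h ^ N * (N ! : ℝ) ^ α)

/-! Facts needed for the function spaces below to be vector spaces. -/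

theorem SmoothUpToBoundary.zero {d : ℕ} : SmoothUpToBoundary (0 : (Fin d → ℝ) → ℂ) := by
  refine ⟨contDiffOn_const, fun k => ⟨iteratedFDeriv ℝ k 0, ?_, fun _ _ => rfl⟩⟩
  exact ((contDiff_const (c := (0 : ℂ)) (n := ∞)).continuous_iteratedFDeriv
    (by exact_mod_cast le_top)).continuousOn

theorem SmoothUpToBoundary.add {d : ℕ} {F G : (Fin d → ℝ) → ℂ} (hF : SmoothUpToBoundary F)
    (hG : SmoothUpToBoundary G) : SmoothUpToBoundary (F + G) := by
  refine ⟨hF.1.add hG.1, fun k => ?_⟩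
  obtain ⟨F', hF', hFe⟩ := hF.2 k
  obtain ⟨G', hG', hGe⟩ := hG.2 k
  refine ⟨F' + G', hF'.add hG', fun x hx => ?_⟩
  have hx' := (isOpen_orthant d).mem_nhds hx
  rw [iteratedFDeriv_add_apply ((hF.1.contDiffAt hx').of_le (by exact_mod_cast le_top))
    ((hG.1.contDiffAt hx').of_le (by exact_mod_cast le_top)), hFe hx, hGe hx]
  rfl

theorem SmoothUpToBoundary.smul {d : ℕ} {F : (Fin d → ℝ) → ℂ} (hF : SmoothUpToBoundary F)
    (c : ℂ) : SmoothUpToBoundary (c • F) := by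
  refine ⟨contDiffOn_const.smul hF.1, fun k => ?_⟩
  obtain ⟨F', hF', hFe⟩ := hF.2 k
  refine ⟨c • F', hF'.const_smul c, fun x hx => ?_⟩
  have hx' := (isOpen_orthant d).mem_nhds hx
  rw [iteratedFDeriv_const_smul_apply
    ((hF.1.contDiffAt hx').of_le (by exact_mod_cast le_top)), hFe hx]
  rfl

theorem partialD_congr {d : ℕ} {F G : (Fin d → ℝ) → ℂ} (j : Fin d)
    (h : EqOn F G (orthant d)) : EqOn (partialD j F) (partialD j G) (orthant d) := fun _ hx =>
  Filter.EventuallyEq.lineDeriv_eq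
    (Filter.eventuallyEq_of_mem ((isOpen_orthant d).mem_nhds hx) h)

theorem partialD_eqOn_fderiv {d : ℕ} {F : (Fin d → ℝ) → ℂ} (j : Fin d)
    (hF : ContDiffOn ℝ ∞ F (orthant d)) :
    EqOn (partialD j F) (fun x => fderiv ℝ F x (Pi.single j 1)) (orthant d) := fun _ hx =>
  ((hF.contDiffAt ((isOpen_orthant d).mem_nhds hx)).differentiableAt (by simp)).lineDeriv_eq_fderiv

theorem contDiffOn_partialD {d : ℕ} {F : (Fin d → ℝ) → ℂ} (j : Fin d)
    (hF : ContDiffOn ℝ ∞ F (orthant d)) : ContDiffOn ℝ ∞ (partialD j F) (orthant d) :=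
  ((hF.fderiv_of_isOpen (isOpen_orthant d) (m := ∞) (by simp)).clm_apply contDiffOn_const).congr
    (partialD_eqOn_fderiv j hF)

theorem partialD_add {d : ℕ} {F G : (Fin d → ℝ) → ℂ} (j : Fin d)
    (hF : ContDiffOn ℝ ∞ F (orthant d)) (hG : ContDiffOn ℝ ∞ G (orthant d)) :
    EqOn (partialD j (F + G)) (partialD j F + partialD j G) (orthant d) := fun x hx => by
  have hx' := (isOpen_orthant d).mem_nhds hx
  rw [show partialD j (F + G) x = fderiv ℝ (F + G) x (Pi.single j 1) from
      partialD_eqOn_fderiv j (hF.add hG) hx, Pi.add_apply, partialD_eqOn_fderiv j hF hx,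
    partialD_eqOn_fderiv j hG hx]
  simp only
  rw [fderiv_add ((hF.contDiffAt hx').differentiableAt (by simp))
    ((hG.contDiffAt hx').differentiableAt (by simp))]
  rfl

theorem partialD_smul {d : ℕ} {F : (Fin d → ℝ) → ℂ} (j : Fin d) (c : ℂ)
    (hF : ContDiffOn ℝ ∞ F (orthant d)) :
    EqOn (partialD j (c • F)) (c • partialD j F) (orthant d) := fun x hx => by
  have hx' := (isOpen_orthant d).mem_nhds hx
  rw [show partialD j (c • F) x = fderiv ℝ (c • F) x (Pi.single j 1) from
      partialD_eqOn_fderiv j (contDiffOn_const.smul hF) hx, Pi.smul_apply,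
    partialD_eqOn_fderiv j hF hx]
  have := fderiv_const_smul ((hF.contDiffAt hx').differentiableAt (by simp)) c
  simp only
  rw [this]
  rfl

theorem laguerreOp_congr {d : ℕ} {F G : (Fin d → ℝ) → ℂ} (h : EqOn F G (orthant d)) :
    EqOn (laguerreOp F) (laguerreOp G) (orthant d) := fun x hx => by
  simp only [laguerreOp]
  congr 1
  refine Finset.sum_congr rfl fun j _ => ?_
  rw [partialD_congr j (partialD_congr j h) hx, partialD_congr j h hx, h hx]

theorem contDiffOn_laguerreOp {d : ℕ} {F : (Fin d → ℝ) → ℂ}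
    (hF : ContDiffOn ℝ ∞ F (orthant d)) : ContDiffOn ℝ ∞ (laguerreOp F) (orthant d) := by
  have hc : ∀ j, ContDiffOn ℝ ∞ (fun x : Fin d → ℝ => (x j : ℂ)) (orthant d) := fun j =>
    (Complex.ofRealCLM.contDiff.comp (contDiff_apply ℝ ℝ j)).contDiffOn
  refine (ContDiffOn.sum fun j _ => ?_).neg
  exact ((((hc j).mul (contDiffOn_partialD j (contDiffOn_partialD j hF))).add
    (contDiffOn_partialD j hF)).sub (((hc j).div_const 4).mul hF)).add (contDiffOn_const.mul hF)

theorem laguerreOp_add {d : ℕ} {F G : (Fin d → ℝ) → ℂ}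
    (hF : ContDiffOn ℝ ∞ F (orthant d)) (hG : ContDiffOn ℝ ∞ G (orthant d)) :
    EqOn (laguerreOp (F + G)) (laguerreOp F + laguerreOp G) (orthant d) := fun x hx => by
  simp only [laguerreOp, Pi.add_apply]
  rw [← neg_add, ← Finset.sum_add_distrib]
  congr 1
  refine Finset.sum_congr rfl fun j _ => ?_
  rw [partialD_congr j (partialD_add j hF hG) hx,
    partialD_add j (contDiffOn_partialD j hF) (contDiffOn_partialD j hG) hx,
    partialD_add j hF hG hx]
  simp only [Pi.add_apply]
  ring

theorem laguerreOp_smul {d : ℕ} {F : (Fin d → ℝ) → ℂ} (c : ℂ)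
    (hF : ContDiffOn ℝ ∞ F (orthant d)) :
    EqOn (laguerreOp (c • F)) (c • laguerreOp F) (orthant d) := fun x hx => by
  simp only [laguerreOp, Pi.smul_apply, smul_eq_mul]
  rw [mul_neg, Finset.mul_sum]
  congr 1
  refine Finset.sum_congr rfl fun j _ => ?_
  rw [partialD_congr j (partialD_smul j c hF) hx,
    partialD_smul j c (contDiffOn_partialD j hF) hx, partialD_smul j c hF hx]
  simp only [Pi.smul_apply, smul_eq_mul]
  ring

theorem laguerreOp_iterate_congr {d : ℕ} (N : ℕ) {F G : (Fin d → ℝ) → ℂ}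
    (h : EqOn F G (orthant d)) : EqOn (laguerreOp^[N] F) (laguerreOp^[N] G) (orthant d) := by
  induction N generalizing F G with
  | zero => exact h
  | succ N ih => exact ih (laguerreOp_congr h)

theorem contDiffOn_laguerreOp_iterate {d : ℕ} (N : ℕ) {F : (Fin d → ℝ) → ℂ}
    (hF : ContDiffOn ℝ ∞ F (orthant d)) : ContDiffOn ℝ ∞ (laguerreOp^[N] F) (orthant d) := by
  induction N generalizing F with
  | zero => exact hF
  | succ N ih => exact ih (contDiffOn_laguerreOp hF)

theorem laguerreOp_iterate_add {d : ℕ} (N : ℕ) {F G : (Fin d → ℝ) → ℂ}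
    (hF : ContDiffOn ℝ ∞ F (orthant d)) (hG : ContDiffOn ℝ ∞ G (orthant d)) :
    EqOn (laguerreOp^[N] (F + G)) (laguerreOp^[N] F + laguerreOp^[N] G) (orthant d) := by
  induction N generalizing F G with
  | zero => exact fun _ _ => rfl
  | succ N ih =>
    exact (laguerreOp_iterate_congr N (laguerreOp_add hF hG)).trans
      (ih (contDiffOn_laguerreOp hF) (contDiffOn_laguerreOp hG))

theorem laguerreOp_iterate_smul {d : ℕ} (N : ℕ) {F : (Fin d → ℝ) → ℂ} (c : ℂ)
    (hF : ContDiffOn ℝ ∞ F (orthant d)) :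
    EqOn (laguerreOp^[N] (c • F)) (c • laguerreOp^[N] F) (orthant d) := by
  induction N generalizing F with
  | zero => exact fun _ _ => rfl
  | succ N ih =>
    exact (laguerreOp_iterate_congr N (laguerreOp_smul c hF)).trans
      (ih (contDiffOn_laguerreOp hF))

theorem eta_add_le {d : ℕ} (h α : ℝ) {F G : (Fin d → ℝ) → ℂ}
    (hF : ContDiffOn ℝ ∞ F (orthant d)) (hG : ContDiffOn ℝ ∞ G (orthant d)) :
    eta h α (F + G) ≤ eta h α F + eta h α G := by
  refine iSup_le fun N => ?_
  have hm : ∀ {H : (Fin d → ℝ) → ℂ}, ContDiffOn ℝ ∞ H (orthant d) →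
      AEStronglyMeasurable (laguerreOp^[N] H) (volume.restrict (orthant d)) := fun hH =>
    (contDiffOn_laguerreOp_iterate N hH).continuousOn.aestronglyMeasurable
      (measurableSet_orthant d)
  rw [eLpNorm_congr_ae ((ae_restrict_iff' (measurableSet_orthant d)).2
    (Filter.Eventually.of_forall (laguerreOp_iterate_add N hF hG)))]
  refine (ENNReal.div_le_div_right (eLpNorm_add_le (hm hF) (hm hG) (by norm_num)) _).trans ?_
  rw [ENNReal.add_div]
  exact add_le_add
    (le_iSup (fun N : ℕ => eLpNorm (laguerreOp^[N] F) 2 (volume.restrict (orthant d)) /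
      ENNReal.ofReal (h ^ N * (N ! : ℝ) ^ α)) N)
    (le_iSup (fun N : ℕ => eLpNorm (laguerreOp^[N] G) 2 (volume.restrict (orthant d)) /
      ENNReal.ofReal (h ^ N * (N ! : ℝ) ^ α)) N)

theorem eta_smul {d : ℕ} (h α : ℝ) (c : ℂ) {F : (Fin d → ℝ) → ℂ}
    (hF : ContDiffOn ℝ ∞ F (orthant d)) : eta h α (c • F) = ‖c‖ₑ * eta h α F := by
  rw [eta, eta, ENNReal.mul_iSup]
  refine iSup_congr fun N => ?_
  rw [eLpNorm_congr_ae ((ae_restrict_iff' (measurableSet_orthant d)).2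
    (Filter.Eventually.of_forall (laguerreOp_iterate_smul N c hF))), eLpNorm_const_smul,
    mul_div_assoc]

theorem eta_zero {d : ℕ} (h α : ℝ) : eta h α (0 : (Fin d → ℝ) → ℂ) = 0 := by
  have := eta_smul (d := d) h α 0 (F := 0) contDiffOn_const
  simpa using this

theorem eta_anti {d : ℕ} {h h' : ℝ} (hpos : 0 < h) (hh : h ≤ h') (α : ℝ)
    (F : (Fin d → ℝ) → ℂ) : eta h' α F ≤ eta h α F := by
  refine iSup_mono fun N => ENNReal.div_le_div_left (ENNReal.ofReal_le_ofReal ?_) _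
  gcongr

/-! ### Pilipović spaces on the orthant -/

/-- The Pilipović space `𝐆^α_α(ℝ^d_+)`: the functions on the orthant, smooth up to the boundary,
with `η_h^α(f) < ∞` for some `h > 0`. -/
def pilipovicUnion (d : ℕ) (α : ℝ) : Submodule ℂ (orthant d → ℂ) where
  carrier := {f | SmoothUpToBoundary (zeroExt f) ∧ ∃ h : ℝ, 0 < h ∧ eta h α (zeroExt f) < ⊤}
  zero_mem' := by
    refine ⟨?_, 1, one_pos, ?_⟩
    · rw [zeroExt_zero]; exact SmoothUpToBoundary.zero
    · rw [zeroExt_zero, eta_zero]; exact ENNReal.zero_lt_top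
  add_mem' := by
    rintro f g ⟨hf, h, hh, hfh⟩ ⟨hg, k, hk, hgk⟩
    refine ⟨by rw [zeroExt_add]; exact hf.add hg, max h k, lt_max_of_lt_left hh, ?_⟩
    rw [zeroExt_add]
    exact (eta_add_le _ _ hf.1 hg.1).trans_lt (ENNReal.add_lt_top.2
      ⟨(eta_anti hh (le_max_left _ _) _ _).trans_lt hfh,
        (eta_anti hk (le_max_right _ _) _ _).trans_lt hgk⟩)
  smul_mem' := by
    rintro c f ⟨hf, h, hh, hfh⟩
    refine ⟨by rw [zeroExt_smul]; exact hf.smul c, h, hh, ?_⟩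
    rw [zeroExt_smul, eta_smul _ _ _ hf.1]
    exact ENNReal.mul_lt_top enorm_lt_top hfh

/-- The Pilipović space `𝐠^α_α(ℝ^d_+)`: the functions on the orthant, smooth up to the boundary,
with `η_h^α(f) < ∞` for all `h > 0`. -/
def pilipovicInter (d : ℕ) (α : ℝ) : Submodule ℂ (orthant d → ℂ) where
  carrier := {f | SmoothUpToBoundary (zeroExt f) ∧ ∀ h : ℝ, 0 < h → eta h α (zeroExt f) < ⊤}
  zero_mem' := by
    refine ⟨?_, fun h _ => ?_⟩
    · rw [zeroExt_zero]; exact SmoothUpToBoundary.zero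
    · rw [zeroExt_zero, eta_zero]; exact ENNReal.zero_lt_top
  add_mem' := by
    rintro f g ⟨hf, hfh⟩ ⟨hg, hgh⟩
    refine ⟨by rw [zeroExt_add]; exact hf.add hg, fun h hh => ?_⟩
    rw [zeroExt_add]
    exact (eta_add_le _ _ hf.1 hg.1).trans_lt (ENNReal.add_lt_top.2 ⟨hfh h hh, hgh h hh⟩)
  smul_mem' := by
    rintro c f ⟨hf, hfh⟩
    refine ⟨by rw [zeroExt_smul]; exact hf.smul c, fun h hh => ?_⟩
    rw [zeroExt_smul, eta_smul _ _ _ hf.1]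
    exact ENNReal.mul_lt_top enorm_lt_top (hfh h hh)

/-- `𝐆^α_α(ℝ^d_+)` as a topological vector space. -/
def PilipovicUnion (d : ℕ) (α : ℝ) : Type := ↥(pilipovicUnion d α)

instance (d : ℕ) (α : ℝ) : AddCommGroup (PilipovicUnion d α) :=
  inferInstanceAs (AddCommGroup (pilipovicUnion d α))
instance (d : ℕ) (α : ℝ) : Module ℂ (PilipovicUnion d α) :=
  inferInstanceAs (Module ℂ (pilipovicUnion d α))

/-- The underlying function on the orthant. -/
def PilipovicUnion.fn {d : ℕ} {α : ℝ} (f : PilipovicUnion d α) : orthant d → ℂ := Subtype.val f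

instance (d : ℕ) (α : ℝ) : TopologicalSpace (PilipovicUnion d α) :=
  inductiveTopology (fun (h : {h : ℝ // 0 < h}) f => eta (h : ℝ) α (zeroExt f.fn))

/-- `𝐠^α_α(ℝ^d_+)` as a topological vector space. -/
def PilipovicInter (d : ℕ) (α : ℝ) : Type := ↥(pilipovicInter d α)

instance (d : ℕ) (α : ℝ) : AddCommGroup (PilipovicInter d α) :=
  inferInstanceAs (AddCommGroup (pilipovicInter d α))
instance (d : ℕ) (α : ℝ) : Module ℂ (PilipovicInter d α) :=
  inferInstanceAs (Module ℂ (pilipovicInter d α))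

/-- The underlying function on the orthant. -/
def PilipovicInter.fn {d : ℕ} {α : ℝ} (f : PilipovicInter d α) : orthant d → ℂ := Subtype.val f

instance (d : ℕ) (α : ℝ) : TopologicalSpace (PilipovicInter d α) :=
  projectiveTopology (fun h : {h : ℝ // 0 < h} =>
    seminormOfENNReal (fun f => eta (h : ℝ) α (zeroExt f.fn)) (fun f => f.2.2 h h.2)
      (fun f g => by
        have : zeroExt (f + g).fn = zeroExt f.fn + zeroExt g.fn := zeroExt_add f.fn g.fn
        simp only [this]
        exact eta_add_le _ _ f.2.1.1 g.2.1.1)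
      (fun c f => by
        have : zeroExt (c • f).fn = c • zeroExt f.fn := zeroExt_smul c f.fn
        simp only [this]
        exact eta_smul _ _ c f.2.1.1))

/-- `f = ∑_n a_n l_n`: the series converges (unconditionally) to `f` at every point of the orthant
and in `L²(ℝ^d_+)`. -/
def IsLaguerreSum {d : ℕ} (a : (Fin d → ℕ) → ℂ) (f : orthant d → ℂ) : Prop :=
  (∀ x : orthant d, HasSum (fun n => a n * (laguerreFun n x : ℂ)) (f x)) ∧
  Tendsto (fun s : Finset (Fin d → ℕ) =>
    eLpNorm (fun x => zeroExt f x - ∑ n ∈ s, a n * (laguerreFun n x : ℂ)) 2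
      (volume.restrict (orthant d))) atTop (𝓝 0)

end

/-! The operator `E` is diagonal in the Laguerre functions: they form a complete orthonormal system
in `L²` of the orthant, and `E l_n = |n| l_n`. Formally, then, `E^N f` has the coefficients `|n|^N
a_n`, and the theorem reduces to the fact that the supremum over `N` of `t^N / (h^N N!^α)` is
comparable to `exp (c t^{1/α})`, up to a change of constants. The two halves of this comparison are
`pow_mul_exp_neg_rpow_le` and `mul_exp_rpow_le_of_forall_mul_pow_le`. Each side of the
correspondence needs some analysis.

From sequences to functions, the derivatives of `l_n` of order `k` grow at most like `(1 + |n|)^k`,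
locally uniformly up to the boundary (`norm_iteratedFDeriv_laguerreFun_le`, by an energy argument
for Laguerre's equation). The series may therefore be differentiated term by term, its sum is smooth
up to the boundary, and `E^N` acts on it termwise. The triangle inequality in `L²` then bounds `‖E^N
f‖`.

From functions to sequences, `E` has to be moved from `f` to `l_n`
(`integral_laguerreOp_mul_laguerreFun`). At the boundary nothing is lost, because `x_j ∂_j² + ∂_j =
∂_j x_j ∂_j` has a factor `x_j` that vanishes on the face. At infinity nothing is known about the
derivatives of `f`, so `l_n` is multiplied by a dilated cutoff and all derivatives are put on this
product; the limit uses only that `f` and `E f` are in `L²`. Cauchy-Schwarz now gives `|a_n| |n|^N ≤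
‖E^N f‖`.

That `f` is the sum of its Laguerre series follows from completeness
(`ae_eq_zero_of_integral_mul_laguerreFun_eq_zero`), proved by a Stone-Weierstrass type uniqueness
theorem for finite measures, and from continuity. All norm estimates go from a single step of one
scale to a single step of the other, with index changes that are bijections of `(0, ∞)`. This yields
continuity in both directions, for the inductive as well as the projective limits. -/

noncomputable section

/-! ### Laguerre polynomials in one variable: Rodrigues' formula and orthonormality -/

open Polynomial in
/-- The Laguerre polynomial `L_n = ∑ₖ (-1)^k (n choose k) X^k / k!`. -/
def laguerre (n : ℕ) : ℝ[X] :=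
  ∑ k ∈ Finset.range (n + 1), monomial k ((-1) ^ k * (n.choose k : ℝ) / (k ! : ℝ))

/-- The operator `p ↦ p' - p`, which is `d/dt` conjugated by `e^{-t}`. -/
def expDerivative : Module.End ℝ (Polynomial ℝ) := 
  Polynomial.derivative + algebraMap ℝ (Module.End ℝ (Polynomial ℝ)) (-1)

namespace laguerre

open Polynomial

theorem coeff_eq (n k : ℕ) : (laguerre n).coeff k = (-1) ^ k * (n.choose k : ℝ) / (k ! : ℝ) := by
  simp only [laguerre, finsetSum_coeff, coeff_monomial, Finset.sum_ite_eq', Finset.mem_range]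
  split_ifs with h
  · rfl
  · rw [Nat.choose_eq_zero_of_lt (by omega)]; simp

theorem expDerivative_apply (p : ℝ[X]) : expDerivative p = derivative p - p := by
  simp [expDerivative, sub_eq_add_neg]

/-- The derivative commutes with scalars, so `(D - 1)^n` expands by the binomial theorem. Only the
term with `n - k` derivatives contributes to the coefficient of `X^k`. -/
theorem rodrigues (n : ℕ) : (expDerivative ^ n) (X ^ n) = (n ! : ℝ) • laguerre n := by
  have hc : Commute (derivative : Module.End ℝ ℝ[X]) (algebraMap ℝ (Module.End ℝ ℝ[X]) (-1)) :=
    (Algebra.commutes _ _).symm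
  ext k
  rw [expDerivative, hc.add_pow, LinearMap.sum_apply, finsetSum_coeff, coeff_smul, coeff_eq]
  have key : ∀ m ∈ Finset.range (n + 1), (((derivative : Module.End ℝ ℝ[X]) ^ m *
      algebraMap ℝ (Module.End ℝ ℝ[X]) (-1) ^ (n - m) *
      (n.choose m : Module.End ℝ ℝ[X])) (X ^ n)).coeff k =
      if k = n - m then (-1) ^ (n - m) * (n.choose m : ℝ) * n.descFactorial m else 0 := by
    intro m _
    have h1 : ((derivative : Module.End ℝ ℝ[X]) ^ m *
      algebraMap ℝ (Module.End ℝ ℝ[X]) (-1) ^ (n - m) *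
      (n.choose m : Module.End ℝ ℝ[X])) =
      ((-1 : ℝ) ^ (n - m) * (n.choose m : ℝ)) • ((derivative : Module.End ℝ ℝ[X]) ^ m) := by
      rw [← map_pow, ← map_natCast (algebraMap ℝ (Module.End ℝ ℝ[X])), mul_assoc, ← map_mul,
        ← Algebra.commutes, ← Algebra.smul_def]
    rw [h1, LinearMap.smul_apply, coeff_smul, Module.End.pow_apply,
      iterate_derivative_X_pow_eq_smul]
    simp [coeff_X_pow]
  rw [Finset.sum_congr rfl key]
  rcases le_or_gt k n with hk | hk
  · rw [Finset.sum_eq_single (n - k)]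
    · rw [if_pos (by omega), show n - (n - k) = k by omega, Nat.choose_symm hk]
      have := Nat.factorial_mul_descFactorial (Nat.sub_le n k)
      rw [show n - (n - k) = k by omega] at this
      rw [← this]
      push_cast
      have : (k ! : ℝ) ≠ 0 := by positivity
      simp only [smul_eq_mul]
      field_simp
    · intro b hb hne
      rw [if_neg]
      simp at hb; omega
    · simp
  · rw [Nat.choose_eq_zero_of_lt hk, Finset.sum_eq_zero]
    · simp
    · intro m _
      rw [if_neg (by omega)]

theorem iteratedDeriv_exp_mul (n j : ℕ) :
    iteratedDeriv j (fun s : ℝ => Real.exp (-s) * s ^ n) =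
      fun s => Real.exp (-s) * ((expDerivative ^ j) (X ^ n)).eval s := by
  induction j with
  | zero => simp
  | succ j ih =>
    rw [iteratedDeriv_succ, ih]
    ext s
    rw [pow_succ', Module.End.mul_apply, expDerivative_apply]
    have h1 : HasDerivAt (fun s : ℝ => Real.exp (-s)) (Real.exp (-s) * (-1)) s :=
      (hasDerivAt_neg s).exp
    have := (h1.mul (((expDerivative ^ j) (X ^ n)).hasDerivAt s)).deriv
    erw [this]
    simp; ring

theorem laguerrePoly_eq (n : ℕ) (t : ℝ) : laguerrePoly n t = (laguerre n).eval t := by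
  rw [laguerrePoly, iteratedDeriv_exp_mul, rodrigues]
  have : (n ! : ℝ) ≠ 0 := by positivity
  simp only [eval_smul, smul_eq_mul]
  rw [Real.exp_neg]
  field_simp

/-- The functional `p ↦ ∫₀^∞ p(t) e^{-t} dt`, which maps `X^k` to `k!`. -/
def expFunctional : ℝ[X] →ₗ[ℝ] ℝ := Polynomial.lsum fun k => (k ! : ℝ) • LinearMap.id

theorem expFunctional_monomial (k : ℕ) (c : ℝ) : expFunctional (monomial k c) = k ! * c := by
  simp [expFunctional]

theorem integrableOn_eval_mul_exp (p : ℝ[X]) :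
    IntegrableOn (fun t => p.eval t * Real.exp (-t)) (Ioi 0) := by
  induction p using Polynomial.induction_on' with
  | add p q hp hq => exact (hp.add hq).congr (Eventually.of_forall fun t => by simp [add_mul])
  | monomial k c =>
    have := (Real.GammaIntegral_convergent (s := k + 1) (by positivity)).const_mul c
    refine IntegrableOn.congr_fun this (fun t ht => ?_) measurableSet_Ioi
    simp
    ring

theorem integral_eval_mul_exp (p : ℝ[X]) :
    ∫ t in Ioi (0 : ℝ), p.eval t * Real.exp (-t) = expFunctional p := by
  induction p using Polynomial.induction_on' with
  | add p q hp hq =>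
    rw [map_add, ← hp, ← hq, ← integral_add (integrableOn_eval_mul_exp p)
      (integrableOn_eval_mul_exp q)]
    simp [add_mul]
  | monomial k c =>
    rw [expFunctional_monomial, ← Real.Gamma_nat_eq_factorial, Real.Gamma_eq_integral
      (by positivity), mul_comm, ← integral_const_mul]
    refine setIntegral_congr_fun measurableSet_Ioi fun t _ => ?_
    simp
    ring

/-- Integration by parts against `e^{-t}` in algebraic form; on monomials it is `k! = k (k - 1)!`.
-/
theorem expFunctional_derivative (p : ℝ[X]) :
    expFunctional (derivative p) = expFunctional p - p.eval 0 := by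
  induction p using Polynomial.induction_on' with
  | add p q hp hq => simp [hp, hq]; ring
  | monomial k c =>
    rw [derivative_monomial, expFunctional_monomial, expFunctional_monomial]
    cases k with
    | zero => simp
    | succ k => simp [Nat.factorial_succ]; ring

/-- This divisibility makes the boundary terms at `0` vanish in the repeated integration by parts
below, as long as `j < n`. -/
theorem X_pow_dvd_expDerivative_pow (n j : ℕ) :
    X ^ (n - j) ∣ (expDerivative ^ j) (X ^ n : ℝ[X]) := by
  induction j with
  | zero => simp
  | succ j ih =>
    rw [pow_succ', Module.End.mul_apply, expDerivative_apply]
    refine dvd_sub ?_ ((pow_dvd_pow _ (by omega)).trans ih)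
    have := pow_sub_one_dvd_derivative_of_pow_dvd ih
    rwa [show n - j - 1 = n - (j + 1) by omega] at this

theorem expFunctional_mul_expDerivative_pow (n j : ℕ) (hj : j ≤ n) (p : ℝ[X]) :
    expFunctional (p * (expDerivative ^ j) (X ^ n)) =
      (-1) ^ j * expFunctional (derivative^[j] p * X ^ n) := by
  induction j generalizing p with
  | zero => simp
  | succ j ih =>
    have h0 : ((expDerivative ^ j) (X ^ n : ℝ[X])).eval 0 = 0 := by
      obtain ⟨q, hq⟩ := X_pow_dvd_expDerivative_pow n j
      rw [hq]
      simp [show n - j ≠ 0 by omega]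
    have h1 := expFunctional_derivative (p * (expDerivative ^ j) (X ^ n))
    rw [derivative_mul, map_add, eval_mul, h0, ih (by omega) (derivative p)] at h1
    rw [pow_succ', Module.End.mul_apply, expDerivative_apply, mul_sub, map_sub,
      Function.iterate_succ_apply, pow_succ']
    linarith

/-- By Rodrigues' formula `n` integrations by parts move all derivatives onto `p`. Orthogonality to
lower degrees is then immediate, and the norm is read off from the leading coefficient. -/
theorem expFunctional_mul_laguerre (n : ℕ) (p : ℝ[X]) :
    expFunctional (p * laguerre n) =
      (-1) ^ n / (n ! : ℝ) * expFunctional (derivative^[n] p * X ^ n) := by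
  have h := expFunctional_mul_expDerivative_pow n n le_rfl p
  rw [rodrigues, mul_smul_comm, map_smul, smul_eq_mul] at h
  have : (n ! : ℝ) ≠ 0 := by positivity
  field_simp
  linarith

theorem natDegree_eq (n : ℕ) : (laguerre n).natDegree = n := by
  refine natDegree_eq_of_le_of_coeff_ne_zero ?_ ?_
  · refine natDegree_le_iff_coeff_eq_zero.2 fun k hk => ?_
    rw [coeff_eq, Nat.choose_eq_zero_of_lt hk]; simp
  · rw [coeff_eq]; simp; positivity

theorem expFunctional_mul_eq_zero {m n : ℕ} (h : m < n) :
    expFunctional (laguerre m * laguerre n) = 0 := by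
  rw [expFunctional_mul_laguerre, iterate_derivative_eq_zero (by rwa [natDegree_eq])]
  simp

theorem expFunctional_mul_self (n : ℕ) : expFunctional (laguerre n * laguerre n) = 1 := by
  have h : derivative^[n] (laguerre n) = C ((-1) ^ n) := by
    ext k
    rw [coeff_iterate_derivative, coeff_C, coeff_eq]
    split_ifs with hk
    · subst hk
      simp [Nat.descFactorial_self]
      field_simp
    · rw [Nat.choose_eq_zero_of_lt (by omega)]; simp
  rw [expFunctional_mul_laguerre, h, C_mul_X_pow_eq_monomial, expFunctional_monomial]
  have : (n ! : ℝ) ≠ 0 := by positivity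
  field_simp
  rw [← pow_mul, mul_comm, pow_mul]; simp

theorem expFunctional_mul (m n : ℕ) :
    expFunctional (laguerre m * laguerre n) = if m = n then 1 else 0 := by
  split_ifs with h
  · rw [h, expFunctional_mul_self]
  · rcases lt_or_gt_of_ne h with h | h
    · exact expFunctional_mul_eq_zero h
    · rw [mul_comm]; exact expFunctional_mul_eq_zero h

/-! ### Laguerre's equation and bounds for the derivatives of Laguerre polynomials -/

theorem ode (n : ℕ) : X * derivative (derivative (laguerre n)) +
    (1 - X) * derivative (laguerre n) + (n : ℝ[X]) * laguerre n = 0 := by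
  ext k
  -- The coefficient of `X^k` in Laguerre's equation is the recursion `(k + 1)² c_{k+1} = (k - n)
  -- c_k`.
  have hstep : ((k : ℝ) + 1) * (laguerre n).coeff (k + 1) * (k + 1) =
      (k - n) * (laguerre n).coeff k := by
    rw [coeff_eq, coeff_eq, Nat.factorial_succ]
    have h2 : ((n.choose (k + 1) : ℕ) : ℝ) * (k + 1) = n.choose k * (n - k) := by
      rcases le_or_gt k n with hk | hk
      · have := Nat.choose_succ_right_eq n k
        rw [← Nat.cast_sub hk]; exact_mod_cast this
      · rw [Nat.choose_eq_zero_of_lt hk, Nat.choose_eq_zero_of_lt (by omega)]; simp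
    have h3 : ((k ! : ℕ) : ℝ) ≠ 0 := by positivity
    have h4 : (k : ℝ) + 1 ≠ 0 := by positivity
    push_cast
    field_simp
    rw [pow_succ]
    linear_combination -(-1) ^ k * h2
  rw [sub_mul, one_mul, coeff_add, coeff_add, coeff_sub, coeff_natCast_mul]
  cases k with
  | zero =>
    simp [coeff_derivative] at hstep ⊢
    linear_combination hstep
  | succ k =>
    simp only [coeff_X_mul, coeff_derivative, coeff_zero] at hstep ⊢
    push_cast at hstep ⊢
    linear_combination hstep

theorem ode_iterate (n k : ℕ) : X * derivative^[k + 2] (laguerre n) +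
    ((k : ℝ[X]) + 1 - X) * derivative^[k + 1] (laguerre n) +
      ((n : ℝ[X]) - (k : ℝ[X])) * derivative^[k] (laguerre n) = 0 := by
  induction k with
  | zero => simpa using ode n
  | succ k ih =>
    have := congrArg derivative ih
    simp only [derivative_add, derivative_mul, derivative_X, derivative_sub, derivative_natCast,
      derivative_one, derivative_zero, ← Function.iterate_succ_apply'] at this
    push_cast
    linear_combination this

theorem eval_zero_iterate_derivative (n k : ℕ) :
    |(derivative^[k] (laguerre n)).eval 0| ≤ (n : ℝ) ^ k := by
  rw [← coeff_zero_eq_eval_zero, coeff_iterate_derivative, coeff_eq]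
  have h3 : ((k ! : ℕ) : ℝ) ≠ 0 := by positivity
  rw [zero_add, Nat.descFactorial_self, nsmul_eq_mul]
  field_simp
  rw [abs_mul, abs_pow, abs_neg, abs_one, one_pow, one_mul, Nat.abs_cast]
  exact_mod_cast Nat.choose_le_pow n k

/-- For `k < n`, with `y` the `k`-th derivative and `c = n - k`, the energy `(c y² + t y'²) e^{-2t}`
decreases: by the equation for `y`, its derivative is `-(2 c y² + (2k + 1) y'²) e^{-2t}`. At `t = 0`
the term with `y'` drops out, so `y(0)` alone controls `y(x)`. For `k ≥ n` the derivative is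
constant. -/
theorem abs_eval_iterate_derivative_le (n k : ℕ) {x : ℝ} (hx : 0 ≤ x) :
    |(derivative^[k] (laguerre n)).eval x| ≤ (n : ℝ) ^ k * Real.exp x := by
  rcases lt_trichotomy k n with hk | hk | hk
  · set y : ℕ → ℝ[X] := fun i => derivative^[i] (laguerre n) with hy
    have hdy : ∀ i t, HasDerivAt (fun t => (y i).eval t) ((y (i + 1)).eval t) t := fun i t => by
      have := (y i).hasDerivAt t
      simpa only [hy, ← Function.iterate_succ_apply'] using this
    set c : ℝ := n - k with hc
    have hcpos : 0 < c := by rw [hc, sub_pos]; exact_mod_cast hk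
    set v : ℝ → ℝ := fun t => (c * (y k).eval t ^ 2 + t * (y (k + 1)).eval t ^ 2) *
      Real.exp (-(2 * t)) with hv
    have hder : ∀ t, HasDerivAt v
        (-(2 * c * (y k).eval t ^ 2 + (2 * k + 1) * (y (k + 1)).eval t ^ 2) *
          Real.exp (-(2 * t))) t := fun t => by
      have he : HasDerivAt (fun t : ℝ => Real.exp (-(2 * t))) (Real.exp (-(2 * t)) * (-2)) t := by
        have := ((hasDerivAt_id t).const_mul 2).neg.exp
        simpa using this
      have h1 := ((((hdy k t).pow 2).const_mul c).add
        ((hasDerivAt_id t).mul ((hdy (k + 1) t).pow 2))).mul he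
      have ho := congrArg (eval t) (ode_iterate n k)
      simp only [eval_add, eval_mul, eval_sub, eval_X, eval_natCast, eval_one, eval_zero] at ho
      refine h1.congr_deriv ?_
      simp only [hy, hc, id, Pi.add_apply, Pi.mul_apply, Pi.pow_apply] at ho ⊢
      push_cast
      linear_combination 2 * (derivative^[k + 1] (laguerre n)).eval t * Real.exp (-(2 * t)) * ho
    have hanti : Antitone v := antitone_of_hasDerivAt_nonpos hder fun t => by
      simp only [Pi.zero_apply]
      have := Real.exp_pos (-(2 * t))
      rw [neg_mul, neg_nonpos]
      positivity
    have h0 := hanti hx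
    simp only [hv, zero_mul, add_zero, mul_zero, neg_zero, Real.exp_zero, mul_one] at h0
    have h1 : (y k).eval x ^ 2 ≤ (y k).eval 0 ^ 2 * Real.exp (2 * x) := by
      have h2 : c * (y k).eval x ^ 2 * Real.exp (-(2 * x)) ≤ c * (y k).eval 0 ^ 2 := by
        refine le_trans ?_ h0
        gcongr
        exact le_add_of_nonneg_right (by positivity)
      rw [Real.exp_neg, ← div_eq_mul_inv, div_le_iff₀ (Real.exp_pos _), mul_assoc] at h2
      exact le_of_mul_le_mul_left h2 hcpos
    have h2 : (y k).eval x ^ 2 ≤ (|(y k).eval 0| * Real.exp x) ^ 2 := by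
      refine h1.trans_eq ?_
      rw [mul_pow, sq_abs, ← Real.exp_nat_mul]; norm_num
    refine (abs_le_of_sq_le_sq h2 (by positivity)).trans ?_
    gcongr
    exact eval_zero_iterate_derivative n k
  · have hconst : derivative^[k] (laguerre n) = C ((derivative^[k] (laguerre n)).eval 0) := by
      rw [← coeff_zero_eq_eval_zero]
      refine eq_C_of_natDegree_eq_zero ?_
      have := natDegree_iterate_derivative (laguerre n) k
      rw [natDegree_eq] at this
      omega
    have h1 : (derivative^[k] (laguerre n)).eval x = (derivative^[k] (laguerre n)).eval 0 := by
      rw [hconst]; simp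
    rw [h1]
    refine (eval_zero_iterate_derivative n k).trans (le_mul_of_one_le_right (by positivity) ?_)
    exact Real.one_le_exp hx
  · rw [iterate_derivative_eq_zero (by rwa [natDegree_eq])]
    simp
    positivity

/-- The `n`-th polynomial has degree exactly `n`, and over a field every nonzero leading coefficient
is a unit. -/
theorem span_eq_top : Submodule.span ℝ (Set.range laguerre) = ⊤ := by
  have h : ∀ n, (laguerre n).degree = n := fun n => by
    rw [degree_eq_natDegree (fun h0 => ?_), natDegree_eq]
    have := expFunctional_mul_self n
    rw [h0] at this; simp at this
  refine Polynomial.Sequence.span ⟨laguerre, h⟩ fun i => ?_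
  refine isUnit_iff_ne_zero.2 (leadingCoeff_ne_zero.2 ?_)
  exact Polynomial.Sequence.ne_zero ⟨laguerre, h⟩ i

end laguerre
end

/-! ### Laguerre functions on the orthant: orthonormality and eigenvalues -/

noncomputable section

/-- As a product measure it lets integrals of products of one-variable functions factor. -/
theorem volume_restrict_orthant (d : ℕ) : (volume : Measure (Fin d → ℝ)).restrict (orthant d) =
    Measure.pi fun _ => (volume : Measure ℝ).restrict (Ioi 0) := by
  rw [← Measure.restrict_pi_pi]
  congr 1
  ext x; simp [orthant]

/-- The function `∏ⱼ pⱼ(xⱼ) e^{-xⱼ/2}` on `ℝ^d`. -/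
def expPoly {d : ℕ} (p : Fin d → Polynomial ℝ) (x : Fin d → ℝ) : ℝ :=
  ∏ j, (p j).eval (x j) * Real.exp (-(x j) / 2)

theorem laguerreFun_eq {d : ℕ} (n : Fin d → ℕ) :
    laguerreFun n = expPoly fun j => laguerre (n j) := by
  ext x
  simp only [laguerreFun, expPoly, laguerre.laguerrePoly_eq]

namespace expPoly

open Polynomial

variable {d : ℕ} (p q : Fin d → ℝ[X])

theorem contDiff {n : WithTop ℕ∞} : ContDiff ℝ n (expPoly p) := by
  unfold expPoly
  refine contDiff_prod fun j _ => ?_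
  have h1 : ContDiff ℝ n fun x : Fin d → ℝ => (p j).eval (x j) := by
    simpa [Function.comp_def] using ((p j).contDiff_aeval (𝕜 := ℝ) n).comp (contDiff_apply ℝ ℝ j)
  exact h1.mul ((contDiff_apply ℝ ℝ j).neg.div_const 2).exp

theorem continuous : Continuous (expPoly p) := (contDiff (n := 0) p).continuous

theorem mul_eq (x : Fin d → ℝ) : expPoly p x * expPoly q x =
    ∏ j, (p j * q j).eval (x j) * Real.exp (-(x j)) := by
  rw [expPoly, expPoly, ← Finset.prod_mul_distrib]
  refine Finset.prod_congr rfl fun j _ => ?_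
  have h : Real.exp (-(x j)) = Real.exp (-(x j) / 2) * Real.exp (-(x j) / 2) := by
    rw [← Real.exp_add, add_halves]
  rw [eval_mul, h]
  ring

theorem integrable_mul :
    Integrable (fun x => expPoly p x * expPoly q x) (volume.restrict (orthant d)) := by
  simp only [mul_eq, volume_restrict_orthant]
  exact Integrable.fintype_prod (f := fun j t => (p j * q j).eval t * Real.exp (-t))
    fun j => laguerre.integrableOn_eval_mul_exp _

theorem integral_mul : ∫ x in orthant d, expPoly p x * expPoly q x =
    ∏ j, laguerre.expFunctional (p j * q j) := by
  simp only [mul_eq, volume_restrict_orthant]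
  rw [integral_fintype_prod_eq_prod (f := fun j t => (p j * q j).eval t * Real.exp (-t))]
  simp only [laguerre.integral_eval_mul_exp]

theorem memLp : MemLp (expPoly p) 2 (volume.restrict (orthant d)) := by
  rw [memLp_two_iff_integrable_sq (continuous p).aestronglyMeasurable]
  simpa only [sq] using integrable_mul p p

theorem memLp_ofReal :
    MemLp (fun x => (expPoly p x : ℂ)) 2 (volume.restrict (orthant d)) := (memLp p).ofReal

/-- The product of all factors of `expPoly p` but the polynomial `p j`. -/
def cofactor (j : Fin d) (x : Fin d → ℝ) : ℝ :=
  Real.exp (-(x j) / 2) * ∏ i ∈ Finset.univ.erase j, (p i).eval (x i) * Real.exp (-(x i) / 2)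

theorem eq_eval_mul_cofactor (j : Fin d) (x : Fin d → ℝ) :
    expPoly p x = (p j).eval (x j) * cofactor p j x := by
  rw [expPoly, ← Finset.mul_prod_erase _ _ (Finset.mem_univ j), cofactor, mul_assoc]

theorem update_eq (j : Fin d) (r : ℝ[X]) (x : Fin d → ℝ) :
    expPoly (Function.update p j r) x = r.eval (x j) * cofactor p j x := by
  rw [eq_eval_mul_cofactor _ j, Function.update_self, cofactor, cofactor]
  congr 2
  refine Finset.prod_congr rfl fun i hi => ?_
  rw [Function.update_of_ne (Finset.ne_of_mem_erase hi)]

/-- The operator `r ↦ r' - r / 2`, which is `d/dt` conjugated by `e^{-t/2}`. -/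
def halfDerivative (r : ℝ[X]) : ℝ[X] := derivative r - C (1 / 2) * r

/-- Polynomials times `e^{-|x|/2}` are stable under `∂_j`, which touches only the `j`-th polynomial.
Applying `E` to them is thus polynomial algebra. -/
theorem hasLineDerivAt (j : Fin d) (x : Fin d → ℝ) : HasLineDerivAt ℝ (expPoly p)
    (expPoly (Function.update p j (halfDerivative (p j))) x) x (Pi.single j 1) := by
  rw [HasLineDerivAt]
  have h : (fun t : ℝ => expPoly p (x + t • Pi.single j 1)) = fun t : ℝ =>
      ((p j).eval (x j + t) * Real.exp (-(x j + t) / 2)) *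
      ∏ i ∈ Finset.univ.erase j, (p i).eval (x i) * Real.exp (-(x i) / 2) := by
    ext t
    rw [eq_eval_mul_cofactor p j, cofactor, mul_assoc]
    simp only [Pi.add_apply, Pi.smul_apply, Pi.single_eq_same, smul_eq_mul, mul_one]
    congr 2
    refine Finset.prod_congr rfl fun i hi => ?_
    rw [Pi.single_eq_of_ne (Finset.ne_of_mem_erase hi)]
    simp
  rw [h, update_eq, cofactor, ← mul_assoc]
  refine HasDerivAt.mul_const ?_ _
  have h1 : HasDerivAt (fun t : ℝ => (p j).eval (x j + t)) ((derivative (p j)).eval (x j)) 0 := by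
    have := ((p j).hasDerivAt (x j + 0)).comp_const_add (x j) 0
    simpa using this
  have h2 : HasDerivAt (fun t : ℝ => Real.exp (-(x j + t) / 2))
      (Real.exp (-(x j) / 2) * (-1 / 2)) 0 := by
    have := (((hasDerivAt_id (0 : ℝ)).const_add (x j)).neg.div_const 2).exp
    simpa using this
  refine (h1.mul h2).congr_deriv ?_
  simp [halfDerivative]
  ring

theorem partialD_eq (j : Fin d) : partialD j (fun x => (expPoly p x : ℂ)) =
    fun x => (expPoly (Function.update p j (halfDerivative (p j))) x : ℂ) := by
  ext x
  have h : HasDerivAt (fun t : ℝ => ((expPoly p (x + t • Pi.single j 1) : ℝ) : ℂ)) _ 0 :=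
    (hasLineDerivAt p j x).ofReal_comp
  exact h.deriv

end expPoly

/-- Conjugation by `e^{-t/2}` turns `d/dt` into `d/dt - 1/2`; the terms `-x_j/4 + 1/2` then cancel,
and `-(x r'' + (1 - x) r')` is left in each variable, which Laguerre's equation evaluates. -/
theorem laguerreOp_laguerreFun {d : ℕ} (n : Fin d → ℕ) :
    laguerreOp (fun x => (laguerreFun n x : ℂ)) =
      fun x => ((∑ j, n j : ℕ) : ℂ) * (laguerreFun n x : ℂ) := by
  ext x
  rw [laguerreFun_eq, laguerreOp]
  push_cast
  rw [Finset.sum_mul, ← Finset.sum_neg_distrib]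
  refine Finset.sum_congr rfl fun j _ => ?_
  rw [expPoly.partialD_eq, expPoly.partialD_eq]
  simp only [Function.update_idem, Function.update_self, expPoly.update_eq,
    expPoly.halfDerivative]
  rw [expPoly.eq_eval_mul_cofactor _ j]
  have ho := congrArg (Polynomial.eval (x j)) (laguerre.ode (n j))
  simp at ho ⊢
  have ho' := congrArg (fun r : ℝ => (r : ℂ)) ho
  push_cast at ho'
  linear_combination
    (-(expPoly.cofactor (fun j => laguerre (n j)) j x : ℂ)) * ho'

theorem integral_laguerreFun_mul {d : ℕ} (m n : Fin d → ℕ) :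
    ∫ x in orthant d, laguerreFun m x * laguerreFun n x = if m = n then 1 else 0 := by
  rw [laguerreFun_eq, laguerreFun_eq, expPoly.integral_mul]
  simp only [laguerre.expFunctional_mul]
  split_ifs with h
  · simp [h]
  · obtain ⟨j, hj⟩ := Function.ne_iff.1 h
    exact Finset.prod_eq_zero (Finset.mem_univ j) (if_neg hj)

theorem eLpNorm_laguerreFun {d : ℕ} (n : Fin d → ℕ) :
    eLpNorm (fun x => (laguerreFun n x : ℂ)) 2 (volume.restrict (orthant d)) = 1 := by
  have hm : MemLp (fun x => (laguerreFun n x : ℂ)) 2 (volume.restrict (orthant d)) := by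
    rw [laguerreFun_eq]; exact expPoly.memLp_ofReal _
  rw [hm.eLpNorm_eq_integral_rpow_norm (by norm_num) (by norm_num)]
  simp
  have := integral_laguerreFun_mul n n
  simp only [if_true, ← sq] at this
  rw [this]; simp

end

/-! ### Completeness of the Laguerre functions -/

noncomputable section

/-- An integrable function whose integral against every member of a point separating algebra of
bounded continuous functions vanishes is zero almost everywhere. -/
theorem ae_eq_zero_of_forall_mem_subalgebra_integral_eq_zero {E : Type*} [MetricSpace E]
    [CompleteSpace E] [SecondCountableTopology E] [MeasurableSpace E] [BorelSpace E]
    {μ : Measure E} (A : Subalgebra ℝ (BoundedContinuousFunction E ℝ))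
    (hA : ∀ x y, x ≠ y → ∃ g ∈ A, g x ≠ g y) {r : E → ℝ} (hr : Integrable r μ)
    (h : ∀ g ∈ A, ∫ x, r x * g x ∂μ = 0) : r =ᵐ[μ] 0 := by
  have hm : AEMeasurable r μ := hr.aestronglyMeasurable.aemeasurable
  have hfin : ∀ {s : E → ℝ}, Integrable s μ → ∫⁻ x, ENNReal.ofReal (s x) ∂μ ≠ ⊤ := fun hs =>
    ((lintegral_mono fun x => ENNReal.ofReal_le_of_le_toReal (by
      simpa using le_abs_self _)).trans_lt hs.2).ne
  have := isFiniteMeasure_withDensity (hfin hr)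
  have := isFiniteMeasure_withDensity (hfin hr.neg)
  let B : StarSubalgebra ℝ (BoundedContinuousFunction E ℝ) :=
    { A with
      star_mem' := fun {a} ha => by
        have : star a = a := by ext; simp
        rwa [this] }
  have hint : ∀ (s : E → ℝ) (g : E → ℝ), AEMeasurable s μ →
      ∫ x, g x ∂μ.withDensity (fun x => ENNReal.ofReal (s x)) = ∫ x, max (s x) 0 * g x ∂μ := by
    intro s g hs
    rw [integral_withDensity_eq_integral_toReal_smul₀ hs.ennreal_ofReal
      (Eventually.of_forall fun _ => ENNReal.ofReal_lt_top)]
    simp [ENNReal.toReal_ofReal']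
  -- The positive and negative parts of `r` are densities of two finite measures with the same
  -- integrals over the algebra. Finite measures that agree on a point separating star subalgebra
  -- are equal; over `ℝ` the star is trivial.
  have hEq : μ.withDensity (fun x => ENNReal.ofReal (r x)) =
      μ.withDensity (fun x => ENNReal.ofReal ((-r) x)) := by
    refine ext_of_forall_mem_subalgebra_integral_eq_of_pseudoEMetric_complete_countable
      (𝕜 := ℝ) (A := B) ?_ ?_
    · intro x y hxy
      obtain ⟨g, hg, hne⟩ := hA x y hxy
      exact ⟨g, ⟨_, ⟨g, hg, rfl⟩, rfl⟩, hne⟩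
    · intro g hg
      rw [hint _ _ hm, hint _ _ hm.neg, ← sub_eq_zero, ← integral_sub]
      · refine Eq.trans (integral_congr_ae (Eventually.of_forall fun x => ?_)) (h g hg)
        simp only [Pi.neg_apply]
        rw [← sub_mul]
        congr 1
        exact max_zero_sub_max_neg_zero_eq_self (r x)
      · exact hr.pos_part.mul_bdd (c := ‖g‖) g.continuous.aestronglyMeasurable
          (Eventually.of_forall fun x => g.norm_coe_le_norm x)
      · exact hr.neg.pos_part.mul_bdd (c := ‖g‖) g.continuous.aestronglyMeasurable
          (Eventually.of_forall fun x => g.norm_coe_le_norm x)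
  rw [withDensity_eq_iff hm.ennreal_ofReal hm.neg.ennreal_ofReal (hfin hr)] at hEq
  filter_upwards [hEq] with x hx
  rcases lt_trichotomy (r x) 0 with h0 | h0 | h0
  · rw [ENNReal.ofReal_of_nonpos h0.le, eq_comm, ENNReal.ofReal_eq_zero] at hx
    simp at hx; exact absurd h0 hx.not_gt
  · exact h0
  · rw [eq_comm, ENNReal.ofReal_of_nonpos (by simpa using h0.le), eq_comm,
      ENNReal.ofReal_eq_zero] at hx
    exact absurd h0 hx.not_gt

/-- A bounded, continuous, injective function on `ℝ` which is `e^{-t/4}` for `t ≥ 0`. -/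
def quarterExp (t : ℝ) : ℝ := Real.exp (-(max t 0) / 4) + (1 - Real.exp (min t 0 / 4))

theorem quarterExp_of_nonneg {t : ℝ} (ht : 0 ≤ t) : quarterExp t = Real.exp (-t / 4) := by
  simp [quarterExp, ht]

/-- The uniqueness theorem asks for separation of all points of `ℝ^d`, not only those of the
orthant. This is why `e^{-t/4}` is continued to `t < 0` by a bounded injective function. -/
theorem quarterExp_strictAnti : StrictAnti quarterExp := by
  intro x y hxy
  unfold quarterExp
  rcases le_or_gt y 0 with hy | hy
  · have h1 : max y 0 = max x 0 := by rw [max_eq_right hy, max_eq_right (hxy.le.trans hy)]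
    rw [h1, min_eq_left hy, min_eq_left (hxy.le.trans hy)]
    gcongr
  · have h1 : max x 0 < max y 0 := by
      rw [max_eq_left hy.le]; exact max_lt hxy hy
    have h2 : min x 0 ≤ min y 0 := min_le_min_right _ hxy.le
    refine add_lt_add_of_lt_of_le ?_ ?_ <;> gcongr

theorem abs_quarterExp_le (t : ℝ) : |quarterExp t| ≤ 2 := by
  unfold quarterExp
  have h1 : Real.exp (-(max t 0) / 4) ≤ 1 := Real.exp_le_one_iff.2 (by
    have := le_max_right t 0; linarith)
  have h2 : Real.exp (min t 0 / 4) ≤ 1 := Real.exp_le_one_iff.2 (by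
    have := min_le_right t 0; linarith)
  have h3 := Real.exp_pos (-(max t 0) / 4)
  have h4 := Real.exp_pos (min t 0 / 4)
  rw [abs_le]; constructor <;> linarith

/-- The function `quarterExp (x j)` on `ℝ^d`. -/
def coordExp {d : ℕ} (j : Fin d) : BoundedContinuousFunction (Fin d → ℝ) ℝ :=
  BoundedContinuousFunction.ofNormedAddCommGroup (fun x => quarterExp (x j))
    (by unfold quarterExp; fun_prop) 2 fun x => abs_quarterExp_le _

/-- The function `∏ⱼ xⱼ^{kⱼ} e^{-cⱼ xⱼ}` on `ℝ^d`. -/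
def expMonomial {d : ℕ} (k : Fin d → ℕ) (c : Fin d → ℝ) (x : Fin d → ℝ) : ℝ :=
  ∏ j, x j ^ k j * Real.exp (-(c j * x j))

namespace expMonomial

variable {d : ℕ}

theorem continuous (k : Fin d → ℕ) (c : Fin d → ℝ) : Continuous (expMonomial k c) := by
  unfold expMonomial; fun_prop

theorem memLp (k : Fin d → ℕ) {c : Fin d → ℝ} (hc : ∀ j, 0 < c j) :
    MemLp (expMonomial k c) 2 (volume.restrict (orthant d)) := by
  rw [memLp_two_iff_integrable_sq (continuous k c).aestronglyMeasurable]
  simp only [expMonomial, ← Finset.prod_pow, volume_restrict_orthant]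
  refine Integrable.fintype_prod (f := fun j t => (t ^ k j * Real.exp (-(c j * t))) ^ 2)
    fun j => ?_
  have := integrableOn_rpow_mul_exp_neg_mul_rpow (p := 1) (s := (2 * k j : ℕ)) (b := 2 * c j)
    (by have : (0 : ℝ) ≤ (2 * k j : ℕ) := by positivity
        linarith) one_pos (by have := hc j; positivity)
  refine IntegrableOn.congr_fun this (fun t _ => ?_) measurableSet_Ioi
  simp only [Real.rpow_natCast, Real.rpow_one]
  rw [mul_pow, ← pow_mul, ← Real.exp_nat_mul, mul_comm 2]
  congr 2
  push_cast; ring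

theorem add_single (k : Fin d → ℕ) (c : Fin d → ℝ) (j : Fin d) (m : ℕ) (x : Fin d → ℝ) :
    expMonomial (k + Pi.single j m) c x = x j ^ m * expMonomial k c x := by
  rw [expMonomial, expMonomial, ← Finset.mul_prod_erase _ _ (Finset.mem_univ j),
    ← Finset.mul_prod_erase _ _ (Finset.mem_univ j)]
  simp only [Pi.add_apply, Pi.single_eq_same, pow_add]
  rw [Finset.prod_congr rfl fun i hi => by rw [Pi.single_eq_of_ne (Finset.ne_of_mem_erase hi)]]
  simp only [pow_zero, mul_one]
  ring

theorem update_add (k : Fin d → ℕ) (c : Fin d → ℝ) (j : Fin d) (δ : ℝ) (x : Fin d → ℝ) :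
    expMonomial k (c + Pi.single j δ) x = Real.exp (-(δ * x j)) * expMonomial k c x := by
  rw [expMonomial, expMonomial, ← Finset.mul_prod_erase _ _ (Finset.mem_univ j),
    ← Finset.mul_prod_erase _ _ (Finset.mem_univ j)]
  simp only [Pi.add_apply, Pi.single_eq_same]
  rw [Finset.prod_congr rfl fun i hi => by rw [Pi.single_eq_of_ne (Finset.ne_of_mem_erase hi)]]
  simp only [add_zero]
  rw [add_mul, neg_add, Real.exp_add]
  ring

theorem nonneg (k : Fin d → ℕ) (c : Fin d → ℝ) {x : Fin d → ℝ} (hx : x ∈ orthant d) :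
    0 ≤ expMonomial k c x :=
  Finset.prod_nonneg fun j _ => mul_nonneg (pow_nonneg (hx j).le _) (Real.exp_pos _).le

end expMonomial

variable {d : ℕ} {f : (Fin d → ℝ) → ℂ}

theorem integrable_mul_ofReal (hf : MemLp f 2 (volume.restrict (orthant d)))
    {g : (Fin d → ℝ) → ℝ} (hg : MemLp g 2 (volume.restrict (orthant d))) :
    Integrable (fun x => f x * (g x : ℂ)) (volume.restrict (orthant d)) :=
  MemLp.integrable_mul hf (MemLp.ofReal (K := ℂ) hg)

/-- One coordinate at a time, a Laguerre polynomial is replaced by an arbitrary one. The induction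
runs over the set of coordinates already freed, and each step uses that the Laguerre polynomials
span. -/
theorem integral_mul_expPoly_eq_zero (hf : MemLp f 2 (volume.restrict (orthant d)))
    (h : ∀ n, ∫ x in orthant d, f x * (laguerreFun n x : ℂ) = 0) (p : Fin d → Polynomial ℝ) :
    ∫ x in orthant d, f x * (expPoly p x : ℂ) = 0 := by
  suffices H : ∀ (S : Finset (Fin d)) (p : Fin d → Polynomial ℝ),
      (∀ i, i ∉ S → p i ∈ Set.range laguerre) → ∫ x in orthant d, f x * (expPoly p x : ℂ) = 0 from
    H Finset.univ p fun i hi => absurd (Finset.mem_univ i) hi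
  intro S
  induction S using Finset.induction_on with
  | empty =>
    intro p hp
    choose n hn using fun i => hp i (Finset.notMem_empty i)
    have := h n
    rwa [laguerreFun_eq, funext hn] at this
  | insert j S hj ih =>
    intro p hp
    have hint : ∀ r, Integrable (fun x => f x * (expPoly (Function.update p j r) x : ℂ))
        (volume.restrict (orthant d)) := fun r => integrable_mul_ofReal hf (expPoly.memLp _)
    have key : ∀ r ∈ Submodule.span ℝ (Set.range laguerre),
        ∫ x in orthant d, f x * (expPoly (Function.update p j r) x : ℂ) = 0 := by
      intro r hr
      induction hr using Submodule.span_induction with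
      | mem r hr =>
        refine ih _ fun i hi => ?_
        by_cases hij : i = j
        · subst hij; simpa using hr
        · rw [Function.update_of_ne hij]
          exact hp i (by simp [hij, hi])
      | zero => simp [expPoly.update_eq]
      | add r s _ _ hr hs =>
        have hsum := integral_add (hint r) (hint s)
        rw [hr, hs, add_zero] at hsum
        rw [← hsum]
        refine integral_congr_ae (Eventually.of_forall fun x => ?_)
        simp [expPoly.update_eq]; ring
      | smul c r _ hr =>
        rw [← mul_zero (c : ℂ), ← hr, ← integral_const_mul]
        refine integral_congr_ae (Eventually.of_forall fun x => ?_)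
        simp [expPoly.update_eq]; ring
    have := key (p j) (by rw [laguerre.span_eq_top]; trivial)
    simpa using this

/-- Expanding `e^{-x_j/4}` into its power series gives terms whose integrals vanish by hypothesis.
Termwise integration is allowed because the increment `1/4` is smaller than every rate `c j ≥ 1/2`;
larger rates are reached by repetition. -/
theorem integral_mul_expMonomial_add (hf : MemLp f 2 (volume.restrict (orthant d)))
    {c : Fin d → ℝ} (hc : ∀ j, 1 / 2 ≤ c j)
    (h : ∀ k, ∫ x in orthant d, f x * (expMonomial k c x : ℂ) = 0) (j : Fin d) (k : Fin d → ℕ) :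
    ∫ x in orthant d, f x * (expMonomial k (c + Pi.single j (1 / 4)) x : ℂ) = 0 := by
  have hc0 : ∀ j, 0 < c j := fun j => by have := hc j; linarith
  set a : ℕ → (Fin d → ℝ) → ℝ := fun m x => (x j / 4) ^ m / (m ! : ℝ) with ha
  have hexp : ∀ t : ℝ, HasSum (fun m : ℕ => t ^ m / (m ! : ℝ)) (Real.exp t) := fun t => by
    rw [Real.exp_eq_exp_ℝ]; exact NormedSpace.expSeries_div_hasSum_exp t
  have hD := hasSum_integral_of_dominated_convergence (μ := volume.restrict (orthant d))
    (F := fun (m : ℕ) x => ((-1 / 4) ^ m / (m ! : ℂ)) *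
      (f x * (expMonomial (k + Pi.single j m) c x : ℂ)))
    (f := fun x => f x * (expMonomial k (c + Pi.single j (1 / 4)) x : ℂ))
    (fun m x => a m x * (‖f x‖ * expMonomial k c x)) ?_ ?_ ?_ ?_ ?_
  · simp only [integral_const_mul, h, mul_zero] at hD
    exact hD.unique hasSum_zero
  · intro m
    exact (integrable_mul_ofReal hf (expMonomial.memLp _ hc0)).aestronglyMeasurable.const_mul _
  · intro m
    refine (ae_restrict_iff' (measurableSet_orthant d)).2 (Eventually.of_forall fun x hx => ?_)
    rw [expMonomial.add_single, norm_mul, norm_mul, Complex.norm_real, norm_mul, norm_pow]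
    simp only [ha]
    rw [Real.norm_of_nonneg (hx j).le, Real.norm_of_nonneg (expMonomial.nonneg k c hx)]
    apply le_of_eq
    simp
    rw [div_pow]
    ring
  · refine Eventually.of_forall fun x => ?_
    exact ((hexp (x j / 4)).summable).mul_right _
  · have : ∀ x, ∑' m, a m x * (‖f x‖ * expMonomial k c x) =
        ‖f x‖ * expMonomial k (c + Pi.single j (-1 / 4)) x := fun x => by
      rw [tsum_mul_right, (hexp (x j / 4)).tsum_eq, expMonomial.update_add]
      rw [show -(-1 / 4 * x j) = x j / 4 by ring]; ring
    simp only [this]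
    -- The majorants sum to `‖f‖` times an exponential monomial whose `j`-th rate has dropped to `c
    -- j - 1/4`, which is still positive.
    refine MemLp.integrable_mul hf.norm (expMonomial.memLp _ fun i => ?_)
    by_cases hij : i = j
    · subst hij; simp; have := hc i; linarith
    · simp [hij, hc0]
  · refine Eventually.of_forall fun x => ?_
    have h1 := (hexp (-(1 / 4 * x j))).mapL Complex.ofRealCLM
    have h2 := h1.mul_left (f x * (expMonomial k c x : ℂ))
    have e1 : ∀ m : ℕ, (-1 / 4) ^ m / (m ! : ℂ) *
        (f x * (expMonomial (k + Pi.single j m) c x : ℂ)) = f x * (expMonomial k c x : ℂ) *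
          Complex.ofRealCLM ((-(1 / 4 * x j)) ^ m / (m ! : ℝ)) := fun m => by
      rw [expMonomial.add_single]
      simp
      rw [show -(4⁻¹ * (x j : ℂ)) = (-1 / 4) * x j by ring, mul_pow]
      ring
    have e2 : f x * (expMonomial k (c + Pi.single j (1 / 4)) x : ℂ) =
        f x * (expMonomial k c x : ℂ) * Complex.ofRealCLM (Real.exp (-(1 / 4 * x j))) := by
      rw [expMonomial.update_add]
      simp; ring
    simp only [e1, e2]
    exact h2

/-- The Laguerre functions are complete in `L²(ℝ^d_+)`. -/
theorem ae_eq_zero_of_integral_mul_laguerreFun_eq_zero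
    (hf : MemLp f 2 (volume.restrict (orthant d)))
    (h : ∀ n, ∫ x in orthant d, f x * (laguerreFun n x : ℂ) = 0) :
    f =ᵐ[volume.restrict (orthant d)] 0 := by
  have hhalf : ∀ k, ∫ x in orthant d, f x * (expMonomial k (fun _ => 1 / 2) x : ℂ) = 0 := by
    intro k
    rw [← integral_mul_expPoly_eq_zero hf h fun j => Polynomial.X ^ k j]
    congr 1
    ext x
    congr 2
    simp only [expMonomial, expPoly, Polynomial.eval_pow, Polynomial.eval_X]
    refine Finset.prod_congr rfl fun j _ => ?_
    congr 2; ring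
  -- Multiplying by `e^{-|x|/2}` makes `f` integrable, as the uniqueness theorem requires, and the
  -- weight has no zeros.
  set g : (Fin d → ℝ) → ℂ := fun x => f x * (expMonomial 0 (fun _ => 1 / 2) x : ℂ) with hg
  have hgi : Integrable g (volume.restrict (orthant d)) :=
    integrable_mul_ofReal hf (expMonomial.memLp _ fun _ => by norm_num)
  set S : Set (BoundedContinuousFunction (Fin d → ℝ) ℝ) := Set.range coordExp with hS
  -- On the orthant a monomial in the generators only raises the rates of the weight by multiples of
  -- `1/4`, so the previous lemma applies factor by factor. The algebra is the linear span of these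
  -- monomials.
  have hmon : ∀ b ∈ Submonoid.closure S, ∃ c : Fin d → ℝ, (∀ j, 1 / 2 ≤ c j) ∧
      (∀ x ∈ orthant d, expMonomial 0 (fun _ => 1 / 2) x * b x = expMonomial 0 c x) ∧
      ∀ k, ∫ x in orthant d, f x * (expMonomial k c x : ℂ) = 0 := by
    intro b hb
    induction hb using Submonoid.closure_induction_left with
    | one => exact ⟨fun _ => 1 / 2, fun _ => le_rfl, fun x _ => by simp, hhalf⟩
    | mul_left u hu b hb ih =>
      obtain ⟨j, rfl⟩ := hu
      obtain ⟨c, hc, hb, hz⟩ := ih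
      refine ⟨c + Pi.single j (1 / 4), fun i => ?_, fun x hx => ?_,
        integral_mul_expMonomial_add hf hc hz j⟩
      · by_cases hij : i = j
        · subst hij; simp; have := hc i; linarith
        · simpa [hij] using hc i
      · rw [expMonomial.update_add, ← hb x hx]
        have : coordExp j x = Real.exp (-(1 / 4 * x j)) := by
          change quarterExp (x j) = _
          rw [quarterExp_of_nonneg (hx j).le]; congr 1; ring
        simp only [BoundedContinuousFunction.coe_mul, Pi.mul_apply, this]
        ring
  have hbdd : ∀ b : BoundedContinuousFunction (Fin d → ℝ) ℝ,
      Integrable (fun x => g x * (b x : ℂ)) (volume.restrict (orthant d)) := fun b =>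
    hgi.mul_bdd (c := ‖b‖) (Complex.continuous_ofReal.comp b.continuous).aestronglyMeasurable
      (Eventually.of_forall fun x => by simpa using b.norm_coe_le_norm x)
  have hA : ∀ b ∈ Algebra.adjoin ℝ S, ∫ x in orthant d, g x * (b x : ℂ) = 0 := by
    intro b hb
    rw [← Subalgebra.mem_toSubmodule, Algebra.adjoin_eq_span] at hb
    induction hb using Submodule.span_induction with
    | mem b hb =>
      obtain ⟨c, -, hb, hz⟩ := hmon b hb
      rw [← hz 0]
      refine setIntegral_congr_fun (measurableSet_orthant d) fun x hx => ?_
      simp only [hg]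
      rw [← hb x hx]; push_cast; ring
    | zero => simp
    | add r s _ _ hr hs =>
      have hsum := integral_add (hbdd r) (hbdd s)
      rw [hr, hs, add_zero] at hsum
      rw [← hsum]
      refine integral_congr_ae (Eventually.of_forall fun x => ?_)
      simp; ring
    | smul c r _ hr =>
      rw [← mul_zero (c : ℂ), ← hr, ← integral_const_mul]
      refine integral_congr_ae (Eventually.of_forall fun x => ?_)
      simp; ring
  have hsep : ∀ x y : Fin d → ℝ, x ≠ y → ∃ b ∈ Algebra.adjoin ℝ S, b x ≠ b y := by
    intro x y hxy
    obtain ⟨j, hj⟩ := Function.ne_iff.1 hxy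
    exact ⟨coordExp j, Algebra.subset_adjoin ⟨j, rfl⟩, quarterExp_strictAnti.injective.ne hj⟩
  have hre := ae_eq_zero_of_forall_mem_subalgebra_integral_eq_zero _ hsep hgi.re fun b hb => by
    have := congrArg Complex.re (hA b hb)
    rw [← RCLike.re_eq_complex_re, ← integral_re (hbdd b)] at this
    simpa using this
  have him := ae_eq_zero_of_forall_mem_subalgebra_integral_eq_zero _ hsep hgi.im fun b hb => by
    have := congrArg Complex.im (hA b hb)
    rw [← RCLike.im_eq_complex_im, ← integral_im (hbdd b)] at this
    simpa using this
  filter_upwards [hre, him] with x h1 h2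
  have h3 : g x = 0 := Complex.ext h1 h2
  have h4 : expMonomial 0 (fun _ => 1 / 2) x ≠ 0 := by
    simp only [expMonomial, Pi.zero_apply, pow_zero, one_mul]
    exact Finset.prod_ne_zero_iff.2 fun j _ => (Real.exp_pos _).ne'
  exact (mul_eq_zero.1 h3).resolve_right (by exact_mod_cast h4)

end

noncomputable section

/-! ### Bounds for the derivatives of the Laguerre functions -/

/-- Each derivative replaces `p` by `p' - p/2` and so costs a factor `n + 1/2 ≤ n + 1`. The
induction needs all `i` at once, since `p'` has the next index. -/
theorem laguerre.abs_iteratedDeriv_mul_exp_le (n k i : ℕ) {t : ℝ} (ht : 0 ≤ t) :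
    |iteratedDeriv k (fun s => (Polynomial.derivative^[i] (laguerre n)).eval s *
      Real.exp (-s / 2)) t| ≤ (n : ℝ) ^ i * (n + 1 : ℝ) ^ k * Real.exp t := by
  have hexp : ∀ s : ℝ, HasDerivAt (fun s : ℝ => Real.exp (-s / 2))
      (Real.exp (-s / 2) * (-1 / 2)) s := fun s => ((hasDerivAt_id s).neg.div_const 2).exp
  have hsmooth : ∀ p : Polynomial ℝ, ContDiff ℝ ∞ fun s => p.eval s * Real.exp (-s / 2) := by
    intro p
    have h1 : ContDiff ℝ ∞ fun s : ℝ => p.eval s := by simpa using p.contDiff_aeval (𝕜 := ℝ) ∞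
    exact h1.mul (contDiff_id.neg.div_const 2).exp
  induction k generalizing i with
  | zero =>
    rw [iteratedDeriv_zero, abs_mul, abs_of_pos (Real.exp_pos _), pow_zero, mul_one]
    have h1 := laguerre.abs_eval_iterate_derivative_le n i ht
    have h2 : Real.exp (-t / 2) ≤ 1 := Real.exp_le_one_iff.2 (by linarith)
    exact (mul_le_of_le_one_right (abs_nonneg _) h2).trans h1
  | succ k ih =>
    have hd : deriv (fun s => (Polynomial.derivative^[i] (laguerre n)).eval s *
        Real.exp (-s / 2)) = (fun s => (Polynomial.derivative^[i + 1] (laguerre n)).eval s *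
          Real.exp (-s / 2)) - fun s => (1 / 2 : ℝ) *
            ((Polynomial.derivative^[i] (laguerre n)).eval s * Real.exp (-s / 2)) := by
      ext s
      refine (((Polynomial.derivative^[i] (laguerre n)).hasDerivAt s).mul (hexp s)).deriv.trans ?_
      simp only [Pi.sub_apply, Function.iterate_succ_apply']
      ring
    have hk : ∀ p : Polynomial ℝ, ContDiffAt ℝ k (fun s => p.eval s * Real.exp (-s / 2)) t :=
      fun p => ((hsmooth p).of_le (by exact_mod_cast le_top)).contDiffAt
    rw [iteratedDeriv_succ', hd, iteratedDeriv_sub (hk _) (contDiffAt_const.mul (hk _)),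
      iteratedDeriv_const_mul _ (hk _)]
    refine (abs_sub _ _).trans ?_
    rw [abs_mul]
    have h1 := ih (i + 1)
    have h2 := ih i
    have h3 : |(1 / 2 : ℝ)| = 1 / 2 := by norm_num
    have h4 : (0 : ℝ) ≤ (n : ℝ) ^ i * (n + 1 : ℝ) ^ k * Real.exp t := by positivity
    rw [h3]
    calc _ ≤ (n : ℝ) ^ (i + 1) * (n + 1 : ℝ) ^ k * Real.exp t +
          1 / 2 * ((n : ℝ) ^ i * (n + 1 : ℝ) ^ k * Real.exp t) := by gcongr
      _ = (n : ℝ) ^ i * (n + 1 : ℝ) ^ k * Real.exp t * (n + 1 / 2) := by ring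
      _ ≤ (n : ℝ) ^ i * (n + 1 : ℝ) ^ k * Real.exp t * (n + 1) := by gcongr; norm_num
      _ = _ := by ring

variable {d : ℕ}

/-- The length `|n| = n₁ + ⋯ + n_d` of a multi-index, as a real number. -/
def multiLength (n : Fin d → ℕ) : ℝ := ((∑ j, n j : ℕ) : ℝ)

theorem multiLength_nonneg (n : Fin d → ℕ) : 0 ≤ multiLength n := Nat.cast_nonneg _

theorem le_multiLength (n : Fin d → ℕ) (j : Fin d) : (n j : ℝ) ≤ multiLength n := by
  rw [multiLength]
  exact_mod_cast Finset.single_le_sum (f := n) (fun _ _ => Nat.zero_le _) (Finset.mem_univ j)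

theorem contDiff_laguerreFun (n : Fin d → ℕ) {m : WithTop ℕ∞} :
    ContDiff ℝ m fun x => (laguerreFun n x : ℂ) := by
  rw [laguerreFun_eq]
  exact Complex.ofRealCLM.contDiff.comp (expPoly.contDiff _)

/-- Leibniz' rule for the product of the one-variable factors. The constant depends on `R` through
`e^R`, but not on `n`; local uniformity up to the boundary is all that the termwise differentiation
needs. -/
theorem norm_iteratedFDeriv_laguerreFun_le (k : ℕ) (R : ℝ) : ∃ C : ℝ, 0 ≤ C ∧
    ∀ (n : Fin d → ℕ) (x : Fin d → ℝ), (∀ j, 0 ≤ x j) → ‖x‖ ≤ R →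
      ‖iteratedFDeriv ℝ k (fun x => (laguerreFun n x : ℂ)) x‖ ≤ C * (1 + multiLength n) ^ k := by
  classical
  refine ⟨∑ p ∈ (Finset.univ : Finset (Fin d)).sym k, ((p : Multiset (Fin d)).countPerms : ℝ) *
    ∏ _j : Fin d, Real.exp R, by positivity, fun n x hx hxR => ?_⟩
  have hfac : ∀ j : Fin d, ContDiff ℝ ∞ fun s : ℝ =>
      (laguerre (n j)).eval s * Real.exp (-s / 2) := fun j => by
    have h1 : ContDiff ℝ ∞ fun s : ℝ => (laguerre (n j)).eval s := by
      simpa using (laguerre (n j)).contDiff_aeval (𝕜 := ℝ) ∞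
    exact h1.mul (contDiff_id.neg.div_const 2).exp
  have hcomp : ∀ j : Fin d, ContDiff ℝ ∞ fun x : Fin d → ℝ =>
      (laguerre (n j)).eval (x j) * Real.exp (-(x j) / 2) := fun j =>
    (hfac j).comp (contDiff_apply ℝ ℝ j)
  have hle : ((k : ℕ) : WithTop ℕ∞) ≤ ((⊤ : ℕ∞) : WithTop ℕ∞) := by exact_mod_cast le_top
  have hbound : ∀ (j : Fin d) (i : ℕ), ‖iteratedFDeriv ℝ i (fun x : Fin d → ℝ =>
      (laguerre (n j)).eval (x j) * Real.exp (-(x j) / 2)) x‖ ≤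
      (1 + multiLength n) ^ i * Real.exp R := by
    intro j i
    let P : (Fin d → ℝ) →L[ℝ] ℝ := ContinuousLinearMap.proj j
    have h1 := P.iteratedFDeriv_comp_right (hfac j) x (i := i) (by exact_mod_cast le_top)
    have hp : ‖P‖ ≤ 1 :=
      ContinuousLinearMap.opNorm_le_bound _ zero_le_one fun y => by
        simpa [P] using norm_le_pi_norm y j
    have h2 : ‖iteratedFDeriv ℝ i (fun x : Fin d → ℝ =>
        (laguerre (n j)).eval (x j) * Real.exp (-(x j) / 2)) x‖ ≤
        ‖iteratedFDeriv ℝ i (fun s : ℝ =>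
          (laguerre (n j)).eval s * Real.exp (-s / 2)) (x j)‖ := by
      refine (le_of_eq (congrArg norm h1)).trans
        ((ContinuousMultilinearMap.norm_compContinuousLinearMap_le _ _).trans ?_)
      refine mul_le_of_le_one_right (norm_nonneg _) ?_
      exact Finset.prod_le_one (fun _ _ => norm_nonneg _) fun _ _ => hp
    refine h2.trans ?_
    rw [norm_iteratedFDeriv_eq_norm_iteratedDeriv]
    refine (laguerre.abs_iteratedDeriv_mul_exp_le (n j) i 0 (hx j)).trans ?_
    rw [pow_zero, one_mul]
    have h3 : x j ≤ R := (le_abs_self _).trans ((norm_le_pi_norm x j).trans hxR)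
    have h4 := le_multiLength n j
    have h5 := multiLength_nonneg n
    gcongr ?_ ^ _ * Real.exp ?_
    · linarith
  have h0 : ‖iteratedFDeriv ℝ k (fun x => (laguerreFun n x : ℂ)) x‖ =
      ‖iteratedFDeriv ℝ k (laguerreFun n) x‖ := by
    have hc : ContDiffAt ℝ ∞ (laguerreFun n) x := by
      rw [laguerreFun_eq]
      exact (expPoly.contDiff _).contDiffAt
    exact Complex.ofRealLI.norm_iteratedFDeriv_comp_left hc hle
  rw [h0, laguerreFun_eq]
  refine (norm_iteratedFDeriv_prod_le (fun j _ => hcomp j) hle).trans ?_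
  rw [Finset.sum_mul]
  refine Finset.sum_le_sum fun p _ => ?_
  rw [mul_assoc]
  refine mul_le_mul_of_nonneg_left ?_ (Nat.cast_nonneg _)
  refine (Finset.prod_le_prod (fun _ _ => norm_nonneg _) fun j _ => hbound j _).trans ?_
  rw [Finset.prod_mul_distrib, Finset.prod_pow_eq_pow_sum,
    Multiset.sum_count_eq_card (fun _ _ => Finset.mem_univ _), mul_comm]
  simp

/-! ### Laguerre series with rapidly decreasing coefficients -/

/-- The sequence `a` decays faster than all powers of `|n|`. -/
def RapidlyDecreasing (a : (Fin d → ℕ) → ℂ) : Prop :=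
  ∀ k : ℕ, Summable fun n => ‖a n‖ * (1 + multiLength n) ^ k

/-- The sum `∑ₙ aₙ lₙ`. -/
def laguerreSeries (a : (Fin d → ℕ) → ℂ) (x : Fin d → ℝ) : ℂ :=
  ∑' n, a n * (laguerreFun n x : ℂ)

theorem closure_orthant_subset : closure (orthant d) ⊆ {x | ∀ j, 0 ≤ x j} :=
  closure_minimal (fun _ hx j => (hx j).le)
    (by simpa only [Set.ofPred_forall] using
      isClosed_iInter fun j => isClosed_le continuous_const (continuous_apply j))

theorem convex_orthant : Convex ℝ (orthant d) := by
  intro x hx y hy s t hs ht hst j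
  have h1 := hx j
  have h2 := hy j
  simp only [Pi.add_apply, Pi.smul_apply, smul_eq_mul]
  rcases hs.eq_or_lt with rfl | hs
  · rw [zero_add] at hst; subst hst; simpa using h2
  · exact add_pos_of_pos_of_nonneg (mul_pos hs h1) (mul_nonneg ht h2.le)

theorem SmoothUpToBoundary.congr {F G : (Fin d → ℝ) → ℂ} (hF : SmoothUpToBoundary F)
    (h : EqOn G F (orthant d)) : SmoothUpToBoundary G := by
  refine ⟨hF.1.congr h, fun k => ?_⟩
  obtain ⟨H, hH, he⟩ := hF.2 k
  refine ⟨H, hH, fun x hx => ?_⟩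
  rw [← he hx]
  exact (Filter.EventuallyEq.iteratedFDeriv ℝ
    (Filter.eventuallyEq_of_mem ((isOpen_orthant d).mem_nhds hx) h) k).self_of_nhds

theorem partialD_eq_fderiv {F : (Fin d → ℝ) → ℂ} (hF : ContDiffOn ℝ ∞ F (orthant d)) (j : Fin d)
    {x : Fin d → ℝ} (hx : x ∈ orthant d) :
    partialD j F x = iteratedFDeriv ℝ 1 F x ![Pi.single j 1] := by
  rw [partialD_eqOn_fderiv j hF hx, iteratedFDeriv_one_apply]
  simp

theorem partialD_partialD_eq {F : (Fin d → ℝ) → ℂ} (hF : ContDiffOn ℝ ∞ F (orthant d)) (j : Fin d)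
    {x : Fin d → ℝ} (hx : x ∈ orthant d) :
    partialD j (partialD j F) x = iteratedFDeriv ℝ 2 F x ![Pi.single j 1, Pi.single j 1] := by
  rw [partialD_eqOn_fderiv j (contDiffOn_partialD j hF) hx, iteratedFDeriv_two_apply]
  have h : partialD j F =ᶠ[𝓝 x] fun y => fderiv ℝ F y (Pi.single j 1) :=
    Filter.eventuallyEq_of_mem ((isOpen_orthant d).mem_nhds hx) (partialD_eqOn_fderiv j hF)
  have hd : DifferentiableAt ℝ (fderiv ℝ F) x :=
    ((hF.fderiv_of_isOpen (isOpen_orthant d) (m := ∞) (by simp)).contDiffAt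
      ((isOpen_orthant d).mem_nhds hx)).differentiableAt (by simp)
  simp only [h.fderiv_eq]
  rw [fderiv_clm_apply hd (differentiableAt_const _)]
  simp

namespace RapidlyDecreasing

variable {a : (Fin d → ℕ) → ℂ}

theorem summable_norm (ha : RapidlyDecreasing a) : Summable fun n => ‖a n‖ := by
  simpa using ha 0

theorem mul_pow (ha : RapidlyDecreasing a) (N : ℕ) :
    RapidlyDecreasing fun n => (multiLength n : ℂ) ^ N * a n := by
  intro k
  refine (ha (N + k)).of_nonneg_of_le
    (fun n => mul_nonneg (norm_nonneg _) (pow_nonneg (by have := multiLength_nonneg n; positivity) _))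
    fun n => ?_
  have h := multiLength_nonneg n
  rw [norm_mul, norm_pow, Complex.norm_real, Real.norm_of_nonneg h, pow_add, mul_comm (_ ^ N),
    mul_assoc]
  gcongr
  linarith

/-- The termwise `k`-th derivative of the Laguerre series. -/
def derivSeries (a : (Fin d → ℕ) → ℂ) (k : ℕ) (x : Fin d → ℝ) : (Fin d → ℝ) [×k]→L[ℝ] ℂ :=
  ∑' n, a n • iteratedFDeriv ℝ k (fun x => (laguerreFun n x : ℂ)) x

theorem norm_term_le (a : (Fin d → ℕ) → ℂ) (k : ℕ) (R : ℝ) : ∃ C : ℝ,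
    ∀ (n : Fin d → ℕ) (x : Fin d → ℝ), (∀ j, 0 ≤ x j) → ‖x‖ ≤ R →
      ‖a n • iteratedFDeriv ℝ k (fun x => (laguerreFun n x : ℂ)) x‖ ≤
        C * (‖a n‖ * (1 + multiLength n) ^ k) := by
  obtain ⟨C, -, hC⟩ := norm_iteratedFDeriv_laguerreFun_le (d := d) k R
  refine ⟨C, fun n x hx hxR => ?_⟩
  rw [norm_smul]
  calc _ ≤ ‖a n‖ * (C * (1 + multiLength n) ^ k) := by gcongr; exact hC n x hx hxR
    _ = _ := by ring

theorem hasSum_derivSeries (ha : RapidlyDecreasing a) (k : ℕ) {x : Fin d → ℝ}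
    (hx : ∀ j, 0 ≤ x j) :
    HasSum (fun n => a n • iteratedFDeriv ℝ k (fun x => (laguerreFun n x : ℂ)) x)
      (derivSeries a k x) := by
  obtain ⟨C, hC⟩ := norm_term_le a k ‖x‖
  exact (Summable.of_norm_bounded ((ha k).mul_left C) fun n => hC n x hx le_rfl).hasSum

/-- The Weierstrass test on bounded pieces of the closed orthant. These sums are the continuous
extensions of the derivatives to the boundary. -/
theorem continuousOn_derivSeries (ha : RapidlyDecreasing a) (k : ℕ) :
    ContinuousOn (derivSeries a k) (closure (orthant d)) := by
  intro x hx
  obtain ⟨C, hC⟩ := norm_term_le a k (‖x‖ + 1)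
  have h : ContinuousOn (derivSeries a k) (closure (orthant d) ∩ Metric.ball 0 (‖x‖ + 1)) :=
    continuousOn_tsum (fun n => (((contDiff_laguerreFun n).continuous_iteratedFDeriv
      (m := k) (n := ∞) (by exact_mod_cast le_top)).const_smul (a n)).continuousOn)
      ((ha k).mul_left C) fun n y hy => hC n y (closure_orthant_subset hy.1)
        (by simpa using (mem_ball_zero_iff.1 hy.2).le)
  exact (h x ⟨hx, by simp⟩).mono_of_mem_nhdsWithin
    (inter_mem_nhdsWithin _ (Metric.isOpen_ball.mem_nhds (by simp)))

/-- Termwise differentiation on a bounded, open and convex piece of the orthant, where the series of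
the next derivatives is uniformly dominated. -/
theorem hasFDerivAt_derivSeries (ha : RapidlyDecreasing a) (k : ℕ) {x : Fin d → ℝ}
    (hx : x ∈ orthant d) : HasFDerivAt (derivSeries a k)
      ((continuousMultilinearCurryLeftEquiv ℝ (fun _ : Fin (k + 1) => Fin d → ℝ) ℂ)
        (derivSeries a (k + 1) x)) x := by
  obtain ⟨C, hC⟩ := norm_term_le a (k + 1) (‖x‖ + 1)
  have hfd : ∀ (n : Fin d → ℕ) y, HasFDerivAt
      (fun y => a n • iteratedFDeriv ℝ k (fun x => (laguerreFun n x : ℂ)) y)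
      ((continuousMultilinearCurryLeftEquiv ℝ (fun _ : Fin (k + 1) => Fin d → ℝ) ℂ)
        (a n • iteratedFDeriv ℝ (k + 1) (fun x => (laguerreFun n x : ℂ)) y)) y := by
    intro n y
    have h1 : DifferentiableAt ℝ (iteratedFDeriv ℝ k (fun x => (laguerreFun n x : ℂ))) y :=
      ((contDiff_laguerreFun n (m := ∞)).differentiable_iteratedFDeriv
        (by exact_mod_cast ENat.natCast_lt_top k)) y
    have h2 := h1.hasFDerivAt.const_smul (a n)
    refine h2.congr_fderiv ?_
    rw [fderiv_iteratedFDeriv]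
    rfl
  have hsum := (continuousMultilinearCurryLeftEquiv ℝ (fun _ : Fin (k + 1) => Fin d → ℝ)
    ℂ).toContinuousLinearEquiv.toContinuousLinearMap.hasSum
    (hasSum_derivSeries ha (k + 1) fun j => (hx j).le)
  rw [← show _ = (continuousMultilinearCurryLeftEquiv ℝ (fun _ : Fin (k + 1) => Fin d → ℝ) ℂ)
        (derivSeries a (k + 1) x) from hsum.tsum_eq]
  refine hasFDerivAt_tsum_of_isPreconnected (s := orthant d ∩ Metric.ball 0 (‖x‖ + 1))
    ((ha (k + 1)).mul_left C) ((isOpen_orthant d).inter Metric.isOpen_ball)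
    (convex_orthant.inter (convex_ball _ _)).isPreconnected (fun n y _ => hfd n y)
    (fun n y hy => ?_) (x₀ := x) ⟨hx, by simp⟩
    (hasSum_derivSeries ha k fun j => (hx j).le).summable ⟨hx, by simp⟩
  exact (LinearIsometryEquiv.norm_map _ _).trans_le
    (hC n y (fun j => (hy.1 j).le) (mem_ball_zero_iff.1 hy.2).le)

theorem iteratedFDeriv_laguerreSeries (ha : RapidlyDecreasing a) (k : ℕ) :
    EqOn (iteratedFDeriv ℝ k (laguerreSeries a)) (derivSeries a k) (orthant d) := by
  induction k with
  | zero =>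
    intro x hx
    have := (continuousMultilinearCurryFin0 ℝ (Fin d → ℝ)
      ℂ).symm.toContinuousLinearEquiv.map_tsum
        (f := fun n => a n * (laguerreFun n x : ℂ)) (L := SummationFilter.unconditional _)
    rw [iteratedFDeriv_zero_eq_comp]
    refine Eq.trans this (tsum_congr fun n => ?_)
    ext m
    simp
  | succ k ih =>
    intro x hx
    have h : iteratedFDeriv ℝ k (laguerreSeries a) =ᶠ[𝓝 x] derivSeries a k :=
      Filter.eventuallyEq_of_mem ((isOpen_orthant d).mem_nhds hx) ih
    rw [iteratedFDeriv_succ_eq_comp_left, Function.comp_apply, h.fderiv_eq,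
      (hasFDerivAt_derivSeries ha k hx).fderiv]
    simp

theorem smoothUpToBoundary (ha : RapidlyDecreasing a) : SmoothUpToBoundary (laguerreSeries a) := by
  refine ⟨?_, fun k => ⟨derivSeries a k, continuousOn_derivSeries ha k,
    iteratedFDeriv_laguerreSeries ha k⟩⟩
  refine contDiffOn_of_differentiableOn fun k _ => ?_
  refine DifferentiableOn.congr (f := derivSeries a k)
    (fun x hx => (hasFDerivAt_derivSeries ha k hx).differentiableAt.differentiableWithinAt)
    fun x hx => ?_
  rw [iteratedFDerivWithin_of_isOpen k (isOpen_orthant d) hx, iteratedFDeriv_laguerreSeries ha k hx]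

theorem hasSum_laguerreSeries (ha : RapidlyDecreasing a) {x : Fin d → ℝ} (hx : x ∈ orthant d) :
    HasSum (fun n => a n * (laguerreFun n x : ℂ)) (laguerreSeries a x) := by
  have h := ContinuousMultilinearMap.hasSum_eval
    (hasSum_derivSeries ha 0 fun j => (hx j).le) ![]
  rw [← iteratedFDeriv_laguerreSeries ha 0 hx] at h
  simpa using h

theorem laguerreOp_laguerreSeries (ha : RapidlyDecreasing a) :
    EqOn (laguerreOp (laguerreSeries a))
      (laguerreSeries fun n => (multiLength n : ℂ) * a n) (orthant d) := by
  intro x hx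
  have hF := ha.smoothUpToBoundary.1
  have hx0 : ∀ j, 0 ≤ x j := fun j => (hx j).le
  have hl : ∀ n : Fin d → ℕ, ContDiffOn ℝ ∞ (fun x => (laguerreFun n x : ℂ)) (orthant d) :=
    fun n => (contDiff_laguerreFun n).contDiffOn
  have h1 : ∀ j, HasSum (fun n => a n * partialD j (fun x => (laguerreFun n x : ℂ)) x)
      (partialD j (laguerreSeries a) x) := fun j => by
    have h := ContinuousMultilinearMap.hasSum_eval
      (hasSum_derivSeries ha 1 hx0) ![Pi.single j 1]
    rw [← iteratedFDeriv_laguerreSeries ha 1 hx, ← partialD_eq_fderiv hF j hx] at h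
    simpa only [partialD_eq_fderiv (hl _) j hx, smul_apply,
      smul_eq_mul] using h
  have h2 : ∀ j, HasSum (fun n => a n * partialD j (partialD j
      (fun x => (laguerreFun n x : ℂ))) x) (partialD j (partialD j (laguerreSeries a)) x) :=
    fun j => by
      have h := ContinuousMultilinearMap.hasSum_eval
        (hasSum_derivSeries ha 2 hx0) ![Pi.single j 1, Pi.single j 1]
      rw [← iteratedFDeriv_laguerreSeries ha 2 hx, ← partialD_partialD_eq hF j hx] at h
      simpa only [partialD_partialD_eq (hl _) j hx, smul_apply,
        smul_eq_mul] using h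
  have h0 := hasSum_laguerreSeries ha hx
  have h3 := (hasSum_sum (s := (Finset.univ : Finset (Fin d))) fun j _ =>
    ((((h2 j).mul_left (x j : ℂ)).add (h1 j)).sub (h0.mul_left ((x j : ℂ) / 4))).add
      (h0.mul_left (1 / 2 : ℂ))).neg
  have h4 : HasSum (fun n => ((multiLength n : ℂ) * a n) * (laguerreFun n x : ℂ))
      (laguerreOp (laguerreSeries a) x) := by
    refine HasSum.congr_fun h3 fun n => ?_
    have h5 := congrFun (laguerreOp_laguerreFun n) x
    rw [multiLength, mul_right_comm, Complex.ofReal_natCast, ← h5, laguerreOp, mul_comm, mul_neg,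
      Finset.mul_sum]
    congr 1
    refine Finset.sum_congr rfl fun j _ => ?_
    ring
  exact h4.tsum_eq.symm

theorem laguerreOp_iterate_laguerreSeries (ha : RapidlyDecreasing a) (N : ℕ) :
    EqOn (laguerreOp^[N] (laguerreSeries a))
      (laguerreSeries fun n => (multiLength n : ℂ) ^ N * a n) (orthant d) := by
  induction N with
  | zero => intro x _; simp
  | succ N ih =>
    intro x hx
    rw [Function.iterate_succ_apply', laguerreOp_congr ih hx,
      laguerreOp_laguerreSeries (ha.mul_pow N) hx]
    simp only [pow_succ', mul_assoc]

end RapidlyDecreasing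
end

noncomputable section

/-! ### Laguerre series in `L²` -/

variable {d : ℕ}

theorem zeroExt_apply {f : orthant d → ℂ} {x : Fin d → ℝ} (hx : x ∈ orthant d) :
    zeroExt f x = f ⟨x, hx⟩ := by
  simp [zeroExt, hx]

theorem zeroExt_restrict_eqOn (F : (Fin d → ℝ) → ℂ) :
    EqOn (zeroExt fun x : orthant d => F x) F (orthant d) := fun _ hx => zeroExt_apply hx

theorem memLp_laguerreFun (n : Fin d → ℕ) :
    MemLp (laguerreFun n) 2 (volume.restrict (orthant d)) := by
  rw [laguerreFun_eq]; exact expPoly.memLp _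

theorem ae_orthant_of_forall {P : (Fin d → ℝ) → Prop} (h : ∀ x ∈ orthant d, P x) :
    ∀ᵐ x ∂volume.restrict (orthant d), P x :=
  (ae_restrict_iff' (measurableSet_orthant d)).2 (Eventually.of_forall h)

theorem eta_congr {h α : ℝ} {F G : (Fin d → ℝ) → ℂ} (hFG : EqOn F G (orthant d)) :
    eta h α F = eta h α G :=
  iSup_congr fun N => by
    rw [eLpNorm_congr_ae (ae_orthant_of_forall (laguerreOp_iterate_congr N hFG))]

theorem integral_abs_laguerreFun_mul_le (m n : Fin d → ℕ) :
    ∫ x in orthant d, |laguerreFun m x * laguerreFun n x| ≤ 1 := by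
  have hi : ∀ k : Fin d → ℕ, Integrable (fun x => laguerreFun k x * laguerreFun k x)
      (volume.restrict (orthant d)) := fun k => (memLp_laguerreFun k).integrable_mul
        (memLp_laguerreFun k)
  calc ∫ x in orthant d, |laguerreFun m x * laguerreFun n x|
      ≤ ∫ x in orthant d, (1 / 2 : ℝ) * (laguerreFun m x * laguerreFun m x +
          laguerreFun n x * laguerreFun n x) := by
        refine integral_mono ((memLp_laguerreFun m).integrable_mul (memLp_laguerreFun n)).abs
          (((hi m).add (hi n)).const_mul _) fun x => ?_
        simp only
        rw [abs_le]
        constructor <;> nlinarith [sq_nonneg (laguerreFun m x + laguerreFun n x),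
          sq_nonneg (laguerreFun m x - laguerreFun n x)]
    _ = 1 := by
        rw [integral_const_mul, integral_add (hi m) (hi n), integral_laguerreFun_mul,
          integral_laguerreFun_mul]
        norm_num

theorem laguerreCoeff_eq_of_eqOn {f : orthant d → ℂ} {F : (Fin d → ℝ) → ℂ}
    (h : EqOn (zeroExt f) F (orthant d)) (n : Fin d → ℕ) :
    laguerreCoeff f n = ∫ x in orthant d, F x * (laguerreFun n x : ℂ) :=
  setIntegral_congr_fun (measurableSet_orthant d) fun x hx => by rw [h hx]

/-- Bessel's inequality for a single Laguerre coefficient. -/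
theorem enorm_integral_mul_laguerreFun_le {F : (Fin d → ℝ) → ℂ}
    (hF : AEStronglyMeasurable F (volume.restrict (orthant d))) (n : Fin d → ℕ) :
    ‖∫ x in orthant d, F x * (laguerreFun n x : ℂ)‖ₑ ≤
      eLpNorm F 2 (volume.restrict (orthant d)) := by
  refine (enorm_integral_le_lintegral_enorm _).trans ?_
  rw [← eLpNorm_one_eq_lintegral_enorm]
  have hm : AEStronglyMeasurable (fun x => (laguerreFun n x : ℂ)) (volume.restrict (orthant d)) :=
    (contDiff_laguerreFun n (m := 0)).continuous.aestronglyMeasurable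
  have h := eLpNorm_smul_le_mul_eLpNorm (p := 2) (q := 2) (r := 1) hm hF
  rw [eLpNorm_laguerreFun, mul_one] at h
  exact h

namespace RapidlyDecreasing

variable {a : (Fin d → ℕ) → ℂ}

/-- Fatou's lemma along a sequence of finite sets that exhausts the multi-indices, and the triangle
inequality with `‖l_n‖ = 1`. Orthogonality is not used: losing a summable factor does no harm to the
weighted norms. -/
theorem eLpNorm_laguerreSeries_le (ha : RapidlyDecreasing a) :
    eLpNorm (laguerreSeries a) 2 (volume.restrict (orthant d)) ≤ ∑' n, ‖a n‖ₑ := by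
  obtain ⟨u, hu⟩ := exists_seq_tendsto (atTop : Filter (Finset (Fin d → ℕ)))
  have hm : ∀ n : Fin d → ℕ, AEStronglyMeasurable (fun x => a n * (laguerreFun n x : ℂ))
      (volume.restrict (orthant d)) := fun n =>
    (MemLp.ofReal (K := ℂ) (memLp_laguerreFun n)).aestronglyMeasurable.const_mul _
  refine (Lp.eLpNorm_lim_le_liminf_eLpNorm (μ := volume.restrict (orthant d)) (p := 2)
    (f := fun m x => ∑ n ∈ u m, a n * (laguerreFun n x : ℂ))
    (fun m => Finset.aestronglyMeasurable_fun_sum _ fun n _ => hm n) _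
    (ae_orthant_of_forall fun x hx => (ha.hasSum_laguerreSeries hx).comp hu)).trans ?_
  refine liminf_le_of_le (by isBoundedDefault) fun b hb => ?_
  obtain ⟨m, hm'⟩ := hb.exists
  refine hm'.trans ?_
  calc _ ≤ ∑ n ∈ u m, eLpNorm (fun x => a n * (laguerreFun n x : ℂ)) 2
        (volume.restrict (orthant d)) := by
        have := eLpNorm_sum_le (μ := volume.restrict (orthant d)) (p := 2) (s := u m)
          (f := fun n x => a n * (laguerreFun n x : ℂ)) (fun n _ => hm n) (by norm_num)
        convert! this using 2
        ext x; simp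
    _ = ∑ n ∈ u m, ‖a n‖ₑ := by
        refine Finset.sum_congr rfl fun n _ => ?_
        have := eLpNorm_const_smul (a n) (fun x => (laguerreFun n x : ℂ)) 2
          (volume.restrict (orthant d))
        rw [eLpNorm_laguerreFun, mul_one] at this
        exact this
    _ ≤ _ := ENNReal.sum_le_tsum _

theorem memLp_laguerreSeries (ha : RapidlyDecreasing a) :
    MemLp (laguerreSeries a) 2 (volume.restrict (orthant d)) := by
  refine ⟨ha.smoothUpToBoundary.1.continuousOn.aestronglyMeasurable (measurableSet_orthant d),
    ha.eLpNorm_laguerreSeries_le.trans_lt ?_⟩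
  exact (tsum_enorm_ne_top_iff_summable_norm.2 ha.summable_norm).lt_top

theorem integral_laguerreSeries_mul (ha : RapidlyDecreasing a) (m : Fin d → ℕ) :
    ∫ x in orthant d, laguerreSeries a x * (laguerreFun m x : ℂ) = a m := by
  have hint : ∀ n : Fin d → ℕ, Integrable (fun x => ((laguerreFun n x * laguerreFun m x : ℝ) : ℂ))
      (volume.restrict (orthant d)) := fun n =>
    ((memLp_laguerreFun n).integrable_mul (memLp_laguerreFun m)).ofReal
  have h := hasSum_integral_of_summable_integral_norm (μ := volume.restrict (orthant d))
    (F := fun n x => a n * ((laguerreFun n x * laguerreFun m x : ℝ) : ℂ))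
    (fun n => (hint n).const_mul _) ?_
  · have h1 : ∀ n, ∫ x in orthant d, a n * ((laguerreFun n x * laguerreFun m x : ℝ) : ℂ) =
        if n = m then a n else 0 := fun n => by
      rw [integral_const_mul, integral_complex_ofReal, integral_laguerreFun_mul]
      split_ifs <;> simp
    simp only [h1] at h
    have h2 := h.unique (hasSum_ite_eq m (a m) |>.congr_fun fun n => by
      by_cases hn : n = m <;> simp [hn])
    rw [← h2]
    refine setIntegral_congr_fun (measurableSet_orthant d) fun x hx => ?_
    have h3 := (ha.hasSum_laguerreSeries hx).mul_right (laguerreFun m x : ℂ)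
    rw [← h3.tsum_eq]
    exact tsum_congr fun n => by push_cast; ring
  · refine ha.summable_norm.of_nonneg_of_le (fun n => integral_nonneg fun x => norm_nonneg _)
      fun n => ?_
    simp only [norm_mul _ (_ : ℂ), Complex.norm_real, Real.norm_eq_abs]
    rw [integral_const_mul]
    exact mul_le_of_le_one_right (norm_nonneg _) (integral_abs_laguerreFun_mul_le n m)

theorem isLaguerreSum (ha : RapidlyDecreasing a) {f : orthant d → ℂ}
    (hf : EqOn (zeroExt f) (laguerreSeries a) (orthant d)) : IsLaguerreSum a f := by
  refine ⟨fun x => ?_, ?_⟩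
  · have := ha.hasSum_laguerreSeries x.2
    rwa [← hf x.2, zeroExt_apply x.2] at this
  · have hsum : ∑' n, ‖a n‖ₑ ≠ ⊤ := tsum_enorm_ne_top_iff_summable_norm.2 ha.summable_norm
    refine tendsto_of_tendsto_of_tendsto_of_le_of_le tendsto_const_nhds
      (ENNReal.tendsto_tsum_compl_atTop_zero hsum) (fun _ => bot_le) fun s => ?_
    -- The remainder after the partial sum over `s` is again a Laguerre series, with the
    -- coefficients in `s` set to zero. Its norm is at most the tail of the sum of the `‖a n‖ₑ`.
    set b : (Fin d → ℕ) → ℂ := fun n => if n ∈ s then 0 else a n with hb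
    have hble : ∀ n, ‖b n‖ ≤ ‖a n‖ := fun n => by
      simp only [hb]; split_ifs <;> simp
    have hbr : RapidlyDecreasing b := fun k => (ha k).of_nonneg_of_le
      (fun n => mul_nonneg (norm_nonneg _)
        (pow_nonneg (by have := multiLength_nonneg n; positivity) _))
      fun n => by have := multiLength_nonneg n; gcongr; exact hble n
    have heq : EqOn (fun x => zeroExt f x - ∑ n ∈ s, a n * (laguerreFun n x : ℂ))
        (laguerreSeries b) (orthant d) := fun x hx => by
      simp only
      rw [hf hx]
      have h1 := ha.hasSum_laguerreSeries hx
      have h2 : HasSum (fun n => if n ∈ s then a n * (laguerreFun n x : ℂ) else 0)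
          (∑ n ∈ s, a n * (laguerreFun n x : ℂ)) := by
        have h3 := hasSum_sum_of_ne_finset_zero (s := s)
          (L := SummationFilter.unconditional _)
          (f := fun n => if n ∈ s then a n * (laguerreFun n x : ℂ) else 0)
          fun n hn => if_neg hn
        rwa [Finset.sum_congr rfl fun n hn => if_pos hn] at h3
      refine ((h1.sub h2).tsum_eq.symm).trans (tsum_congr fun n => ?_)
      simp only [hb]; split_ifs <;> simp
    rw [eLpNorm_congr_ae (ae_orthant_of_forall heq)]
    refine hbr.eLpNorm_laguerreSeries_le.trans (le_of_eq ?_)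
    refine Eq.trans (tsum_congr fun n => ?_) (tsum_subtype {n | n ∉ s} fun n => ‖a n‖ₑ).symm
    by_cases hn : n ∈ s
    · simp [hb, hn]
    · simp [hb, hn]

/-- A continuous square integrable function with rapidly decreasing Laguerre coefficients is the
sum of its Laguerre series. -/
theorem eqOn_laguerreSeries {F : (Fin d → ℝ) → ℂ} (hF : MemLp F 2 (volume.restrict (orthant d)))
    (hc : ContinuousOn F (orthant d)) (ha : RapidlyDecreasing a)
    (h : ∀ n, ∫ x in orthant d, F x * (laguerreFun n x : ℂ) = a n) :
    EqOn F (laguerreSeries a) (orthant d) := by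
  have h0 := ae_eq_zero_of_integral_mul_laguerreFun_eq_zero (hF.sub ha.memLp_laguerreSeries)
    fun n => by
      simp only [Pi.sub_apply, sub_mul]
      rw [integral_sub (integrable_mul_ofReal hF (memLp_laguerreFun n))
        (integrable_mul_ofReal ha.memLp_laguerreSeries (memLp_laguerreFun n)), h,
        ha.integral_laguerreSeries_mul, sub_self]
  -- Completeness gives equality almost everywhere; both functions are continuous on the open
  -- orthant, so they agree at every point.
  refine Measure.eqOn_open_of_ae_eq (μ := volume) ?_ (isOpen_orthant d) hc
    ha.smoothUpToBoundary.1.continuousOn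
  filter_upwards [h0] with x hx
  exact sub_eq_zero.1 hx

end RapidlyDecreasing
end

noncomputable section

/-! ### Symmetry of the Laguerre operator -/

variable {d : ℕ}

/-- `F` is smooth on the orthant, and all of its derivatives are bounded on bounded subsets. -/
def LocallyBoundedDerivs (F : (Fin d → ℝ) → ℂ) : Prop :=
  ContDiffOn ℝ ∞ F (orthant d) ∧
    ∀ (k : ℕ) (R : ℝ), ∃ C, ∀ x ∈ orthant d, ‖x‖ ≤ R → ‖iteratedFDeriv ℝ k F x‖ ≤ C

/-- A continuous extension is bounded on compact pieces of the closed orthant. The weaker property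
passes easily to products, derivatives and images under `E`, as no extensions have to be carried
along. -/
theorem SmoothUpToBoundary.locallyBoundedDerivs {F : (Fin d → ℝ) → ℂ}
    (hF : SmoothUpToBoundary F) : LocallyBoundedDerivs F := by
  refine ⟨hF.1, fun k R => ?_⟩
  obtain ⟨G, hG, he⟩ := hF.2 k
  obtain ⟨C, hC⟩ := ((isCompact_closedBall (0 : Fin d → ℝ) R).inter_left
    (isClosed_closure (s := orthant d))).exists_bound_of_continuousOn (hG.mono inter_subset_left)
  exact ⟨C, fun x hx hxR => by
    rw [he hx]; exact hC x ⟨subset_closure hx, mem_closedBall_zero_iff.2 hxR⟩⟩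

namespace LocallyBoundedDerivs

variable {F G : (Fin d → ℝ) → ℂ}

theorem of_contDiff (hF : ContDiff ℝ ∞ F) : LocallyBoundedDerivs F :=
  SmoothUpToBoundary.locallyBoundedDerivs ⟨hF.contDiffOn, fun k => ⟨iteratedFDeriv ℝ k F,
    (hF.continuous_iteratedFDeriv (by exact_mod_cast le_top)).continuousOn, fun _ _ => rfl⟩⟩

theorem exists_bound (hF : LocallyBoundedDerivs F) (R : ℝ) :
    ∃ C, 0 ≤ C ∧ ∀ x ∈ orthant d, ‖x‖ ≤ R → ‖F x‖ ≤ C := by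
  obtain ⟨C, hC⟩ := hF.2 0 R
  exact ⟨max C 0, le_max_right _ _, fun x hx hxR => le_max_of_le_left (by simpa using hC x hx hxR)⟩

theorem congr (hF : LocallyBoundedDerivs F) (h : EqOn G F (orthant d)) :
    LocallyBoundedDerivs G := by
  refine ⟨hF.1.congr h, fun k R => ?_⟩
  obtain ⟨C, hC⟩ := hF.2 k R
  refine ⟨C, fun x hx hxR => ?_⟩
  rw [(Filter.EventuallyEq.iteratedFDeriv ℝ
    (Filter.eventuallyEq_of_mem ((isOpen_orthant d).mem_nhds hx) h) k).self_of_nhds]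
  exact hC x hx hxR

theorem contDiffAt (hF : LocallyBoundedDerivs F) {x : Fin d → ℝ} (hx : x ∈ orthant d) :
    ContDiffAt ℝ ∞ F x := hF.1.contDiffAt ((isOpen_orthant d).mem_nhds hx)

theorem add (hF : LocallyBoundedDerivs F) (hG : LocallyBoundedDerivs G) :
    LocallyBoundedDerivs fun x => F x + G x := by
  refine ⟨hF.1.add hG.1, fun k R => ?_⟩
  obtain ⟨C, hC⟩ := hF.2 k R
  obtain ⟨D, hD⟩ := hG.2 k R
  refine ⟨C + D, fun x hx hxR => ?_⟩
  have h := iteratedFDeriv_add_apply (i := k) ((hF.contDiffAt hx).of_le (by exact_mod_cast le_top))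
    ((hG.contDiffAt hx).of_le (by exact_mod_cast le_top))
  exact (congrArg norm h).trans_le
    ((norm_add_le _ _).trans (add_le_add (hC x hx hxR) (hD x hx hxR)))

theorem mul (hF : LocallyBoundedDerivs F) (hG : LocallyBoundedDerivs G) :
    LocallyBoundedDerivs fun x => F x * G x := by
  refine ⟨hF.1.mul hG.1, fun k R => ?_⟩
  choose C hC using fun i => hF.2 i R
  choose D hD using fun i => hG.2 i R
  refine ⟨∑ i ∈ Finset.range (k + 1), (k.choose i : ℝ) * C i * D (k - i), fun x hx hxR => ?_⟩
  have h := norm_iteratedFDerivWithin_mul_le (n := k) hF.1 hG.1 (isOpen_orthant d).uniqueDiffOn hx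
    (by exact_mod_cast le_top)
  simp only [iteratedFDerivWithin_of_isOpen _ (isOpen_orthant d) hx] at h
  refine h.trans (Finset.sum_le_sum fun i _ => ?_)
  have h1 := hC i x hx hxR
  have h2 := hD (k - i) x hx hxR
  have h3 := (norm_nonneg _).trans h1
  gcongr

theorem const_mul (hF : LocallyBoundedDerivs F) (c : ℂ) :
    LocallyBoundedDerivs fun x => c * F x := (of_contDiff contDiff_const).mul hF

theorem coord_mul (hF : LocallyBoundedDerivs F) (j : Fin d) :
    LocallyBoundedDerivs fun x => (x j : ℂ) * F x :=
  (of_contDiff (Complex.ofRealCLM.contDiff.comp (contDiff_apply ℝ ℝ j))).mul hF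

theorem finset_sum {ι : Type*} (s : Finset ι) {F : ι → (Fin d → ℝ) → ℂ}
    (hF : ∀ i, LocallyBoundedDerivs (F i)) : LocallyBoundedDerivs fun x => ∑ i ∈ s, F i x := by
  classical
  induction s using Finset.induction_on with
  | empty => simpa using of_contDiff contDiff_const
  | insert i s hi ih => simpa [Finset.sum_insert hi] using (hF i).add ih

theorem partialD (hF : LocallyBoundedDerivs F) (j : Fin d) :
    LocallyBoundedDerivs (partialD j F) := by
  refine congr (F := fun x => fderiv ℝ F x (Pi.single j 1)) ?_ (partialD_eqOn_fderiv j hF.1)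
  have hd := hF.1.fderiv_of_isOpen (isOpen_orthant d) (m := ∞) (by simp)
  refine ⟨hd.clm_apply contDiffOn_const, fun k R => ?_⟩
  obtain ⟨C, hC⟩ := hF.2 (k + 1) R
  refine ⟨‖(Pi.single j 1 : Fin d → ℝ)‖ * C, fun x hx hxR => ?_⟩
  refine (norm_iteratedFDeriv_clm_apply_const
    (hd.contDiffAt ((isOpen_orthant d).mem_nhds hx)) (by exact_mod_cast le_top)).trans ?_
  rw [norm_iteratedFDeriv_fderiv]
  gcongr
  exact hC x hx hxR

theorem laguerreOp (hF : LocallyBoundedDerivs F) : LocallyBoundedDerivs (laguerreOp F) := by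
  have h := (finset_sum Finset.univ fun j => ((((hF.partialD j).partialD j).coord_mul j).add
    (hF.partialD j)).add (((hF.coord_mul j).const_mul (-1 / 4)).add (hF.const_mul (1 / 2)))).const_mul
      (-1)
  refine h.congr fun x _ => ?_
  simp only
  rw [neg_one_mul, _root_.laguerreOp]
  congr 1
  refine Finset.sum_congr rfl fun j _ => ?_
  ring

theorem laguerreOp_iterate (hF : LocallyBoundedDerivs F) (N : ℕ) :
    LocallyBoundedDerivs (_root_.laguerreOp^[N] F) := by
  induction N with
  | zero => exact hF
  | succ N ih => rw [Function.iterate_succ_apply']; exact ih.laguerreOp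

theorem integrableOn_mul (hF : LocallyBoundedDerivs F) {ψ : (Fin d → ℝ) → ℂ}
    (hψ : Continuous ψ) (hs : HasCompactSupport ψ) :
    Integrable (fun x => F x * ψ x) (volume.restrict (orthant d)) := by
  obtain ⟨R, hR⟩ := hs.isBounded.subset_closedBall (0 : Fin d → ℝ)
  obtain ⟨C, hC0, hC⟩ := hF.exists_bound R
  have hfm := hF.1.continuousOn.aestronglyMeasurable (measurableSet_orthant d) (μ := volume)
  refine (((hψ.integrable_of_hasCompactSupport hs).norm.const_mul C).integrableOn
    (s := orthant d)).mono' (hfm.mul hψ.aestronglyMeasurable) ?_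
  refine ae_orthant_of_forall fun x hx => ?_
  rw [norm_mul]
  by_cases hx' : x ∈ tsupport ψ
  · gcongr
    exact hC x hx (mem_closedBall_zero_iff.1 (hR hx'))
  · simp [image_eq_zero_of_notMem_tsupport hx']

theorem hasLineDerivAt (hF : LocallyBoundedDerivs F) (j : Fin d) {x : Fin d → ℝ}
    (hx : x ∈ orthant d) : HasLineDerivAt ℝ F (_root_.partialD j F x) x (Pi.single j 1) :=
  ((hF.contDiffAt hx).differentiableAt (by simp)).lineDifferentiableAt.hasLineDerivAt

end LocallyBoundedDerivs

/-- A function which vanishes at the face `x_j = 0` and for large `x_j` has a derivative in the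
direction of `x_j` with vanishing integral over the orthant. -/
theorem integral_orthant_hasLineDerivAt_eq_zero (j : Fin d) {H H' : (Fin d → ℝ) → ℂ}
    (hderiv : ∀ x ∈ orthant d, HasLineDerivAt ℝ H (H' x) x (Pi.single j 1))
    (hint : IntegrableOn H' (orthant d)) {C R : ℝ}
    (hb : ∀ x ∈ orthant d, ‖H x‖ ≤ C * x j) (hz : ∀ x ∈ orthant d, R < x j → H x = 0) :
    ∫ x in orthant d, H' x = 0 := by
  obtain _ | m := d
  · exact j.elim0
  -- Fubini with the `j`-th variable integrated first reduces the claim to the fundamental theorem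
  -- of calculus on half-lines.
  have hmp := (volume_preserving_piFinSuccAbove (fun _ : Fin (m + 1) => ℝ) j).symm
  have hmem : ∀ (t : ℝ) (y : Fin m → ℝ),
      (j.insertNth t y : Fin (m + 1) → ℝ) ∈ orthant (m + 1) ↔ 0 < t ∧ y ∈ orthant m := by
    intro t y
    simp only [orthant, Set.mem_ofPred_eq, Fin.forall_iff_succAbove j, Fin.insertNth_apply_same,
      Fin.insertNth_apply_succAbove]
  have hI : Integrable ((orthant (m + 1)).indicator H') :=
    (integrable_indicator_iff (measurableSet_orthant _)).2 hint
  have hI' := (hmp.integrable_comp_emb (MeasurableEquiv.measurableEmbedding _)).2 hI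
  rw [← integral_indicator (measurableSet_orthant _),
    ← hmp.integral_comp (MeasurableEquiv.measurableEmbedding _), Measure.volume_eq_prod]
  refine (integral_prod_symm _ hI').trans (integral_eq_zero_of_ae ?_)
  filter_upwards [hI'.prod_left_ae] with y hy
  change ∫ t, (orthant (m + 1)).indicator H' (j.insertNth t y) = 0
  change Integrable (fun t => (orthant (m + 1)).indicator H' (j.insertNth t y)) at hy
  by_cases hym : y ∈ orthant m
  swap
  · refine integral_eq_zero_of_ae (Eventually.of_forall fun t => ?_)
    exact indicator_of_notMem (fun h => hym ((hmem t y).1 h).2) _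
  have hind : (fun t => (orthant (m + 1)).indicator H' (j.insertNth t y)) =
      (Ioi (0 : ℝ)).indicator fun t => H' (j.insertNth t y) := by
    ext t
    by_cases ht : 0 < t
    · rw [indicator_of_mem ((hmem t y).2 ⟨ht, hym⟩), indicator_of_mem (by exact ht)]
    · rw [indicator_of_notMem (fun h => ht ((hmem t y).1 h).1), indicator_of_notMem (by exact ht)]
  rw [hind] at hy ⊢
  rw [integrable_indicator_iff measurableSet_Ioi] at hy
  rw [integral_indicator measurableSet_Ioi]
  -- Nothing is assumed on `H` outside the open orthant, so its slice is given the value `0` for `t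
  -- ≤ 0`. The bound `C * t` makes this continuous from the right at `0`.
  set g : ℝ → ℂ := fun t => if 0 < t then H (j.insertNth t y) else 0 with hg
  have hg0 : g 0 = 0 := by simp [hg]
  have hgle : ∀ t, 0 ≤ t → ‖g t‖ ≤ C * t := by
    intro t ht
    rcases ht.eq_or_lt with rfl | ht
    · simp [hg0]
    · simp only [hg, if_pos ht]
      have := hb _ ((hmem t y).2 ⟨ht, hym⟩)
      rwa [Fin.insertNth_apply_same] at this
  rw [integral_Ioi_of_hasDerivAt_of_tendsto (f := g) (m := 0) ?_ ?_ hy ?_, hg0, sub_zero]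
  · rw [ContinuousWithinAt, hg0]
    refine squeeze_zero_norm' (a := fun t => C * t)
      (eventually_mem_nhdsWithin.mono fun t ht => hgle t ht) ?_
    have : Continuous fun t : ℝ => C * t := by fun_prop
    have h := this.tendsto 0
    rw [mul_zero] at h
    exact h.mono_left nhdsWithin_le_nhds
  · intro t ht
    have h1 : HasDerivAt (fun s : ℝ => H (j.insertNth (t + s) y)) (H' (j.insertNth t y)) (t - t) := by
      rw [sub_self]
      have h2 := hderiv _ ((hmem t y).2 ⟨ht, hym⟩)
      rw [HasLineDerivAt] at h2
      have he : ∀ s : ℝ, (j.insertNth (t + s) y : Fin (m + 1) → ℝ) =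
          j.insertNth t y + s • Pi.single j 1 := fun s => by
        ext i
        refine Fin.succAboveCases j ?_ (fun i => ?_) i <;> simp
      simpa only [he] using h2
    have h3 := h1.comp_sub_const t t
    simp only [add_sub_cancel] at h3
    refine h3.congr_of_eventuallyEq ?_
    filter_upwards [Ioi_mem_nhds ht] with s hs
    simp only [hg]
    rw [if_pos (by exact hs)]
  · refine tendsto_const_nhds.congr' ?_
    filter_upwards [eventually_gt_atTop (max R 0)] with t ht
    have h0 : 0 < t := (le_max_right _ _).trans_lt ht
    simp only [hg, if_pos h0]
    refine (hz _ ((hmem t y).2 ⟨h0, hym⟩) ?_).symm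
    rw [Fin.insertNth_apply_same]
    exact (le_max_left _ _).trans_lt ht

theorem partialD_of_contDiff {ψ : (Fin d → ℝ) → ℂ} (hψ : ContDiff ℝ ∞ ψ) (j : Fin d) :
    partialD j ψ = fun x => fderiv ℝ ψ x (Pi.single j 1) := by
  ext x
  exact ((hψ.differentiable (by simp)) x).lineDeriv_eq_fderiv

theorem contDiff_partialD {ψ : (Fin d → ℝ) → ℂ} (hψ : ContDiff ℝ ∞ ψ) (j : Fin d) :
    ContDiff ℝ ∞ (partialD j ψ) := by
  rw [partialD_of_contDiff hψ]
  exact (hψ.fderiv_right (m := ∞) (by simp)).clm_apply contDiff_const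

theorem hasCompactSupport_partialD {ψ : (Fin d → ℝ) → ℂ} (hψ : ContDiff ℝ ∞ ψ)
    (hs : HasCompactSupport ψ) (j : Fin d) : HasCompactSupport (partialD j ψ) := by
  rw [partialD_of_contDiff hψ]
  exact hs.fderiv_apply ℝ _

/-- Green's identity for the operator `∂_j x_j ∂_j` on the orthant. -/
theorem integral_coord_op_mul {F ψ : (Fin d → ℝ) → ℂ} (hF : LocallyBoundedDerivs F)
    (hψ : ContDiff ℝ ∞ ψ) (hs : HasCompactSupport ψ) (j : Fin d) :
    ∫ x in orthant d, ((x j : ℂ) * partialD j (partialD j F) x + partialD j F x) * ψ x =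
    ∫ x in orthant d, F x * ((x j : ℂ) * partialD j (partialD j ψ) x + partialD j ψ x) := by
  have hψ' := LocallyBoundedDerivs.of_contDiff hψ
  have hs1 := hasCompactSupport_partialD hψ hs j
  have hψ1 := contDiff_partialD hψ j
  have hψ2 := contDiff_partialD hψ1 j
  have hs2 := hasCompactSupport_partialD hψ1 hs1 j
  have hc : Continuous fun x : Fin d → ℝ => (x j : ℂ) :=
    Complex.continuous_ofReal.comp (continuous_apply j)
  have hi1 := (((hF.partialD j).partialD j).coord_mul j).add (hF.partialD j) |>.integrableOn_mul
    hψ.continuous hs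
  have hi2 := hF.integrableOn_mul (ψ := fun x => (x j : ℂ) * partialD j (partialD j ψ) x +
    partialD j ψ x) ((hc.mul hψ2.continuous).add hψ1.continuous)
      ((hs2.mul_left (f := fun x : Fin d → ℝ => (x j : ℂ))).add hs1)
  rw [← sub_eq_zero, ← integral_sub hi1 hi2]
  obtain ⟨R, hR⟩ := hs.isBounded.subset_closedBall (0 : Fin d → ℝ)
  have hout : ∀ x, R < ‖x‖ → ψ x = 0 ∧ partialD j ψ x = 0 := by
    intro x hx
    have h1 : x ∉ tsupport ψ := fun h => hx.not_ge (mem_closedBall_zero_iff.1 (hR h))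
    refine ⟨image_eq_zero_of_notMem_tsupport h1, ?_⟩
    rw [partialD_of_contDiff hψ]
    have h2 : x ∉ tsupport (fderiv ℝ ψ) := fun h => h1 (tsupport_fderiv_subset ℝ h)
    simp [image_eq_zero_of_notMem_tsupport h2]
  -- The difference of the two integrands is `∂_j` of `x_j (ψ ∂_j F - F ∂_j ψ)`. The bracket is
  -- bounded and vanishes for large `x`, and the factor `x_j` removes the boundary term.
  have hW : LocallyBoundedDerivs fun x => partialD j F x * ψ x + (-1) * (F x * partialD j ψ x) :=
    ((hF.partialD j).mul hψ').add ((hF.mul (hψ'.partialD j)).const_mul _)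
  obtain ⟨C, hC0, hC⟩ := hW.exists_bound R
  have hW0 : ∀ x, R < ‖x‖ → partialD j F x * ψ x + (-1) * (F x * partialD j ψ x) = 0 := by
    intro x hx
    rw [(hout x hx).1, (hout x hx).2]; simp
  refine integral_orthant_hasLineDerivAt_eq_zero j (C := C) (R := R)
    (H := fun x => (x j : ℂ) * (partialD j F x * ψ x + (-1) * (F x * partialD j ψ x)))
    (fun x hx => ?_) (hi1.sub hi2) (fun x hx => ?_) fun x hx hxR => ?_
  · have h1 := hF.hasLineDerivAt j hx
    have h2 := (hF.partialD j).hasLineDerivAt j hx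
    have h3 := hψ'.hasLineDerivAt j hx
    have h4 := (hψ'.partialD j).hasLineDerivAt j hx
    have h5 : HasDerivAt (fun t : ℝ => (((x + t • Pi.single j 1 : Fin d → ℝ) j : ℝ) : ℂ)) 1 0 := by
      have : HasDerivAt (fun t : ℝ => (x + t • Pi.single j 1 : Fin d → ℝ) j) 1 0 := by
        simpa using (hasDerivAt_id (0 : ℝ)).const_add (x j)
      simpa using this.ofReal_comp
    unfold HasLineDerivAt at h1 h2 h3 h4 ⊢
    refine (h5.mul ((h2.mul h3).add ((h1.mul h4).const_mul (-1)))).congr_deriv ?_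
    simp
    ring
  · rw [norm_mul, Complex.norm_real, Real.norm_of_nonneg (hx j).le, mul_comm]
    have h0 := (hx j).le
    gcongr
    by_cases hxR : ‖x‖ ≤ R
    · exact hC x hx hxR
    · rw [hW0 x (not_le.1 hxR), norm_zero]; exact hC0
  · have := norm_le_pi_norm x j
    rw [Real.norm_of_nonneg (hx j).le] at this
    rw [hW0 x (hxR.trans_le this), mul_zero]

/-- The potential `x_j/4 - 1/2` acts by multiplication, hence symmetrically; Green's identity treats
the rest. The test function need not vanish near the faces of the orthant. -/
theorem integral_laguerreOp_mul_of_hasCompactSupport {F ψ : (Fin d → ℝ) → ℂ}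
    (hF : LocallyBoundedDerivs F) (hψ : ContDiff ℝ ∞ ψ) (hs : HasCompactSupport ψ) :
    ∫ x in orthant d, laguerreOp F x * ψ x = ∫ x in orthant d, F x * laguerreOp ψ x := by
  have hc : ∀ j, Continuous fun x : Fin d → ℝ => (x j : ℂ) := fun j =>
    Complex.continuous_ofReal.comp (continuous_apply j)
  have hi0 : ∀ j, Integrable (fun x => F x * (((x j : ℂ) / 4 - 1 / 2) * ψ x))
      (volume.restrict (orthant d)) := fun j =>
    hF.integrableOn_mul ((((hc j).div_const 4).sub continuous_const).mul hψ.continuous)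
      (hs.mul_left (f := fun x : Fin d → ℝ => (x j : ℂ) / 4 - 1 / 2))
  have hi1 := fun j => (((hF.partialD j).partialD j).coord_mul j).add (hF.partialD j)
    |>.integrableOn_mul hψ.continuous hs
  have hi2 := fun j => hF.integrableOn_mul
    (ψ := fun x => (x j : ℂ) * partialD j (partialD j ψ) x + partialD j ψ x)
      (((hc j).mul (contDiff_partialD (contDiff_partialD hψ j) j).continuous).add
        (contDiff_partialD hψ j).continuous)
      (((hasCompactSupport_partialD (contDiff_partialD hψ j)
        (hasCompactSupport_partialD hψ hs j) j).mul_left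
          (f := fun x : Fin d → ℝ => (x j : ℂ))).add (hasCompactSupport_partialD hψ hs j))
  have e1 : ∀ x, laguerreOp F x * ψ x = ∑ j, (F x * (((x j : ℂ) / 4 - 1 / 2) * ψ x) -
      ((x j : ℂ) * partialD j (partialD j F) x + partialD j F x) * ψ x) := fun x => by
    rw [laguerreOp, neg_mul, Finset.sum_mul, ← Finset.sum_neg_distrib]
    exact Finset.sum_congr rfl fun j _ => by ring
  have e2 : ∀ x, F x * laguerreOp ψ x = ∑ j, (F x * (((x j : ℂ) / 4 - 1 / 2) * ψ x) -
      F x * ((x j : ℂ) * partialD j (partialD j ψ) x + partialD j ψ x)) := fun x => by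
    rw [laguerreOp, mul_neg, Finset.mul_sum, ← Finset.sum_neg_distrib]
    exact Finset.sum_congr rfl fun j _ => by ring
  simp only [e1, e2]
  refine (integral_finsetSum _ fun j _ => (hi0 j).sub (hi1 j)).trans
    (Eq.trans ?_ (integral_finsetSum _ fun j _ => (hi0 j).sub (hi2 j)).symm)
  refine Finset.sum_congr rfl fun j _ => (integral_sub (hi0 j) (hi1 j)).trans
    (Eq.trans ?_ (integral_sub (hi0 j) (hi2 j)).symm)
  rw [integral_coord_op_mul hF hψ hs]

end

/-! ### Cutoffs at infinity and the Laguerre coefficients of `E F` -/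

noncomputable section

variable {d : ℕ}

theorem partialD_comp_smul (F : (Fin d → ℝ) → ℂ) (j : Fin d) (c : ℝ) (x : Fin d → ℝ) :
    partialD j (fun x => F (c • x)) x = c * partialD j F (c • x) := by
  have h := deriv_comp_mul_left c (fun t : ℝ => F (c • x + t • Pi.single j 1)) 0
  rw [mul_zero] at h
  simp only [partialD, lineDeriv, smul_add, smul_smul]
  rw [h, Complex.real_smul]

theorem partialD_const_mul (F : (Fin d → ℝ) → ℂ) (j : Fin d) (c : ℂ) :
    partialD j (fun x => c * F x) = fun x => c * partialD j F x := by
  ext x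
  simp only [partialD, lineDeriv]
  exact deriv_const_mul_field c

theorem partialD_mul {u v : (Fin d → ℝ) → ℂ} (hu : ContDiff ℝ ∞ u) (hv : ContDiff ℝ ∞ v)
    (j : Fin d) : partialD j (fun x => u x * v x) =
      fun x => partialD j u x * v x + u x * partialD j v x := by
  ext x
  rw [partialD_of_contDiff hu, partialD_of_contDiff hv, partialD_of_contDiff (hu.mul hv)]
  simp only
  rw [fderiv_fun_mul (hu.differentiable (by simp) x) (hv.differentiable (by simp) x)]
  simp
  ring

theorem partialD_fun_add {u v : (Fin d → ℝ) → ℂ} (hu : ContDiff ℝ ∞ u) (hv : ContDiff ℝ ∞ v)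
    (j : Fin d) : partialD j (fun x => u x + v x) =
      fun x => partialD j u x + partialD j v x := by
  ext x
  rw [partialD_of_contDiff hu, partialD_of_contDiff hv, partialD_of_contDiff (hu.add hv)]
  simp only
  rw [fderiv_fun_add (hu.differentiable (by simp) x) (hv.differentiable (by simp) x)]
  simp

/-- Every term of the commutator contains a derivative of `u`, which is small when `u` is a widely
dilated cutoff. The factors `x_j` are kept with `v`, whose decay absorbs them. -/
theorem laguerreOp_mul {u v : (Fin d → ℝ) → ℂ} (hu : ContDiff ℝ ∞ u) (hv : ContDiff ℝ ∞ v)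
    (x : Fin d → ℝ) : laguerreOp (fun x => u x * v x) x = u x * laguerreOp v x -
      ∑ j, (partialD j u x * (2 * ((x j : ℂ) * partialD j v x) + v x) +
        partialD j (partialD j u) x * ((x j : ℂ) * v x)) := by
  have h2 : ∀ j, partialD j (partialD j (fun x => u x * v x)) x =
      partialD j (partialD j u) x * v x + 2 * (partialD j u x * partialD j v x) +
        u x * partialD j (partialD j v) x := fun j => by
    have hu' := contDiff_partialD hu j
    have hv' := contDiff_partialD hv j
    rw [partialD_mul hu hv, partialD_fun_add (hu'.mul hv) (hu.mul hv'), partialD_mul hu' hv,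
      partialD_mul hu hv']
    ring
  simp only [laguerreOp, h2]
  simp only [partialD_mul hu hv]
  rw [mul_neg, Finset.mul_sum, ← Finset.sum_neg_distrib, ← Finset.sum_neg_distrib,
    ← Finset.sum_sub_distrib]
  exact Finset.sum_congr rfl fun j _ => by ring

theorem exists_cutoff : ∃ χ : (Fin d → ℝ) → ℂ, ContDiff ℝ ∞ χ ∧ HasCompactSupport χ ∧ χ 0 = 1 := by
  let b : ContDiffBump (0 : Fin d → ℝ) := ⟨1, 2, one_pos, one_lt_two⟩
  refine ⟨fun x => (b x : ℂ), Complex.ofRealCLM.contDiff.comp b.contDiff, ?_, ?_⟩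
  · exact b.hasCompactSupport.comp_left (g := fun r : ℝ => (r : ℂ)) Complex.ofReal_zero
  · have := b.one_of_mem_closedBall (x := 0) (by simp [b.rIn_pos.le])
    simp [this]

/-- The Laguerre coefficients of `E F` are those of `F` multiplied by `|n|`. -/
theorem integral_laguerreOp_mul_laguerreFun {F : (Fin d → ℝ) → ℂ} (hF : LocallyBoundedDerivs F)
    (hF2 : MemLp F 2 (volume.restrict (orthant d)))
    (hE2 : MemLp (laguerreOp F) 2 (volume.restrict (orthant d))) (n : Fin d → ℕ) :
    ∫ x in orthant d, laguerreOp F x * (laguerreFun n x : ℂ) =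
      multiLength n * ∫ x in orthant d, F x * (laguerreFun n x : ℂ) := by
  obtain ⟨χ, hχ, hχs, hχ0⟩ := exists_cutoff (d := d)
  set l : (Fin d → ℝ) → ℂ := fun x => (laguerreFun n x : ℂ) with hl
  have hlc : ContDiff ℝ ∞ l := contDiff_laguerreFun n
  have hEl : ∀ x, laguerreOp l x = multiLength n * l x := fun x => by
    rw [laguerreOp_laguerreFun]; simp [multiLength, hl]
  -- The cutoffs are `χ (c k • x)`: they tend to `χ 0 = 1`, and each derivative brings a factor `c
  -- k` that tends to `0`.
  set c : ℕ → ℝ := fun k => 1 / ((k : ℝ) + 1) with hc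
  have hcpos : ∀ k, 0 < c k := fun k => Nat.one_div_pos_of_nat
  have hcle : ∀ k, c k ≤ 1 := fun k => by
    simp only [hc]
    rw [div_le_one (by positivity)]
    linarith [Nat.cast_nonneg (α := ℝ) k]
  have hclim : Tendsto c atTop (𝓝 0) := tendsto_one_div_add_atTop_nhds_zero_nat
  obtain ⟨M, hM⟩ : ∃ M, ∀ x, ‖χ x‖ ≤ M ∧ (∀ j, ‖partialD j χ x‖ ≤ M) ∧
      ∀ j, ‖partialD j (partialD j χ) x‖ ≤ M := by
    obtain ⟨M0, h0⟩ := hχ.continuous.bounded_above_of_compact_support hχs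
    choose M1 h1 using fun j => (contDiff_partialD hχ j).continuous.bounded_above_of_compact_support
      (hasCompactSupport_partialD hχ hχs j)
    choose M2 h2 using fun j =>
      (contDiff_partialD (contDiff_partialD hχ j) j).continuous.bounded_above_of_compact_support
        (hasCompactSupport_partialD (contDiff_partialD hχ j)
          (hasCompactSupport_partialD hχ hχs j) j)
    have hs1 : ∀ j, M1 j ≤ ∑ j, |M1 j| := fun j => (le_abs_self _).trans
      (Finset.single_le_sum (f := fun j => |M1 j|) (fun _ _ => abs_nonneg _) (Finset.mem_univ j))
    have hs2 : ∀ j, M2 j ≤ ∑ j, |M2 j| := fun j => (le_abs_self _).trans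
      (Finset.single_le_sum (f := fun j => |M2 j|) (fun _ _ => abs_nonneg _) (Finset.mem_univ j))
    have hp1 : 0 ≤ ∑ j, |M1 j| := Finset.sum_nonneg fun _ _ => abs_nonneg _
    have hp2 : 0 ≤ ∑ j, |M2 j| := Finset.sum_nonneg fun _ _ => abs_nonneg _
    refine ⟨|M0| + ∑ j, |M1 j| + ∑ j, |M2 j|, fun x => ⟨?_, fun j => ?_, fun j => ?_⟩⟩
    · linarith [h0 x, le_abs_self M0]
    · linarith [h1 j x, hs1 j, abs_nonneg M0]
    · linarith [h2 j x, hs2 j, abs_nonneg M0]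
  have hM0 : 0 ≤ M := (norm_nonneg _).trans (hM 0).1
  set χ' : ℕ → (Fin d → ℝ) → ℂ := fun k x => χ (c k • x) with hχ'
  have hsm : ∀ k, ContDiff ℝ ∞ (χ' k) := fun k => hχ.comp (contDiff_const_smul _)
  have hcs : ∀ k, HasCompactSupport (χ' k) := fun k => hχs.comp_smul (hcpos k).ne'
  have hd1 : ∀ k j, partialD j (χ' k) = fun x => (c k : ℂ) * partialD j χ (c k • x) := fun k j => by
    ext x; exact partialD_comp_smul χ j (c k) x
  have hd2 : ∀ k j, partialD j (partialD j (χ' k)) =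
      fun x => (c k : ℂ) * ((c k : ℂ) * partialD j (partialD j χ) (c k • x)) := fun k j => by
    ext x
    rw [hd1, partialD_const_mul]
    simp only
    rw [partialD_comp_smul (partialD j χ)]
  have hχlim : ∀ x, Tendsto (fun k => χ' k x) atTop (𝓝 1) := fun x => by
    have h1 : Tendsto (fun k => c k • x) atTop (𝓝 0) := by
      simpa using hclim.smul_const x
    have := (hχ.continuous.tendsto 0).comp h1
    rwa [hχ0] at this
  -- A majorant, independent of `k`, for `E` applied to the truncated Laguerre function. It is in
  -- `L²` because `x_j l` and `x_j ∂_j l` are still polynomials times `e^{-|x|/2}`.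
  set q : (Fin d → ℝ) → ℝ := fun x => ‖laguerreOp l x‖ +
    ∑ j, ((2 * ‖(x j : ℂ) * partialD j l x‖ + ‖l x‖) + ‖(x j : ℂ) * l x‖) with hq
  have hl2 : MemLp l 2 (volume.restrict (orthant d)) := (memLp_laguerreFun n).ofReal
  have hxl : ∀ j, MemLp (fun x => (x j : ℂ) * l x) 2 (volume.restrict (orthant d)) := fun j => by
    have := expPoly.memLp_ofReal (d := d)
      (Function.update (fun j => laguerre (n j)) j (Polynomial.X * laguerre (n j)))
    convert this using 2 with x
    simp only [hl]
    rw [expPoly.update_eq, laguerreFun_eq, expPoly.eq_eval_mul_cofactor _ j]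
    simp; ring
  have hxdl : ∀ j, MemLp (fun x => (x j : ℂ) * partialD j l x) 2 (volume.restrict (orthant d)) :=
    fun j => by
      have := expPoly.memLp_ofReal (d := d) (Function.update (fun j => laguerre (n j)) j
        (Polynomial.X * expPoly.halfDerivative (laguerre (n j))))
      convert this using 2 with x
      rw [hl, laguerreFun_eq, expPoly.partialD_eq]
      simp only [expPoly.update_eq]
      simp; ring
  have hEl2 : MemLp (laguerreOp l) 2 (volume.restrict (orthant d)) := by
    rw [funext hEl]; exact hl2.const_mul _
  have hq2 : MemLp q 2 (volume.restrict (orthant d)) :=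
    hEl2.norm.add (memLp_finsetSum _ fun j _ =>
      ((((hxdl j).norm.const_mul 2).add hl2.norm).add (hxl j).norm))
  have hEχ : ∀ k x, laguerreOp (fun x => χ' k x * l x) x = χ' k x * laguerreOp l x -
      ∑ j, ((c k : ℂ) * partialD j χ (c k • x) * (2 * ((x j : ℂ) * partialD j l x) + l x) +
        (c k : ℂ) * ((c k : ℂ) * partialD j (partialD j χ) (c k • x)) * ((x j : ℂ) * l x)) :=
    fun k x => by rw [laguerreOp_mul (hsm k) hlc]; simp only [hd2]; simp only [hd1]
  have hn1 : ∀ k j x, ‖(c k : ℂ) * partialD j χ (c k • x)‖ ≤ c k * M := fun k j x => by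
    rw [norm_mul, Complex.norm_real, Real.norm_of_nonneg (hcpos k).le]
    exact mul_le_mul_of_nonneg_left ((hM _).2.1 j) (hcpos k).le
  have hn2 : ∀ k j x, ‖(c k : ℂ) * ((c k : ℂ) * partialD j (partialD j χ) (c k • x))‖ ≤ c k * M :=
    fun k j x => by
      rw [norm_mul, norm_mul, Complex.norm_real, Real.norm_of_nonneg (hcpos k).le]
      refine mul_le_mul_of_nonneg_left ?_ (hcpos k).le
      exact (mul_le_of_le_one_left (norm_nonneg _) (hcle k)).trans ((hM _).2.2 j)
  have hck : ∀ k, c k * M ≤ M := fun k => mul_le_of_le_one_left hM0 (hcle k)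
  have hbound : ∀ k x, ‖laguerreOp (fun x => χ' k x * l x) x‖ ≤ M * q x := fun k x => by
    rw [hEχ, hq, mul_add M, Finset.mul_sum]
    refine (norm_sub_le _ _).trans (add_le_add ?_ ((norm_sum_le _ _).trans
      (Finset.sum_le_sum fun j _ => ?_)))
    · rw [norm_mul]; gcongr; exact (hM _).1
    · rw [mul_add M]
      refine (norm_add_le _ _).trans (add_le_add ?_ ?_)
      · rw [norm_mul]
        gcongr
        · exact (hn1 k j x).trans (hck k)
        · refine (norm_add_le _ _).trans ?_
          rw [norm_mul]; simp
      · rw [norm_mul]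
        gcongr
        exact (hn2 k j x).trans (hck k)
  have hElim : ∀ x, Tendsto (fun k => laguerreOp (fun x => χ' k x * l x) x) atTop
      (𝓝 (laguerreOp l x)) := fun x => by
    simp only [hEχ]
    have h0 : Tendsto (fun k => c k * M) atTop (𝓝 0) := by simpa using hclim.mul_const M
    have h1 : ∀ j, Tendsto (fun k => (c k : ℂ) * partialD j χ (c k • x)) atTop (𝓝 0) := fun j =>
      squeeze_zero_norm (fun k => hn1 k j x) h0
    have h2 : ∀ j, Tendsto (fun k => (c k : ℂ) * ((c k : ℂ) *
        partialD j (partialD j χ) (c k • x))) atTop (𝓝 0) := fun j =>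
      squeeze_zero_norm (fun k => hn2 k j x) h0
    have h3 := ((hχlim x).mul_const (laguerreOp l x)).sub
      (tendsto_finsetSum Finset.univ fun j _ =>
        ((h1 j).mul_const (2 * ((x j : ℂ) * partialD j l x) + l x)).add
          ((h2 j).mul_const ((x j : ℂ) * l x)))
    simpa using h3
  -- All derivatives now fall on the truncated Laguerre function, so both limits need only `F` and
  -- `E F` in `L²`.
  have hgreen : ∀ k, ∫ x in orthant d, laguerreOp F x * (χ' k x * l x) =
      ∫ x in orthant d, F x * laguerreOp (fun x => χ' k x * l x) x := fun k =>
    integral_laguerreOp_mul_of_hasCompactSupport hF ((hsm k).mul hlc) (hcs k).mul_right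
  have hL : Tendsto (fun k => ∫ x in orthant d, laguerreOp F x * (χ' k x * l x)) atTop
      (𝓝 (∫ x in orthant d, laguerreOp F x * l x)) := by
    refine tendsto_integral_of_dominated_convergence
      (fun x => M * (‖laguerreOp F x‖ * ‖l x‖)) (fun k => ?_) ?_ (fun k => ?_) ?_
    · exact hE2.aestronglyMeasurable.mul
        ((hsm k).mul hlc).continuous.aestronglyMeasurable
    · exact (hE2.norm.integrable_mul hl2.norm).const_mul M
    · refine Eventually.of_forall fun x => ?_
      rw [norm_mul, norm_mul]
      calc _ ≤ ‖laguerreOp F x‖ * (M * ‖l x‖) := by gcongr; exact (hM _).1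
        _ = _ := by ring
    · refine Eventually.of_forall fun x => ?_
      simpa using ((hχlim x).mul_const (l x)).const_mul (laguerreOp F x)
  have hR : Tendsto (fun k => ∫ x in orthant d, F x * laguerreOp (fun x => χ' k x * l x) x) atTop
      (𝓝 (∫ x in orthant d, F x * laguerreOp l x)) := by
    refine tendsto_integral_of_dominated_convergence
      (fun x => M * (‖F x‖ * q x)) (fun k => ?_) ?_ (fun k => ?_) ?_
    · exact hF2.aestronglyMeasurable.mul
        ((LocallyBoundedDerivs.of_contDiff ((hsm k).mul hlc)).laguerreOp.1.continuousOn
          |>.aestronglyMeasurable (measurableSet_orthant d))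
    · exact (hF2.norm.integrable_mul hq2).const_mul M
    · refine Eventually.of_forall fun x => ?_
      rw [norm_mul]
      calc _ ≤ ‖F x‖ * (M * q x) := by gcongr; exact hbound k x
        _ = _ := by ring
    · exact Eventually.of_forall fun x => (hElim x).const_mul (F x)
  simp only [hgreen] at hL
  rw [tendsto_nhds_unique hL hR, ← integral_const_mul]
  refine integral_congr_ae (Eventually.of_forall fun x => ?_)
  simp only [hEl]
  ring

theorem integral_laguerreOp_iterate_mul_laguerreFun {F : (Fin d → ℝ) → ℂ}
    (hF : LocallyBoundedDerivs F)
    (hF2 : ∀ N, MemLp (laguerreOp^[N] F) 2 (volume.restrict (orthant d))) (N : ℕ)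
    (n : Fin d → ℕ) : ∫ x in orthant d, laguerreOp^[N] F x * (laguerreFun n x : ℂ) =
      (multiLength n : ℂ) ^ N * ∫ x in orthant d, F x * (laguerreFun n x : ℂ) := by
  induction N with
  | zero => simp
  | succ N ih =>
    have h2 := hF2 (N + 1)
    rw [Function.iterate_succ_apply'] at h2 ⊢
    rw [integral_laguerreOp_mul_laguerreFun (hF.laguerreOp_iterate N) (hF2 N) h2, ih]
    ring

end

noncomputable section

/-! ### Estimates for the weights -/

/-- With `s = t^{1/α}`, this is `x^N / N! ≤ e^x` at `x = k s / α`, raised to the power `α`. -/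
theorem pow_mul_exp_neg_rpow_le {α k t : ℝ} (hα : 0 < α) (hk : 0 < k) (ht : 0 ≤ t) (N : ℕ) :
    t ^ N * Real.exp (-(k * t ^ (1 / α))) ≤ ((α / k) ^ α) ^ N * (N ! : ℝ) ^ α := by
  set s := t ^ (1 / α) with hs
  have hs0 : 0 ≤ s := Real.rpow_nonneg ht _
  have hst : s ^ α = t := by
    rw [hs, ← Real.rpow_mul ht, one_div_mul_cancel hα.ne', Real.rpow_one]
  have h1 := Real.pow_div_factorial_le_exp (k * s / α) (by positivity) N
  have hfac : (0 : ℝ) < N ! := by positivity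
  have h2 : s ^ N ≤ (α / k) ^ N * N ! * Real.exp (k * s / α) := by
    rw [div_le_iff₀ hfac, div_pow, mul_pow, div_le_iff₀ (by positivity)] at h1
    rw [div_pow]
    have hkN : 0 < k ^ N := by positivity
    rw [div_mul_eq_mul_div, div_mul_eq_mul_div, le_div_iff₀ hkN]
    linarith
  have h3 := Real.rpow_le_rpow (by positivity) h2 hα.le
  rw [Real.mul_rpow (by positivity) (by positivity), Real.mul_rpow (by positivity) (by positivity),
    ← Real.exp_mul, div_mul_cancel₀ _ hα.ne', ← Real.rpow_natCast, ← Real.rpow_mul hs0,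
    mul_comm (N : ℝ) α, Real.rpow_mul hs0, hst, Real.rpow_natCast, ← Real.rpow_natCast (α / k),
    ← Real.rpow_mul (by positivity), mul_comm (N : ℝ) α, Real.rpow_mul (by positivity),
    Real.rpow_natCast] at h3
  rw [Real.exp_neg, ← div_eq_mul_inv, div_le_iff₀ (Real.exp_pos _)]
  exact h3

theorem exists_one_add_pow_mul_exp_neg_rpow_le {α k : ℝ} (hα : 0 < α) (hk : 0 < k) (m : ℕ) :
    ∃ B : ℝ, 0 ≤ B ∧ ∀ t : ℝ, 0 ≤ t → (1 + t) ^ m * Real.exp (-(k * t ^ (1 / α))) ≤ B := by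
  refine ⟨2 ^ (m - 1) * (1 + ((α / k) ^ α) ^ m * (m ! : ℝ) ^ α), by positivity, fun t ht => ?_⟩
  have h1 := add_pow_le (zero_le_one (α := ℝ)) ht m
  have h2 := pow_mul_exp_neg_rpow_le hα hk ht m
  have h3 : Real.exp (-(k * t ^ (1 / α))) ≤ 1 := Real.exp_le_one_iff.2 (by
    have : 0 ≤ t ^ (1 / α) := Real.rpow_nonneg ht _
    have := mul_nonneg hk.le this
    linarith)
  calc _ ≤ 2 ^ (m - 1) * (1 ^ m + t ^ m) * Real.exp (-(k * t ^ (1 / α))) := by gcongr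
    _ = 2 ^ (m - 1) * (Real.exp (-(k * t ^ (1 / α))) + t ^ m * Real.exp (-(k * t ^ (1 / α)))) := by
        rw [one_pow]; ring
    _ ≤ _ := by gcongr

/-- After taking the power `1/α`, the hypotheses bound the terms of an exponential series. Halving
its argument inserts a factor `2^{-N}`, so the series sums to at most `2`; raising to the power `α`
gives the constant `2^α`. -/
theorem mul_exp_rpow_le_of_forall_mul_pow_le {α h t A η : ℝ} (hα : 0 < α) (hh : 0 < h)
    (ht : 0 ≤ t) (hA : 0 ≤ A) (hη : 0 ≤ η)
    (hle : ∀ N : ℕ, A * t ^ N ≤ η * (h ^ N * (N ! : ℝ) ^ α)) :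
    A * Real.exp (α / (2 * h ^ (1 / α)) * t ^ (1 / α)) ≤ 2 ^ α * η := by
  rcases hη.eq_or_lt with rfl | hη
  · have := hle 0
    have hA0 : A = 0 := le_antisymm (by simpa using this) hA
    simp [hA0]
  set s := t ^ (1 / α) with hs
  set g := h ^ (1 / α) with hg
  have hs0 : 0 ≤ s := Real.rpow_nonneg ht _
  have hg0 : 0 < g := Real.rpow_pos_of_pos hh _
  set r := (A / η) ^ (1 / α) with hr
  have hr0 : 0 ≤ r := Real.rpow_nonneg (by positivity) _
  have hpow : ∀ (N : ℕ) {y : ℝ}, 0 ≤ y → (y ^ N) ^ (1 / α) = (y ^ (1 / α)) ^ N := by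
    intro N y hy
    rw [← Real.rpow_natCast, ← Real.rpow_mul hy, mul_comm, Real.rpow_mul hy, Real.rpow_natCast]
  have hterm : ∀ N : ℕ, r * ((s / (2 * g)) ^ N / (N ! : ℝ)) ≤ (1 / 2) ^ N := by
    intro N
    have h1 : A / η * t ^ N ≤ h ^ N * (N ! : ℝ) ^ α := by
      rw [div_mul_eq_mul_div, div_le_iff₀ hη, mul_comm _ η]; exact hle N
    have h2 := Real.rpow_le_rpow (by positivity) h1 (one_div_pos.2 hα).le
    rw [Real.mul_rpow (by positivity) (by positivity), Real.mul_rpow (by positivity)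
      (by positivity), hpow N ht, hpow N hh.le, ← Real.rpow_mul (by positivity),
      mul_one_div_cancel hα.ne', Real.rpow_one] at h2
    change r * s ^ N ≤ g ^ N * N ! at h2
    have hfac : (0 : ℝ) < N ! := by positivity
    rw [div_pow, mul_pow, one_div, inv_pow]
    have : r * (s ^ N / (2 ^ N * g ^ N) / (N ! : ℝ)) = (r * s ^ N) / (g ^ N * N !) * (2 ^ N)⁻¹ := by
      field_simp
    rw [this]
    refine mul_le_of_le_one_left (by positivity) ?_
    rw [div_le_one (by positivity)]
    exact h2
  have hexp : HasSum (fun N : ℕ => r * ((s / (2 * g)) ^ N / (N ! : ℝ)))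
      (r * Real.exp (s / (2 * g))) := by
    rw [Real.exp_eq_exp_ℝ]
    exact (NormedSpace.expSeries_div_hasSum_exp _).mul_left r
  have h2 : r * Real.exp (s / (2 * g)) ≤ 2 := hasSum_le hterm hexp hasSum_geometric_two
  have h3 := Real.rpow_le_rpow (by positivity) h2 hα.le
  rw [Real.mul_rpow hr0 (Real.exp_pos _).le, ← Real.exp_mul, hr, ← Real.rpow_mul (by positivity),
    one_div_mul_cancel hα.ne', Real.rpow_one, div_mul_eq_mul_div, div_le_iff₀ hη] at h3
  refine le_trans (le_of_eq ?_) h3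
  congr 2
  ring

theorem summable_prod_of_summable {g : ℕ → ℝ} (hg0 : ∀ i, 0 ≤ g i) (hg : Summable g) (d : ℕ) :
    Summable fun n : Fin d → ℕ => ∏ j, g (n j) := by
  induction d with
  | zero => exact Summable.of_finite
  | succ d ih =>
    rw [← (Fin.consEquiv fun _ : Fin (d + 1) => ℕ).summable_iff]
    have := hg.mul_of_nonneg ih hg0 fun n => Finset.prod_nonneg fun j _ => hg0 _
    convert this using 1
    ext p
    simp [Fin.prod_univ_succ, Fin.consEquiv]

variable {d : ℕ}

theorem summable_exp_neg_multiLength_rpow {α k : ℝ} (hα : 0 < α) (hk : 0 < k) :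
    Summable fun n : Fin d → ℕ => Real.exp (-(k * multiLength n ^ (1 / α))) := by
  -- The power `2 * d` of `1 + |n|` dominates the product of the `(n_j + 1)²`, so the sum is
  -- compared with a product of `d` convergent series.
  obtain ⟨B, hB0, hB⟩ := exists_one_add_pow_mul_exp_neg_rpow_le hα hk (2 * d)
  have hsum : Summable fun i : ℕ => 1 / ((i : ℝ) + 1) ^ 2 := by
    have := (summable_nat_add_iff 1).2 (Real.summable_one_div_nat_pow.2 one_lt_two)
    simpa using this
  refine Summable.of_nonneg_of_le (fun _ => (Real.exp_pos _).le) (fun n => ?_)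
    ((summable_prod_of_summable (fun i => by positivity) hsum d).mul_left B)
  have h1 := hB _ (multiLength_nonneg n)
  have h2 : ∏ j, ((n j : ℝ) + 1) ^ 2 ≤ (1 + multiLength n) ^ (2 * d) := by
    calc _ ≤ ∏ _j : Fin d, (1 + multiLength n) ^ 2 := by
          refine Finset.prod_le_prod (fun _ _ => by positivity) fun j _ => ?_
          have := le_multiLength n j
          exact pow_le_pow_left₀ (by positivity) (by linarith) 2
      _ = _ := by simp [← pow_mul]
  have h3 : 0 < ∏ j, ((n j : ℝ) + 1) ^ 2 := Finset.prod_pos fun _ _ => by positivity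
  simp only [one_div, Finset.prod_inv_distrib]
  rw [← div_eq_mul_inv, le_div_iff₀ h3, mul_comm]
  exact (mul_le_mul_of_nonneg_right h2 (Real.exp_pos _).le).trans (by simpa using h1)

theorem seqWeight_eq {α : ℝ} (h : ℝ) (n : Fin d → ℕ) :
    seqWeight h (α / 2) n = Real.exp (h * multiLength n ^ (1 / α)) := by
  rw [seqWeight, multiLength, mul_div_cancel₀ α two_ne_zero]

/-! ### Norm estimates for Laguerre series and Laguerre coefficients -/

variable {α h : ℝ} {a : (Fin d → ℕ) → ℂ}

theorem enorm_le_seqNorm_mul (h α : ℝ) (a : (Fin d → ℕ) → ℂ) (n : Fin d → ℕ) :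
    ‖a n‖ₑ ≤ seqNorm h (α / 2) a *
      ENNReal.ofReal (Real.exp (-(h * multiLength n ^ (1 / α)))) := by
  have h1 : ‖a n‖ₑ * ENNReal.ofReal (seqWeight h (α / 2) n) ≤ seqNorm h (α / 2) a :=
    le_iSup (fun n => ‖a n‖ₑ * ENNReal.ofReal (seqWeight h (α / 2) n)) n
  refine le_trans (le_of_eq ?_) (mul_le_mul_left h1 _)
  rw [seqWeight_eq, mul_assoc, ← ENNReal.ofReal_mul (Real.exp_pos _).le, ← Real.exp_add]
  simp

/-- Half of the exponent absorbs the polynomial factor, the other half makes the sum converge. -/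
theorem rapidlyDecreasing_of_seqNorm_lt_top (hα : 0 < α) (hh : 0 < h)
    (ha : seqNorm h (α / 2) a < ⊤) : RapidlyDecreasing a := by
  intro m
  obtain ⟨B, hB0, hB⟩ := exists_one_add_pow_mul_exp_neg_rpow_le hα (half_pos hh) m
  refine Summable.of_nonneg_of_le (fun n => mul_nonneg (norm_nonneg _)
    (pow_nonneg (by have := multiLength_nonneg n; positivity) _)) (fun n => ?_)
    ((summable_exp_neg_multiLength_rpow (d := d) hα (half_pos hh)).mul_left
      ((seqNorm h (α / 2) a).toReal * B))
  have h1 : ‖a n‖ ≤ (seqNorm h (α / 2) a).toReal *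
      Real.exp (-(h * multiLength n ^ (1 / α))) := by
    have := ENNReal.toReal_mono (ENNReal.mul_lt_top ha ENNReal.ofReal_lt_top).ne
      (enorm_le_seqNorm_mul h α a n)
    rwa [ENNReal.toReal_mul, ENNReal.toReal_ofReal (Real.exp_pos _).le, toReal_enorm] at this
  have h2 := hB _ (multiLength_nonneg n)
  have h3 : Real.exp (-(h * multiLength n ^ (1 / α))) =
      Real.exp (-(h / 2 * multiLength n ^ (1 / α))) *
        Real.exp (-(h / 2 * multiLength n ^ (1 / α))) := by
    rw [← Real.exp_add]; congr 1; ring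
  have h4 : 0 ≤ (1 + multiLength n) ^ m :=
    pow_nonneg (by have := multiLength_nonneg n; positivity) _
  calc _ ≤ (seqNorm h (α / 2) a).toReal * Real.exp (-(h * multiLength n ^ (1 / α))) *
        (1 + multiLength n) ^ m := by gcongr
    _ = (seqNorm h (α / 2) a).toReal * ((1 + multiLength n) ^ m *
        Real.exp (-(h / 2 * multiLength n ^ (1 / α)))) *
          Real.exp (-(h / 2 * multiLength n ^ (1 / α))) := by rw [h3]; ring
    _ ≤ _ := by gcongr

/-- The Laguerre series maps the steps of the sequence spaces boundedly into those of the
Pilipović spaces. -/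
theorem exists_eta_laguerreSeries_le (hα : 0 < α) (hh : 0 < h) (d : ℕ) : ∃ C : ℝ≥0,
    ∀ a : (Fin d → ℕ) → ℂ, seqNorm h (α / 2) a < ⊤ →
      eta ((2 * α / h) ^ α) α (laguerreSeries a) ≤ C * seqNorm h (α / 2) a := by
  have hsum := summable_exp_neg_multiLength_rpow (d := d) hα (half_pos hh)
  have hfin : ∑' n : Fin d → ℕ,
      ENNReal.ofReal (Real.exp (-(h / 2 * multiLength n ^ (1 / α)))) ≠ ⊤ :=
    hsum.tsum_ofReal_ne_top
  refine ⟨(∑' n : Fin d → ℕ,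
    ENNReal.ofReal (Real.exp (-(h / 2 * multiLength n ^ (1 / α))))).toNNReal, fun a ha => ?_⟩
  rw [ENNReal.coe_toNNReal hfin]
  have hr := rapidlyDecreasing_of_seqNorm_lt_top hα hh ha
  refine iSup_le fun N => ENNReal.div_le_of_le_mul ?_
  rw [eLpNorm_congr_ae (ae_orthant_of_forall (hr.laguerreOp_iterate_laguerreSeries N))]
  refine (hr.mul_pow N).eLpNorm_laguerreSeries_le.trans ?_
  rw [mul_assoc, ← ENNReal.tsum_mul_right]
  refine ENNReal.tsum_le_tsum fun n => ?_
  have ht := multiLength_nonneg n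
  -- Half of the weight absorbs `|n|^N`, which produces the new index `(α / (h/2))^α = (2α/h)^α`;
  -- the other half is summed into the constant.
  have h1 := pow_mul_exp_neg_rpow_le hα (half_pos hh) ht N
  have h2 : multiLength n ^ N * Real.exp (-(h * multiLength n ^ (1 / α))) ≤
      Real.exp (-(h / 2 * multiLength n ^ (1 / α))) *
        (((2 * α / h) ^ α) ^ N * (N ! : ℝ) ^ α) := by
    have h3 : Real.exp (-(h * multiLength n ^ (1 / α))) =
        Real.exp (-(h / 2 * multiLength n ^ (1 / α))) *
          Real.exp (-(h / 2 * multiLength n ^ (1 / α))) := by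
      rw [← Real.exp_add]; congr 1; ring
    rw [h3, ← mul_assoc, mul_comm]
    rw [show α / (h / 2) = 2 * α / h by field_simp] at h1
    gcongr
  calc ‖(multiLength n : ℂ) ^ N * a n‖ₑ = ENNReal.ofReal (multiLength n ^ N) * ‖a n‖ₑ := by
        rw [enorm_mul, enorm_pow, ← ofReal_norm (multiLength n : ℂ), Complex.norm_real,
          Real.norm_of_nonneg ht, ENNReal.ofReal_pow ht]
    _ ≤ ENNReal.ofReal (multiLength n ^ N) * (seqNorm h (α / 2) a *
        ENNReal.ofReal (Real.exp (-(h * multiLength n ^ (1 / α))))) := by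
        gcongr; exact enorm_le_seqNorm_mul h α a n
    _ = seqNorm h (α / 2) a * ENNReal.ofReal (multiLength n ^ N *
        Real.exp (-(h * multiLength n ^ (1 / α)))) := by
        rw [ENNReal.ofReal_mul (by positivity)]; ring
    _ ≤ seqNorm h (α / 2) a * ENNReal.ofReal (Real.exp (-(h / 2 * multiLength n ^ (1 / α))) *
        (((2 * α / h) ^ α) ^ N * (N ! : ℝ) ^ α)) := by gcongr
    _ = _ := by rw [ENNReal.ofReal_mul (by positivity)]; ring

theorem eLpNorm_laguerreOp_iterate_le (hh : 0 < h) (α : ℝ) (F : (Fin d → ℝ) → ℂ) (N : ℕ) :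
    eLpNorm (laguerreOp^[N] F) 2 (volume.restrict (orthant d)) ≤
      eta h α F * ENNReal.ofReal (h ^ N * (N ! : ℝ) ^ α) := by
  have hpos : 0 < h ^ N * (N ! : ℝ) ^ α := by positivity
  rw [← ENNReal.div_le_iff (ENNReal.ofReal_pos.2 hpos).ne' ENNReal.ofReal_ne_top]
  exact le_iSup (fun N : ℕ => eLpNorm (laguerreOp^[N] F) 2 (volume.restrict (orthant d)) /
    ENNReal.ofReal (h ^ N * (N ! : ℝ) ^ α)) N

theorem memLp_laguerreOp_iterate {F : (Fin d → ℝ) → ℂ} (hF : ContDiffOn ℝ ∞ F (orthant d))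
    (hh : 0 < h) (hη : eta h α F < ⊤) (N : ℕ) :
    MemLp (laguerreOp^[N] F) 2 (volume.restrict (orthant d)) :=
  ⟨(contDiffOn_laguerreOp_iterate N hF).continuousOn.aestronglyMeasurable (measurableSet_orthant d),
    (eLpNorm_laguerreOp_iterate_le hh α F N).trans_lt
      (ENNReal.mul_lt_top hη ENNReal.ofReal_lt_top)⟩

/-- The Laguerre coefficients map the steps of the Pilipović spaces boundedly into those of the
sequence spaces. -/
theorem seqNorm_integral_mul_laguerreFun_le (hα : 0 < α) (hh : 0 < h) {F : (Fin d → ℝ) → ℂ}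
    (hF : SmoothUpToBoundary F) (hη : eta h α F < ⊤) :
    seqNorm (α / (2 * h ^ (1 / α))) (α / 2)
      (fun n => ∫ x in orthant d, F x * (laguerreFun n x : ℂ)) ≤
      ((2 ^ α : ℝ≥0) : ℝ≥0∞) * eta h α F := by
  refine iSup_le fun n => ?_
  rw [seqWeight_eq]
  have ht := multiLength_nonneg n
  set A := ‖∫ x in orthant d, F x * (laguerreFun n x : ℂ)‖
  have hmem := memLp_laguerreOp_iterate hF.1 hh hη
  -- The `n`-th coefficient of `E^N F` is `|n|^N` times that of `F`, and by Cauchy-Schwarz it is at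
  -- most the `L²` norm of `E^N F`.
  have key : ∀ N : ℕ, A * multiLength n ^ N ≤ (eta h α F).toReal * (h ^ N * (N ! : ℝ) ^ α) := by
    intro N
    have h1 := (enorm_integral_mul_laguerreFun_le (hmem N).aestronglyMeasurable n).trans
      (eLpNorm_laguerreOp_iterate_le hh α F N)
    rw [integral_laguerreOp_iterate_mul_laguerreFun hF.locallyBoundedDerivs hmem] at h1
    have h2 := ENNReal.toReal_mono (ENNReal.mul_lt_top hη ENNReal.ofReal_lt_top).ne h1
    rw [toReal_enorm, norm_mul, norm_pow, Complex.norm_real, Real.norm_of_nonneg ht,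
      ENNReal.toReal_mul, ENNReal.toReal_ofReal (by positivity)] at h2
    rw [mul_comm]; exact h2
  have h3 := mul_exp_rpow_le_of_forall_mul_pow_le hα hh ht (norm_nonneg _) ENNReal.toReal_nonneg key
  have h4 := ENNReal.ofReal_le_ofReal h3
  rw [ENNReal.ofReal_mul (norm_nonneg _), ENNReal.ofReal_mul (by positivity),
    ENNReal.ofReal_toReal hη.ne, ofReal_norm] at h4
  refine h4.trans (le_of_eq ?_)
  congr 1
  rw [ENNReal.ofReal, Real.toNNReal_rpow_of_nonneg (by norm_num)]
  simp

end

noncomputable section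

/-! ### Continuity criteria for inductive and projective limit topologies -/

section LimitTopologies

variable {W V ι κ : Type*} [AddCommGroup W] [Module ℂ W] [AddCommGroup V] [Module ℂ V]

/-- A seminorm bounded on every step of the target pulls back to one bounded on every step of the
source, so it is itself one of the defining seminorms there. -/
theorem continuous_inductiveTopology {q : ι → W → ℝ≥0∞} {r : κ → V → ℝ≥0∞} (T : W →ₗ[ℂ] V)
    (hT : ∀ i, ∃ k, ∃ C : ℝ≥0, ∀ w, q i w < ⊤ → r k (T w) ≤ C * q i w) :
    @Continuous W V (inductiveTopology q) (inductiveTopology r) T := by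
  let _ : Nonempty {p : Seminorm ℂ W //
      ∀ i, ∃ C : ℝ≥0, ∀ w, q i w < ⊤ → ENNReal.ofReal (p w) ≤ C * q i w} :=
    ⟨⟨0, fun _ => ⟨0, fun w _ => by simp⟩⟩⟩
  let _ : Nonempty {p : Seminorm ℂ V //
      ∀ i, ∃ C : ℝ≥0, ∀ w, r i w < ⊤ → ENNReal.ofReal (p w) ≤ C * r i w} :=
    ⟨⟨0, fun _ => ⟨0, fun w _ => by simp⟩⟩⟩
  let _ : TopologicalSpace W := inductiveTopology q
  let _ : TopologicalSpace V := inductiveTopology r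
  have hW : WithSeminorms (fun p : {p : Seminorm ℂ W //
      ∀ i, ∃ C : ℝ≥0, ∀ w, q i w < ⊤ → ENNReal.ofReal (p w) ≤ C * q i w} =>
    (p : Seminorm ℂ W)) := ⟨rfl⟩
  have hV : WithSeminorms (fun p : {p : Seminorm ℂ V //
      ∀ i, ∃ C : ℝ≥0, ∀ w, r i w < ⊤ → ENNReal.ofReal (p w) ≤ C * r i w} =>
    (p : Seminorm ℂ V)) := ⟨rfl⟩
  refine WithSeminorms.continuous_of_isBounded hW hV T fun ⟨p, hp⟩ => ?_
  refine ⟨{⟨p.comp T, fun i => ?_⟩}, 1, by simp⟩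
  obtain ⟨k, C, hC⟩ := hT i
  obtain ⟨D, hD⟩ := hp k
  refine ⟨D * C, fun w hw => (hD _ ((hC w hw).trans_lt
    (ENNReal.mul_lt_top ENNReal.coe_lt_top hw))).trans ?_⟩
  rw [ENNReal.coe_mul, mul_assoc]
  gcongr
  exact hC w hw

theorem continuous_projectiveTopology [Nonempty ι] [Nonempty κ] {p : ι → Seminorm ℂ W}
    {r : κ → Seminorm ℂ V} (T : W →ₗ[ℂ] V)
    (hT : ∀ k, ∃ i, ∃ C : ℝ≥0, ∀ w, r k (T w) ≤ C * p i w) :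
    @Continuous W V (projectiveTopology p) (projectiveTopology r) T := by
  let _ : TopologicalSpace W := projectiveTopology p
  let _ : TopologicalSpace V := projectiveTopology r
  have hW : WithSeminorms p := ⟨rfl⟩
  have hV : WithSeminorms r := ⟨rfl⟩
  refine WithSeminorms.continuous_of_isBounded hW hV T fun k => ?_
  obtain ⟨i, C, hC⟩ := hT k
  refine ⟨{i}, C, fun w => ?_⟩
  simpa [NNReal.smul_def] using hC w

end LimitTopologies

/-! ### The Laguerre expansion as an isomorphism -/

variable {d : ℕ}

/-- The sum `∑ₙ aₙ lₙ` as a function on the orthant. -/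
def laguerreSum (a : (Fin d → ℕ) → ℂ) : orthant d → ℂ := fun x => laguerreSeries a x

theorem zeroExt_laguerreSum (a : (Fin d → ℕ) → ℂ) :
    EqOn (zeroExt (laguerreSum a)) (laguerreSeries a) (orthant d) := zeroExt_restrict_eqOn _

theorem laguerreCoeff_laguerreSum {a : (Fin d → ℕ) → ℂ} (ha : RapidlyDecreasing a) :
    laguerreCoeff (laguerreSum a) = a := by
  funext n
  rw [laguerreCoeff_eq_of_eqOn (zeroExt_laguerreSum a), ha.integral_laguerreSeries_mul]

theorem zeroExt_eqOn_laguerreSeries {f : orthant d → ℂ} (hc : ContinuousOn (zeroExt f) (orthant d))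
    (hf : MemLp (zeroExt f) 2 (volume.restrict (orthant d)))
    (ha : RapidlyDecreasing (laguerreCoeff f)) :
    EqOn (zeroExt f) (laguerreSeries (laguerreCoeff f)) (orthant d) :=
  ha.eqOn_laguerreSeries hf hc fun _ => rfl

/-- Laguerre expansion as a linear bijection between a space of rapidly decreasing sequences and a
space of continuous square integrable functions on the orthant. -/
def laguerreEquiv (S : Submodule ℂ ((Fin d → ℕ) → ℂ)) (P : Submodule ℂ (orthant d → ℂ))
    (hS : ∀ a ∈ S, RapidlyDecreasing a)
    (hP : ∀ f ∈ P, ContinuousOn (zeroExt f) (orthant d) ∧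
      MemLp (zeroExt f) 2 (volume.restrict (orthant d)))
    (hSP : ∀ a ∈ S, laguerreSum a ∈ P) (hPS : ∀ f ∈ P, laguerreCoeff f ∈ S) : S ≃ₗ[ℂ] P where
  toFun a := ⟨laguerreSum a, hSP a a.2⟩
  map_add' a b := Subtype.ext <| funext fun x => by
    have h := ((hS a a.2).hasSum_laguerreSeries x.2).add ((hS b b.2).hasSum_laguerreSeries x.2)
    simp only [← add_mul] at h
    exact h.tsum_eq
  map_smul' c a := Subtype.ext <| funext fun x => by
    have h := ((hS a a.2).hasSum_laguerreSeries x.2).mul_left c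
    simp only [← mul_assoc] at h
    exact h.tsum_eq
  invFun f := ⟨laguerreCoeff f, hPS f f.2⟩
  left_inv a := Subtype.ext (laguerreCoeff_laguerreSum (hS a a.2))
  right_inv f := Subtype.ext <| funext fun x => by
    have h := zeroExt_eqOn_laguerreSeries (hP f f.2).1 (hP f f.2).2 (hS _ (hPS f f.2)) x.2
    rw [zeroExt_apply x.2] at h
    exact h.symm

variable {α : ℝ}

theorem smoothUpToBoundary_laguerreSum {a : (Fin d → ℕ) → ℂ} (ha : RapidlyDecreasing a) :
    SmoothUpToBoundary (zeroExt (laguerreSum a)) :=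
  ha.smoothUpToBoundary.congr (zeroExt_laguerreSum a)

theorem eta_laguerreSum (h α : ℝ) (a : (Fin d → ℕ) → ℂ) :
    eta h α (zeroExt (laguerreSum a)) = eta h α (laguerreSeries a) :=
  eta_congr (zeroExt_laguerreSum a)

theorem exists_eta_laguerreSum_le (hα : 0 < α) (d : ℕ) {h : ℝ} (hh : 0 < h) :
    ∃ k : ℝ, 0 < k ∧ ∃ C : ℝ≥0, ∀ a : (Fin d → ℕ) → ℂ, seqNorm h (α / 2) a < ⊤ →
      eta k α (zeroExt (laguerreSum a)) ≤ C * seqNorm h (α / 2) a := by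
  obtain ⟨C, hC⟩ := exists_eta_laguerreSeries_le hα hh d
  have hk : 0 < (2 * α / h) ^ α := Real.rpow_pos_of_pos (by positivity) _
  refine ⟨_, hk, C, fun a ha => ?_⟩
  rw [eta_laguerreSum]
  exact hC a ha

/-- For the intersections the target index is prescribed: `h = 2α / k^{1/α}` solves `(2α/h)^α = k`.
-/
theorem exists_eta_laguerreSum_le_of_eta (hα : 0 < α) (d : ℕ) {k : ℝ} (hk : 0 < k) :
    ∃ h : ℝ, 0 < h ∧ ∃ C : ℝ≥0, ∀ a : (Fin d → ℕ) → ℂ, seqNorm h (α / 2) a < ⊤ →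
      eta k α (zeroExt (laguerreSum a)) ≤ C * seqNorm h (α / 2) a := by
  have hk' : 0 < k ^ (1 / α) := Real.rpow_pos_of_pos hk _
  have hh : 0 < 2 * α / k ^ (1 / α) := by positivity
  obtain ⟨C, hC⟩ := exists_eta_laguerreSeries_le hα hh d
  have hk2 : (2 * α / (2 * α / k ^ (1 / α))) ^ α = k := by
    rw [div_div_cancel₀ (by positivity), ← Real.rpow_mul hk.le, one_div_mul_cancel hα.ne',
      Real.rpow_one]
  rw [hk2] at hC
  exact ⟨_, hh, C, fun a ha => by rw [eta_laguerreSum]; exact hC a ha⟩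

theorem exists_seqNorm_laguerreCoeff_le (hα : 0 < α) (d : ℕ) {h : ℝ} (hh : 0 < h) :
    ∃ k : ℝ, 0 < k ∧ ∃ C : ℝ≥0, ∀ f : orthant d → ℂ, SmoothUpToBoundary (zeroExt f) →
      eta h α (zeroExt f) < ⊤ →
      seqNorm k (α / 2) (laguerreCoeff f) ≤ C * eta h α (zeroExt f) := by
  have hh' : 0 < h ^ (1 / α) := Real.rpow_pos_of_pos hh _
  exact ⟨_, by positivity, _, fun f hf hη => seqNorm_integral_mul_laguerreFun_le hα hh hf hη⟩

/-- Here `h = (α/(2k))^α` solves `α / (2 h^{1/α}) = k`, so every index of the sequence norms is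
attained. -/
theorem exists_seqNorm_laguerreCoeff_le_of_seqNorm (hα : 0 < α) (d : ℕ) {k : ℝ} (hk : 0 < k) :
    ∃ h : ℝ, 0 < h ∧ ∃ C : ℝ≥0, ∀ f : orthant d → ℂ, SmoothUpToBoundary (zeroExt f) →
      eta h α (zeroExt f) < ⊤ →
      seqNorm k (α / 2) (laguerreCoeff f) ≤ C * eta h α (zeroExt f) := by
  have h0 : 0 < α / (2 * k) := by positivity
  have hh : 0 < (α / (2 * k)) ^ α := Real.rpow_pos_of_pos h0 _
  have hk2 : α / (2 * ((α / (2 * k)) ^ α) ^ (1 / α)) = k := by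
    rw [← Real.rpow_mul h0.le, mul_one_div_cancel hα.ne', Real.rpow_one]
    field_simp
  refine ⟨_, hh, 2 ^ α, fun f hf hη => ?_⟩
  have := seqNorm_integral_mul_laguerreFun_le hα hh hf hη
  rwa [hk2] at this

theorem rapidlyDecreasing_of_mem_ellUnion (hα : 0 < α) {a : (Fin d → ℕ) → ℂ}
    (ha : a ∈ ellUnion d (α / 2)) : RapidlyDecreasing a := by
  obtain ⟨h, hh, ha⟩ := ha
  exact rapidlyDecreasing_of_seqNorm_lt_top hα hh ha

theorem rapidlyDecreasing_of_mem_ellInter (hα : 0 < α) {a : (Fin d → ℕ) → ℂ}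
    (ha : a ∈ ellInter d (α / 2)) : RapidlyDecreasing a :=
  rapidlyDecreasing_of_seqNorm_lt_top hα one_pos (ha 1 one_pos)

/-- Square integrability is the term `N = 0` of the supremum. -/
theorem memLp_of_eta_lt_top {h : ℝ} (hh : 0 < h) {f : orthant d → ℂ}
    (hf : SmoothUpToBoundary (zeroExt f)) (hη : eta h α (zeroExt f) < ⊤) :
    ContinuousOn (zeroExt f) (orthant d) ∧ MemLp (zeroExt f) 2 (volume.restrict (orthant d)) :=
  ⟨hf.1.continuousOn, memLp_laguerreOp_iterate hf.1 hh hη 0⟩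

theorem laguerreSum_mem_pilipovicUnion (hα : 0 < α) {a : (Fin d → ℕ) → ℂ}
    (ha : a ∈ ellUnion d (α / 2)) : laguerreSum a ∈ pilipovicUnion d α := by
  refine ⟨smoothUpToBoundary_laguerreSum (rapidlyDecreasing_of_mem_ellUnion hα ha), ?_⟩
  obtain ⟨h, hh, ha⟩ := ha
  obtain ⟨k, hk, C, hC⟩ := exists_eta_laguerreSum_le hα d hh
  exact ⟨k, hk, (hC a ha).trans_lt (ENNReal.mul_lt_top ENNReal.coe_lt_top ha)⟩

theorem laguerreSum_mem_pilipovicInter (hα : 0 < α) {a : (Fin d → ℕ) → ℂ}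
    (ha : a ∈ ellInter d (α / 2)) : laguerreSum a ∈ pilipovicInter d α := by
  refine ⟨smoothUpToBoundary_laguerreSum (rapidlyDecreasing_of_mem_ellInter hα ha),
    fun k hk => ?_⟩
  obtain ⟨h, hh, C, hC⟩ := exists_eta_laguerreSum_le_of_eta hα d hk
  exact (hC a (ha h hh)).trans_lt (ENNReal.mul_lt_top ENNReal.coe_lt_top (ha h hh))

theorem laguerreCoeff_mem_ellUnion (hα : 0 < α) {f : orthant d → ℂ}
    (hf : f ∈ pilipovicUnion d α) : laguerreCoeff f ∈ ellUnion d (α / 2) := by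
  obtain ⟨hs, h, hh, hf⟩ := hf
  obtain ⟨k, hk, C, hC⟩ := exists_seqNorm_laguerreCoeff_le hα d hh
  exact ⟨k, hk, (hC f hs hf).trans_lt (ENNReal.mul_lt_top ENNReal.coe_lt_top hf)⟩

theorem laguerreCoeff_mem_ellInter (hα : 0 < α) {f : orthant d → ℂ}
    (hf : f ∈ pilipovicInter d α) : laguerreCoeff f ∈ ellInter d (α / 2) := by
  intro k hk
  obtain ⟨h, hh, C, hC⟩ := exists_seqNorm_laguerreCoeff_le_of_seqNorm hα d hk
  exact (hC f hf.1 (hf.2 h hh)).trans_lt (ENNReal.mul_lt_top ENNReal.coe_lt_top (hf.2 h hh))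

/-- Laguerre expansion as a linear bijection of `ℓ_{α/2}` onto `𝐆^α_α`. -/
def laguerreEquivUnion (d : ℕ) (hα : 0 < α) : EllUnion d (α / 2) ≃ₗ[ℂ] PilipovicUnion d α :=
  laguerreEquiv (ellUnion d (α / 2)) (pilipovicUnion d α)
    (fun _ => rapidlyDecreasing_of_mem_ellUnion hα)
    (fun _ hf => let ⟨hs, _, hh, hη⟩ := hf; memLp_of_eta_lt_top hh hs hη)
    (fun _ => laguerreSum_mem_pilipovicUnion hα) (fun _ => laguerreCoeff_mem_ellUnion hα)

/-- Laguerre expansion as a linear bijection of `ℓ_{0,α/2}` onto `𝐠^α_α`. -/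
def laguerreEquivInter (d : ℕ) (hα : 0 < α) : EllInter d (α / 2) ≃ₗ[ℂ] PilipovicInter d α :=
  laguerreEquiv (ellInter d (α / 2)) (pilipovicInter d α)
    (fun _ => rapidlyDecreasing_of_mem_ellInter hα)
    (fun _ hf => memLp_of_eta_lt_top one_pos hf.1 (hf.2 1 one_pos))
    (fun _ => laguerreSum_mem_pilipovicInter hα) (fun _ => laguerreCoeff_mem_ellInter hα)

theorem continuous_laguerreEquivUnion (d : ℕ) (hα : 0 < α) :
    Continuous (laguerreEquivUnion d hα) := by
  refine continuous_inductiveTopology (laguerreEquivUnion d hα).toLinearMap fun ⟨h, hh⟩ => ?_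
  obtain ⟨k, hk, C, hC⟩ := exists_eta_laguerreSum_le hα d hh
  exact ⟨⟨k, hk⟩, C, fun a ha => hC a.seq ha⟩

theorem continuous_laguerreEquivUnion_symm (d : ℕ) (hα : 0 < α) :
    Continuous (laguerreEquivUnion d hα).symm := by
  refine continuous_inductiveTopology (laguerreEquivUnion d hα).symm.toLinearMap
    fun ⟨h, hh⟩ => ?_
  obtain ⟨k, hk, C, hC⟩ := exists_seqNorm_laguerreCoeff_le hα d hh
  exact ⟨⟨k, hk⟩, C, fun f hf => hC f.fn f.2.1 hf⟩

theorem toReal_le_mul_toReal {x y : ℝ≥0∞} {C : ℝ≥0} (hy : y < ⊤) (h : x ≤ C * y) :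
    x.toReal ≤ C * y.toReal := by
  have := ENNReal.toReal_mono (ENNReal.mul_lt_top ENNReal.coe_lt_top hy).ne h
  simpa using this

theorem continuous_laguerreEquivInter (d : ℕ) (hα : 0 < α) :
    Continuous (laguerreEquivInter d hα) := by
  refine continuous_projectiveTopology (laguerreEquivInter d hα).toLinearMap fun ⟨k, hk⟩ => ?_
  obtain ⟨h, hh, C, hC⟩ := exists_eta_laguerreSum_le_of_eta hα d hk
  exact ⟨⟨h, hh⟩, C, fun a => toReal_le_mul_toReal (a.2 h hh) (hC a.seq (a.2 h hh))⟩

theorem continuous_laguerreEquivInter_symm (d : ℕ) (hα : 0 < α) :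
    Continuous (laguerreEquivInter d hα).symm := by
  refine continuous_projectiveTopology (laguerreEquivInter d hα).symm.toLinearMap
    fun ⟨k, hk⟩ => ?_
  obtain ⟨h, hh, C, hC⟩ := exists_seqNorm_laguerreCoeff_le_of_seqNorm hα d hk
  exact ⟨⟨h, hh⟩, C, fun f => toReal_le_mul_toReal (f.2.2 h hh) (hC f.fn f.2.1 (f.2.2 h hh))⟩

/-- At each point of the orthant `f` equals its own Laguerre sum. Smoothness up to the boundary is
not assumed of `f`; it is inherited from the series. -/
theorem mem_of_laguerreSum_laguerreCoeff_mem {P : Submodule ℂ (orthant d → ℂ)}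
    {f : orthant d → ℂ} (hc : ContinuousOn (zeroExt f) (orthant d))
    (hf : MemLp (zeroExt f) 2 (volume.restrict (orthant d)))
    (ha : RapidlyDecreasing (laguerreCoeff f)) (h : laguerreSum (laguerreCoeff f) ∈ P) : f ∈ P := by
  convert h using 1
  funext x
  have := zeroExt_eqOn_laguerreSeries hc hf ha x.2
  rwa [zeroExt_apply x.2] at this

end

/-! ### The characterization by coefficients and the topological isomorphisms -/

theorem theorem3p3 (d : ℕ) (α : ℝ) (hα : 0 < α) :
    (∀ f : orthant d → ℂ, ContDiffOn ℝ ∞ (zeroExt f) (orthant d) →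
      MemLp (zeroExt f) 2 (volume.restrict (orthant d)) →
        (f ∈ pilipovicUnion d α ↔ laguerreCoeff f ∈ ellUnion d (α / 2)) ∧
        (f ∈ pilipovicInter d α ↔ laguerreCoeff f ∈ ellInter d (α / 2))) ∧
    (∃ T : EllUnion d (α / 2) ≃L[ℂ] PilipovicUnion d α,
      ∀ a, IsLaguerreSum a.seq (T a).fn) ∧
    (∃ T : EllInter d (α / 2) ≃L[ℂ] PilipovicInter d α,
      ∀ a, IsLaguerreSum a.seq (T a).fn) := by
  refine ⟨fun f hf hf2 => ⟨⟨laguerreCoeff_mem_ellUnion hα, fun ha => ?_⟩,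
    ⟨laguerreCoeff_mem_ellInter hα, fun ha => ?_⟩⟩, ?_, ?_⟩
  · exact mem_of_laguerreSum_laguerreCoeff_mem hf.continuousOn hf2
      (rapidlyDecreasing_of_mem_ellUnion hα ha) (laguerreSum_mem_pilipovicUnion hα ha)
  · exact mem_of_laguerreSum_laguerreCoeff_mem hf.continuousOn hf2
      (rapidlyDecreasing_of_mem_ellInter hα ha) (laguerreSum_mem_pilipovicInter hα ha)
  · exact ⟨⟨laguerreEquivUnion d hα, continuous_laguerreEquivUnion d hα,
      continuous_laguerreEquivUnion_symm d hα⟩, fun a =>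
      (rapidlyDecreasing_of_mem_ellUnion hα a.2).isLaguerreSum (zeroExt_laguerreSum a.seq)⟩
  · exact ⟨⟨laguerreEquivInter d hα, continuous_laguerreEquivInter d hα,
      continuous_laguerreEquivInter_symm d hα⟩, fun a =>
      (rapidlyDecreasing_of_mem_ellInter hα a.2).isLaguerreSum (zeroExt_laguerreSum a.seq)⟩
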